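/- **Setting.** A *biquandle* is a set $X$ with binary operations $\circ,\ast$ such that $x\circ x=x\ast x$; for every $y$ the maps $x\mapsto x\ast y$ and $x\mapsto x\circ y$ are bijective; the map $(x,y)\mapsto(y\ast x,x\circ y)$ of $X\times X$ is bijective; and $(x\circ z)\circ(y\circ z)=(x\circ y)\circ(z\ast y)$, $(y\circ z)\ast(x\circ z)=(y\ast x)\circ(z\ast x)$, $(z\ast x)\ast(y\ast x)=(z\ast y)\ast(x\circ y)$. Let $X$ be a finite biquandle. An *$X$-colouring* of an oriented virtual link diagram $L$ assigns an element of $X$ to each edge (and to each circle without classical crossings), virtual crossings being disregarded, such that at every classical crossing the following holds. At a positive crossing let $x$ be the colour of the incoming lower edge and $y$ that of the outgoing upper edge; then the outgoing lower edge has colour $x\circ y$ and the incoming upper edge has colour $y\ast x$. At a negative crossing let $x$ be the colour of the outgoing lower edge and $y$ that of the incoming upper edge; then the incoming lower edge has colour $x\circ y$ and the outgoing upper edge has colour $y\ast x$. The pair $(x,y)$ is the *label* of the crossing. A *framed 4-graph* is a finite 4-valent graph in which the four half-edges at each vertex are split into two pairs of opposite half-edges; circles without vertices are allowed as components. The *first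 Reidemeister move* removes a vertex with a loop formed by two non-opposite half-edges and joins the half-edges opposite to them. The *second Reidemeister move* removes a bigon with two distinct vertices whose two edges are non-opposite at both vertices, each strand through the bigon being kept as a strand. Let $\delta$, $A_{x,y},B_{x,y},C_{x,y},D_{x,y},E_{x,y},F_{x,y}$ $(x,y\in X)$ be variables, and let $R_j=\mathbb Z[\delta,A_{x,y},\dots,F_{x,y}\mid x,y\in X]/I_j$ for $j=1,2$. To describe the ideals $I_j$, put, for $x,y,z\in X$ and $P,Q,R\in\{A,B,C\}$, $$PQR^{l}=P_{x,y}Q_{y,z}R_{x\circ y,z\ast y},\qquad PQR^{r}=P_{x,z}Q_{y\ast x,z\ast x}R_{x\circ z,y\circ z}.$$ $I_2$ is generated by the following polynomials, for all $x,y,z\in X$: * $\delta A_{x,x}+B_{x,x}+C_{x,x}-1$, $\ \delta D_{x,x}+E_{x,x}+F_{x,x}-1$; * $A_{x,y}F_{x,y}+C_{x,y}D_{x,y}$, $\ B_{x,y}F_{x,y}+C_{x,y}E_{x,y}$, $\ A_{x,y}D_{x,y}-B_{x,y}E_{x,y}$, $\ A_{x,y}D_{x,y}+C_{x,y}F_{x,y}-1$,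 $\ \delta A_{x,y}D_{x,y}+A_{x,y}E_{x,y}+B_{x,y}D_{x,y}$; * (common list) $AAA^l+CCA^l-AAA^r-ACC^r$, $\ ABB^l+CBC^l-BBA^r-CBC^r$, $\ BAB^l+BCC^l-BAB^r-CCB^r$, $\ ACA^l+CAA^l-CAA^r$, $\ AAC^l-AAC^r-ACA^r$, $\ ACB^l-BBC^r-CBA^r$, $\ BCB^l+BAC^l-BAC^r$, $\ ABC^l+CBB^l-BCA^r$, $\ CAB^l-BCB^r-CAB^r$, $\ CCB^l-BCC^r$, $\ ACC^l-CCA^r$, $\ CAC^l-CAC^r$, $\ CCC^l$, $\ CCC^r$; * $AAB^l-(ABA^r+AAB^r+\delta ABB^r+BBB^r+ABC^r+ACB^r+CBB^r)$, $\ BAA^r-(BAA^l+ABA^l+\delta BBA^l+BBB^l+BCA^l+CBA^l+BBC^l)$. $I_1$ is generated by the following polynomials, for all $x,y,z\in X$: * $\delta A_{x,x}+B_{x,x}-1$, $\ \delta D_{x,x}+E_{x,x}-1$, $\ C_{x,x}$, $\ F_{x,x}$; * $A_{x,y}F_{x,y}$, $\ C_{x,y}D_{x,y}$, $\ B_{x,y}F_{x,y}$,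 $\ C_{x,y}E_{x,y}$, $\ A_{x,y}D_{x,y}-B_{x,y}E_{x,y}$, $\ A_{x,y}D_{x,y}+C_{x,y}F_{x,y}-1$, $\ \delta A_{x,y}D_{x,y}+A_{x,y}E_{x,y}+B_{x,y}D_{x,y}$; * the common list above, and $BCA^l$, $CBA^l$, $BBC^l$, $ABC^r$, $ACB^r$, $CBB^r$; * $AAB^l-(ABA^r+AAB^r+\delta ABB^r+BBB^r)$, $\ BAA^r-(BAA^l+ABA^l+\delta BBA^l+BBB^l)$. Let $R_j\mathfrak G_{j,\delta}$ be the quotient of the free $R_j$-module on the isomorphism classes of framed 4-graphs by the relations $G=G'$ whenever $G,G'$ differ by a second Reidemeister move (for $j=1$), or by a first or second Reidemeister move (for $j=2$), and $G\sqcup\bigcirc=\delta G$ for every non-empty framed 4-graph $G$. A *state* of $L$ chooses, at each classical crossing, the smoothing that respects the orientation, the other smoothing, or a graphical vertex (in which the half-edges of each strand are opposite). It yields a framed 4-graph. The choice at a crossing with label $(x,y)$ has the coefficient $A_{x,y}$, $B_{x,y}$, $C_{x,y}$ respectively if the crossing is positive, and $D_{x,y}$, $E_{x,y}$, $F_{x,y}$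 respectively if it is negative. For an $X$-colouring $f$ of $L$, let $[[L]](f)_j\in R_j\mathfrak G_{j,\delta}$ be the sum over all states of the product of the coefficients times the class of the framed 4-graph of the state. The *parity-biquandle bracket multiset* of $L$ is the multiset $$[[L]](X)_j=\{\,[[L]](f)_j \mid f \text{ an } X\text{-colouring of } L\,\}.$$ **Theorem.** Let $X$ be a finite biquandle and $j\in\{1,2\}$. If two oriented virtual link diagrams $L_1$ and $L_2$ represent the same oriented virtual link, that is, if they are related by planar isotopies and oriented generalised Reidemeister moves (the oriented classical Reidemeister moves and the detour move), then $[[L_1]](X)_j=[[L_2]](X)_j$. So the parity-biquandle bracket multiset is an invariant of oriented virtual links. -/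

import Mathlib

/-! ### Biquandles -/

/-- A biquandle: a set with two binary operations `circ` (written `∘` in the literature) and
`star` (written `∗`). -/
class Biquandle (X : Type*) where
  circ : X → X → X
  star : X → X → X
  circ_self : ∀ x, circ x x = star x x
  star_bijective : ∀ y, Function.Bijective fun x => star x y
  circ_bijective : ∀ y, Function.Bijective fun x => circ x y
  sideways_bijective :
    Function.Bijective fun p : X × X => (star p.2 p.1, circ p.1 p.2)
  exchange₁ : ∀ x y z, circ (circ x z) (circ y z) = circ (circ x y) (star z y)
  exchange₂ : ∀ x y z, star (circ y z) (circ x z) = circ (star y x) (star z x)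
  exchange₃ : ∀ x y z, star (star z x) (star y x) = star (star z y) (circ x y)

/-! ### Oriented virtual link diagrams -/

/-- An oriented virtual link diagram, combinatorially.

There are classical crossings, each with a sign (`positive c = true` for a positive crossing),
virtual crossings, and marks; a mark is an auxiliary two-valent point on an edge. Marks have no
meaning, but they allow a circle without crossings to be represented by a circle with marks.

Each crossing is passed twice. The passes through a classical crossing `c` are
`Sum.inl (c, true)` (the upper one) and `Sum.inl (c, false)` (the lower one); those through a
virtual crossing `v` are `Sum.inr (Sum.inl (v, b))`; a mark is passed once. The permutation `next`
sends a pass to the one that follows it along the orientation of the link, so its cycles are the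
components of the link, and the edges are the ordered pairs `(p, next p)`.

The cyclic order of the four half-edges at a classical crossing is determined by the orientation,
the upper and the lower pass, and the sign. A planar picture of the diagram is not part of the
data, and none is required to exist: every diagram drawn in the plane gives such data, planar
isotopic diagrams give isomorphic data, and each move between planar diagrams is composed of the
moves below. -/
structure VirtualLinkDiagram where
  Crossing : Type
  Virtual : Type
  Mark : Type
  [fintypeCrossing : Fintype Crossing]
  [fintypeVirtual : Fintype Virtual]
  [fintypeMark : Fintype Mark]
  positive : Crossing → Bool
  next : Equiv.Perm (Crossing × Bool ⊕ Virtual × Bool ⊕ Mark)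

namespace VirtualLinkDiagram

attribute [instance] fintypeCrossing fintypeVirtual fintypeMark

/-- The passes of a diagram; also its edges, a pass standing for the edge that leaves it. -/
abbrev Pass (D : VirtualLinkDiagram) : Type :=
  D.Crossing × Bool ⊕ D.Virtual × Bool ⊕ D.Mark

/-- The upper pass through a classical crossing. -/
abbrev upper (D : VirtualLinkDiagram) (c : D.Crossing) : D.Pass := Sum.inl (c, true)

/-- The lower pass through a classical crossing. -/
abbrev lower (D : VirtualLinkDiagram) (c : D.Crossing) : D.Pass := Sum.inl (c, false)

/-- The map of passes induced by maps of classical crossings, virtual crossings and marks. -/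
abbrev passMap {D D' : VirtualLinkDiagram} (crossing : D'.Crossing → D.Crossing)
    (virtual : D'.Virtual → D.Virtual) (mark : D'.Mark → D.Mark) : D'.Pass → D.Pass :=
  Sum.map (Prod.map crossing id) (Sum.map (Prod.map virtual id) mark)

/-- `Deletion D D' S T`: the diagram `D'` is obtained from `D`, up to renaming, by deleting the
classical crossings in `S`, the virtual crossings in `T`, and some marks, so that every component
runs straight through the places where it has been deleted. -/
structure Deletion (D D' : VirtualLinkDiagram) (S : Set D.Crossing) (T : Set D.Virtual) where
  crossing : D'.Crossing → D.Crossing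
  virtual : D'.Virtual → D.Virtual
  mark : D'.Mark → D.Mark
  crossing_injective : Function.Injective crossing
  virtual_injective : Function.Injective virtual
  mark_injective : Function.Injective mark
  range_crossing : Set.range crossing = Sᶜ
  range_virtual : Set.range virtual = Tᶜ
  positive_crossing : ∀ c, D.positive (crossing c) = D'.positive c
  /-- The successor of a pass in `D'` is the first surviving pass after it in `D`. -/
  next_pass : ∀ p, ∃ n : ℕ,
    D.next^[n + 1] (passMap crossing virtual mark p) =
      passMap crossing virtual mark (D'.next p) ∧
    ∀ i < n, D.next^[i + 1] (passMap crossing virtual mark p) ∉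
      Set.range (passMap crossing virtual mark)
  /-- No component of `D` disappears. -/
  meets : ∀ q, ∃ n : ℕ, D.next^[n] q ∈ Set.range (passMap crossing virtual mark)

/-- The diagram in which the passes `p` of `D` have been renamed to `τ p`; the crossings, their
signs, and which passes belong to them stay as they are. -/
def rename (D : VirtualLinkDiagram) (τ : Equiv.Perm D.Pass) : VirtualLinkDiagram :=
  { D with next := τ * D.next * τ⁻¹ }

open Classical in
/-- The generalised oriented Reidemeister moves. -/
inductive Move : VirtualLinkDiagram → VirtualLinkDiagram → Prop
  /-- Virtual crossings and marks are deleted (for none of them: the diagrams are isomorphic).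
  A detour move deletes the virtual crossings on an arc in this way, and then creates those on the
  new arc by the reverse of this. -/
  | detour {D D' : VirtualLinkDiagram} {T : Set D.Virtual} (d : Deletion D D' ∅ T) : Move D D'
  /-- First move: a kink, with any sign, and with the upper or the lower pass first. -/
  | omega₁ {D D' : VirtualLinkDiagram} (c : D.Crossing)
      (hc : D.next (D.upper c) = D.lower c ∨ D.next (D.lower c) = D.upper c)
      (d : Deletion D D' {c} ∅) : Move D D'
  /-- Second move: two crossings of opposite signs such that both upper and both lower passes are
  adjacent, the strands having the same direction or opposite directions. -/
  | omega₂ {D D' : VirtualLinkDiagram} (c₁ c₂ : D.Crossing)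
      (sign : D.positive c₁ ≠ D.positive c₂)
      (hover : D.next (D.upper c₁) = D.upper c₂)
      (hunder : D.next (D.lower c₁) = D.lower c₂ ∨ D.next (D.lower c₂) = D.lower c₁)
      (d : Deletion D D' {c₁, c₂} ∅) : Move D D'
  /-- Third move. The strand `i` lies under the strand `j`, which lies under the strand `k`; these
  cross in `ij`, `ik` and `jk`. If all three strands point upwards then all signs are equal, `i`
  meets `j` before `k`, `j` meets `i` before `k`, and `k` meets `i` before `j`, or the other way
  round on all three. Reversing a strand reverses the order on it and changes the signs of its two
  crossings; `oi`, `oj` and `ok` tell which strands have been reversed. The move exchanges the two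
  passes on each of the strands. -/
  | omega₃ {D : VirtualLinkDiagram} (ij ik jk : D.Crossing) (oi oj ok : Bool)
      (h₁ : ij ≠ ik) (h₂ : ij ≠ jk) (h₃ : ik ≠ jk)
      (sign₁ : D.positive ij = D.positive ik ↔ oj = ok)
      (sign₂ : D.positive ij = D.positive jk ↔ oi = ok)
      (sign₃ : D.positive ik = D.positive jk ↔ oi = oj)
      (hi : if oi then D.next (D.lower ij) = D.lower ik else D.next (D.lower ik) = D.lower ij)
      (hj : if oj then D.next (D.upper ij) = D.lower jk else D.next (D.lower jk) = D.upper ij)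
      (hk : if ok then D.next (D.upper ik) = D.upper jk else D.next (D.upper jk) = D.upper ik) :
      Move D (D.rename (Equiv.swap (D.lower ij) (D.lower ik) *
        Equiv.swap (D.upper ij) (D.lower jk) * Equiv.swap (D.upper ik) (D.upper jk)))

/-- Two oriented virtual link diagrams represent the same oriented virtual link. -/
def SameLink (D D' : VirtualLinkDiagram) : Prop :=
  Relation.EqvGen Move D D'

section Colouring

variable {X : Type*} (D : VirtualLinkDiagram)

/-- For a map `f` from the edges to `X`, the colours `(x, y)` at the crossing `c` to which the
crossing relation is applied: that of the incoming lower and that of the outgoing upper edge at a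
positive crossing, that of the outgoing lower and that of the incoming upper edge at a negative
one. In both cases these two edges are on the right-hand side of the crossing, if its strands point
upwards. -/
def label (f : D.Pass → X) (c : D.Crossing) : X × X :=
  if D.positive c then (f (D.next.symm (D.lower c)), f (D.upper c))
  else (f (D.lower c), f (D.next.symm (D.upper c)))

/-- The colours of the other two edges at `c`, first the lower one, then the upper one. -/
def oppositeLabel (f : D.Pass → X) (c : D.Crossing) : X × X :=
  if D.positive c then (f (D.lower c), f (D.next.symm (D.upper c)))
  else (f (D.next.symm (D.lower c)), f (D.upper c))

/-- A biquandle colouring: a lower edge `x` becomes `x ∘ y` and an upper edge `y` becomes `y ∗ x`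
on the other side of a classical crossing. The colour does not change at a virtual crossing or at
a mark. -/
def IsColouring [Biquandle X] (f : D.Pass → X) : Prop :=
  (∀ c, D.oppositeLabel f c =
    (Biquandle.circ (D.label f c).1 (D.label f c).2,
      Biquandle.star (D.label f c).2 (D.label f c).1)) ∧
  ∀ q : D.Virtual × Bool ⊕ D.Mark, f (D.next.symm (Sum.inr q)) = f (Sum.inr q)

/-- The set of `X`-colourings of a diagram. -/
abbrev Colouring (X : Type*) [Biquandle X] : Type _ :=
  {f : D.Pass → X // D.IsColouring f}

end Colouring

end VirtualLinkDiagram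

/-! ### Framed 4-graphs -/

/-- A finite four-valent graph with a cross structure (a framed 4-graph); circles without vertices
are allowed as components.

Points may be placed on edges and circles as two-valent vertices. The involution `edge` joins the
half-edges in pairs to edges. The involution `opp` exchanges opposite half-edges at a four-valent
vertex, and the two half-edges at a two-valent point. The half-edges at the four-valent vertex `v`
are the `half (v, s, e)`; the Boolean `s` distinguishes the two pairs of opposite half-edges. The
other half-edges are those at the two-valent points. -/
structure FramedGraph where
  Half : Type
  Vertex : Type
  [finiteHalf : Finite Half]
  edge : Half → Half
  edge_edge : ∀ h, edge (edge h) = h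
  edge_ne : ∀ h, edge h ≠ h
  opp : Half → Half
  opp_opp : ∀ h, opp (opp h) = h
  opp_ne : ∀ h, opp h ≠ h
  half : Vertex × Bool × Bool → Half
  half_injective : Function.Injective half
  opp_half : ∀ v s e, opp (half (v, s, e)) = half (v, s, !e)

namespace FramedGraph

/-- The half-edges at a four-valent vertex. -/
def star (G : FramedGraph) (v : G.Vertex) : Set G.Half :=
  Set.range fun i : Bool × Bool => G.half (v, i)

/-- `Homeo G G'`: up to isomorphism, `G'` is obtained from `G` by forgetting some (possibly no)
two-valent points, at least one being kept on each circle. -/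
structure Homeo (G G' : FramedGraph) where
  toHalf : G'.Half → G.Half
  toVertex : G'.Vertex ≃ G.Vertex
  toHalf_injective : Function.Injective toHalf
  image_star : ∀ v, toHalf '' G'.star v = G.star (toVertex v)
  opp_toHalf : ∀ h, G.opp (toHalf h) = toHalf (G'.opp h)
  /-- Starting along an edge, the first remaining half-edge that is met is the end of the edge
  of `G'`. -/
  edge_toHalf : ∀ h, ∃ n : ℕ,
    G.edge ((G.opp ∘ G.edge)^[n] (toHalf h)) = toHalf (G'.edge h) ∧
    ∀ i < n, G.edge ((G.opp ∘ G.edge)^[i] (toHalf h)) ∉ Set.range toHalf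
  meets : ∀ k, ∃ n : ℕ, (G.opp ∘ G.edge)^[n] k ∈ Set.range toHalf

/-- Each of the four-valent vertices in `S` is resolved into two two-valent points, so that
opposite half-edges continue each other. -/
def resolve (G : FramedGraph) (S : Set G.Vertex) : FramedGraph where
  Half := G.Half
  Vertex := {v // v ∉ S}
  finiteHalf := G.finiteHalf
  edge := G.edge
  edge_edge := G.edge_edge
  edge_ne := G.edge_ne
  opp := G.opp
  opp_opp := G.opp_opp
  opp_ne := G.opp_ne
  half := fun i => G.half (i.1.1, i.2)
  half_injective := by
    rintro ⟨⟨v, hv⟩, i⟩ ⟨⟨w, hw⟩, k⟩ h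
    have := G.half_injective h
    simp only [Prod.mk.injEq] at this
    simp [this]
  opp_half := fun v s e => G.opp_half v.1 s e

/-- The disjoint union of `G` and a circle (with one two-valent point). -/
def addCircle (G : FramedGraph) : FramedGraph where
  Half := G.Half ⊕ Bool
  Vertex := G.Vertex
  finiteHalf := by
    have := G.finiteHalf
    infer_instance
  edge := Sum.map G.edge not
  edge_edge := by rintro (h | b) <;> simp [G.edge_edge]
  edge_ne := by rintro (h | b) <;> simp [G.edge_ne]
  opp := Sum.map G.opp not
  opp_opp := by rintro (h | b) <;> simp [G.opp_opp]
  opp_ne := by rintro (h | b) <;> simp [G.opp_ne]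
  half := fun i => Sum.inl (G.half i)
  half_injective := Sum.inl_injective.comp G.half_injective
  opp_half := fun v s e => by simp [G.opp_half]

end FramedGraph

/-- The two versions of the bracket: graphs modulo the second Reidemeister move, and graphs modulo
the first and the second one. -/
inductive Version
  | one
  | two

namespace FramedGraph

/-- The relations between framed 4-graphs in the given version, except that for circles. -/
inductive Move : Version → FramedGraph → FramedGraph → Prop
  | homeo {j : Version} {G G' : FramedGraph} (φ : Homeo G G') : Move j G G'
  /-- First move: two non-opposite half-edges at `v` form a loop. The loop is removed, and the
  opposite half-edges are joined. -/
  | omega₁ {G : FramedGraph} (v : G.Vertex) (a : G.Half)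
      (ha : a ∈ G.star v) (ha' : G.edge a ∈ G.star v) (hne : G.edge a ≠ G.opp a) :
      Move Version.two G (G.resolve {v})
  /-- Second move: two edges form a bigon with vertices `u` and `v`, and are opposite neither at
  `u` nor at `v`. The bigon is removed, and the strands through it remain. -/
  | omega₂ {j : Version} {G : FramedGraph} (u v : G.Vertex) (a b : G.Half) (huv : u ≠ v)
      (ha : a ∈ G.star u) (hb : b ∈ G.star u)
      (ha' : G.edge a ∈ G.star v) (hb' : G.edge b ∈ G.star v)
      (hne : a ≠ b) (hopp : b ≠ G.opp a) (hopp' : G.edge b ≠ G.opp (G.edge a)) :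
      Move j G (G.resolve {u, v})

end FramedGraph

/-! ### The coefficient rings -/

/-- The variables: the formal variable `δ`, and `A_{x,y}, …, F_{x,y}` for `x, y ∈ X`. -/
inductive BracketVar (X : Type*)
  | delta
  | A (x y : X)
  | B (x y : X)
  | C (x y : X)
  | D (x y : X)
  | E (x y : X)
  | F (x y : X)

namespace BracketRing

/-- The polynomial ring over the integers in the variables above. -/
abbrev Poly (X : Type*) : Type _ := MvPolynomial (BracketVar X) ℤ

section

variable {X : Type*}

noncomputable def δ : Poly X := MvPolynomial.X BracketVar.delta
noncomputable def A (x y : X) : Poly X := MvPolynomial.X (BracketVar.A x y)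
noncomputable def B (x y : X) : Poly X := MvPolynomial.X (BracketVar.B x y)
noncomputable def C (x y : X) : Poly X := MvPolynomial.X (BracketVar.C x y)
noncomputable def D (x y : X) : Poly X := MvPolynomial.X (BracketVar.D x y)
noncomputable def E (x y : X) : Poly X := MvPolynomial.X (BracketVar.E x y)
noncomputable def F (x y : X) : Poly X := MvPolynomial.X (BracketVar.F x y)

end

/-- The generators with one parameter. -/
def gens₁ {X : Type*} (x : X) : Version → Set (Poly X)
  | Version.one =>
    {δ * A x x + B x x - 1, δ * D x x + E x x - 1, C x x, F x x}
  | Version.two =>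
    {δ * A x x + B x x + C x x - 1, δ * D x x + E x x + F x x - 1}

/-- The generators with two parameters. -/
def gens₂ {X : Type*} (x y : X) : Version → Set (Poly X)
  | Version.one =>
    {A x y * F x y, C x y * D x y, B x y * F x y, C x y * E x y,
      A x y * D x y - B x y * E x y,
      A x y * D x y + C x y * F x y - 1,
      δ * A x y * D x y + A x y * E x y + B x y * D x y}
  | Version.two =>
    {A x y * F x y + C x y * D x y, B x y * F x y + C x y * E x y,
      A x y * D x y - B x y * E x y,
      A x y * D x y + C x y * F x y - 1,
      δ * A x y * D x y + A x y * E x y + B x y * D x y}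

/-- The product of `P_{x,y}`, `Q_{y,z}` and `R_{x∘y,z∗y}`. -/
noncomputable def lhs {X : Type*} [Biquandle X] (x y z : X) (P Q R : X → X → Poly X) : Poly X :=
  P x y * Q y z * R (Biquandle.circ x y) (Biquandle.star z y)

/-- The product of `P_{x,z}`, `Q_{y∗x,z∗x}` and `R_{x∘z,y∘z}`. -/
noncomputable def rhs {X : Type*} [Biquandle X] (x y z : X) (P Q R : X → X → Poly X) : Poly X :=
  P x z * Q (Biquandle.star y x) (Biquandle.star z x) *
    R (Biquandle.circ x z) (Biquandle.circ y z)

/-- The generators with three parameters that occur in both versions. -/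
def gens₃Common {X : Type*} [Biquandle X] (x y z : X) : Set (Poly X) :=
  let l := lhs x y z
  let r := rhs x y z
  {l A A A + l C C A - (r A A A + r A C C),
    l A B B + l C B C - (r B B A + r C B C),
    l B A B + l B C C - (r B A B + r C C B),
    l A C A + l C A A - r C A A,
    l A A C - (r A A C + r A C A),
    l A C B - (r B B C + r C B A),
    l B C B + l B A C - r B A C,
    l A B C + l C B B - r B C A,
    l C A B - (r B C B + r C A B),
    l C C B - r B C C,
    l A C C - r C C A,
    l C A C - r C A C,
    l C C C,
    r C C C}

/-- The generators with three parameters. -/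
def gens₃ {X : Type*} [Biquandle X] (x y z : X) : Version → Set (Poly X)
  | Version.one =>
    let l := lhs x y z
    let r := rhs x y z
    gens₃Common x y z ∪
      {l B C A, l C B A, l B B C, r A B C, r A C B, r C B B,
        l A A B - (r A B A + r A A B + δ * r A B B + r B B B),
        r B A A - (l B A A + l A B A + δ * l B B A + l B B B)}
  | Version.two =>
    let l := lhs x y z
    let r := rhs x y z
    gens₃Common x y z ∪
      {l A A B - (r A B A + r A A B + δ * r A B B + r B B B + r A B C + r A C B + r C B B),
        r B A A - (l B A A + l A B A + δ * l B B A + l B B B + l B C A + l C B A + l B B C)}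

/-- The ideal `I_j`. -/
noncomputable def relations (X : Type*) [Biquandle X] (j : Version) : Ideal (Poly X) :=
  Ideal.span ((⋃ x, gens₁ x j) ∪ (⋃ (x) (y), gens₂ x y j) ∪ ⋃ (x) (y) (z), gens₃ x y z j)

end BracketRing

/-- The ring `R_j`. -/
abbrev BracketRing (X : Type*) [Biquandle X] (j : Version) : Type _ :=
  BracketRing.Poly X ⧸ BracketRing.relations X j

/-! ### The module of pictures -/

/-- The relations in the free `R_j`-module on framed 4-graphs: the moves, and `G ⊔ ○ = δ G` for
non-empty `G`. -/
noncomputable def pictureRelations (X : Type*) [Biquandle X] (j : Version) :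
    Submodule (BracketRing X j) (FramedGraph →₀ BracketRing X j) :=
  Submodule.span (BracketRing X j)
    ({v | ∃ G G' : FramedGraph, FramedGraph.Move j G G' ∧
        v = Finsupp.single G 1 - Finsupp.single G' 1} ∪
      {v | ∃ G : FramedGraph, Nonempty G.Half ∧
        v = Finsupp.single G.addCircle 1 -
          Finsupp.single G (Ideal.Quotient.mk (BracketRing.relations X j) BracketRing.δ)})

/-- The module `R_j 𝔊_{j,δ}` of linear combinations of framed 4-graphs. -/
abbrev PictureModule (X : Type*) [Biquandle X] (j : Version) : Type _ :=
  (FramedGraph →₀ BracketRing X j) ⧸ pictureRelations X j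

/-- The class of a framed 4-graph. -/
noncomputable def picture (X : Type*) [Biquandle X] (j : Version) (G : FramedGraph) :
    PictureModule X j :=
  (pictureRelations X j).mkQ (Finsupp.single G 1)

/-! ### The bracket -/

/-- What is done at a classical crossing in a state: it is smoothed respecting the orientation
(variables `A` and `D`), smoothed in the other way (variables `B` and `E`), or replaced by a
graphical vertex (variables `C` and `F`). -/
inductive Smoothing
  | oriented
  | unoriented
  | vertex
  deriving DecidableEq

instance : Fintype Smoothing where
  elems := {Smoothing.oriented, Smoothing.unoriented, Smoothing.vertex}
  complete := by rintro (_ | _ | _) <;> simp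

/-- The coefficient in the skein relation at a positive (`true`) or negative (`false`) crossing. -/
noncomputable def skein {X : Type*} : Bool → Smoothing → X → X → BracketRing.Poly X
  | true, Smoothing.oriented => BracketRing.A
  | true, Smoothing.unoriented => BracketRing.B
  | true, Smoothing.vertex => BracketRing.C
  | false, Smoothing.oriented => BracketRing.D
  | false, Smoothing.unoriented => BracketRing.E
  | false, Smoothing.vertex => BracketRing.F

namespace VirtualLinkDiagram

variable (D : VirtualLinkDiagram)

/-- The half-edges of a state are `(p, false)`, by which the pass `p` is entered, and `(p, true)`,
by which it is left. -/
def stateEdge : D.Pass × Bool → D.Pass × Bool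
  | (p, true) => (D.next p, false)
  | (p, false) => (D.next.symm p, true)

/-- How the half-edges at each place are connected in the state `s`. At a graphical vertex, at a
virtual crossing and at a mark, one goes straight on. In an oriented smoothing each incoming
half-edge is connected to the outgoing one of the other strand; in an unoriented one the two
incoming half-edges are connected, and so are the outgoing ones. -/
def stateOpp (s : D.Crossing → Smoothing) : D.Pass × Bool → D.Pass × Bool
  | (Sum.inl (c, b), e) =>
    match s c with
    | Smoothing.oriented => (Sum.inl (c, !b), !e)
    | Smoothing.unoriented => (Sum.inl (c, !b), e)
    | Smoothing.vertex => (Sum.inl (c, b), !e)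
  | (Sum.inr q, e) => (Sum.inr q, !e)

/-- The framed 4-graph of a state. -/
def stateGraph (s : D.Crossing → Smoothing) : FramedGraph where
  Half := D.Pass × Bool
  Vertex := {c // s c = Smoothing.vertex}
  edge := D.stateEdge
  edge_edge := by rintro ⟨p, _ | _⟩ <;> simp [stateEdge]
  edge_ne := by rintro ⟨p, _ | _⟩ <;> simp [stateEdge]
  opp := D.stateOpp s
  opp_opp := by
    rintro ⟨⟨c, b⟩ | q, e⟩
    · cases h : s c <;> simp [stateOpp, h]
    · simp [stateOpp]
  opp_ne := by
    rintro ⟨⟨c, b⟩ | q, e⟩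
    · cases h : s c <;> simp [stateOpp, h]
    · simp [stateOpp]
  half := fun i => (Sum.inl (i.1.1, i.2.1), i.2.2)
  half_injective := by
    rintro ⟨⟨c, hc⟩, b, e⟩ ⟨⟨c', hc'⟩, b', e'⟩ h
    simp only [Prod.mk.injEq, Sum.inl.injEq] at h
    simp [h]
  opp_half := by
    rintro ⟨c, hc⟩ s e
    simp [stateOpp, hc]

open Classical in
/-- The bracket `[[L]](f)_j`: the sum over the `3 ^ n` states of the products of the coefficients
with the classes of the resulting graphs. As `G ⊔ ○ = δ G` in the module, the circles of a state
contribute the powers of `δ`. -/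
noncomputable def bracket {X : Type*} [Biquandle X] (j : Version) (f : D.Pass → X) :
    PictureModule X j :=
  ∑ s : D.Crossing → Smoothing,
    (Ideal.Quotient.mk (BracketRing.relations X j)
      (∏ c, skein (D.positive c) (s c) (D.label f c).1 (D.label f c).2)) •
        picture X j (D.stateGraph s)

open Classical in
/-- The parity-biquandle bracket multiset `[[L]](X)_j`. -/
noncomputable def bracketMultiset (X : Type*) [Biquandle X] [Fintype X] (j : Version) :
    Multiset (PictureModule X j) :=
  (Finset.univ : Finset (D.Colouring X)).val.map fun f => D.bracket j f.1

end VirtualLinkDiagram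

/-! The bracket is a sum over states, so each Reidemeister move splits into a local statement about
colourings and a local statement about pictures.

Colourings: given a colouring of one side of a move, its restriction to the outside of the move
extends in exactly one way over the other side. For the first move this comes from `circ_self` and
the sideways bijection on a finite set (`kink_existsUnique`), for the second from the bijectivity
axioms (`clasp_existsUnique`), for the third from the exchange laws (`triangle_true_existsUnique`,
`triangle_false_existsUnique`). The labels of the crossings outside do not change, and those inside
are exactly the ones that occur in the generators of the ideal.

Pictures: with the outside fixed, the weighted sum over the smoothings of the crossings of the move
is the same on both sides (`kink_skein`, `clasp_skein`, `triangle_skein`). Every local state is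
brought to a normal form by homeomorphisms, by splitting off a circle at the price of `δ`, and by
the moves of framed graphs; the total coefficients of each normal form agree by a relation in the
coefficient ring. In version one there is no first move of graphs, but the states that would need it
have coefficient zero.

To make "local" precise, the graph of a state is cut into an exterior and a small tangle with at
most three crossings (`nonempty_homeo_stateGraph`). Of such a tangle only the way in which its ends
and vertices are joined by paths matters, and this is a finite computation done by `decide`. Virtual
crossings and planarity play no part, as the graph of a state is read off from `next`; a detour is a
deletion with no classical crossing.

For the third move only one case is computed: all strands upwards and all crossings positive. The
other orientations and signs follow from it by second moves (`ThirdInvariant.all`). A cancelling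
pair of crossings is inserted opposite to one crossing of the triangle, the move is made across the
triangle with two strands reversed, and another cancelling pair is removed. -/

/-! ### Tangles of framed 4-graphs -/

/-- A framed 4-graph with free ends indexed by `P`. -/
structure Tangle (P : Type) where
  Half : Type
  Vertex : Type
  [finiteHalf : Finite Half]
  edge : Half ⊕ P → Half ⊕ P
  edge_edge : ∀ h, edge (edge h) = h
  edge_ne : ∀ h, edge h ≠ h
  opp : Half → Half
  opp_opp : ∀ h, opp (opp h) = h
  opp_ne : ∀ h, opp h ≠ h
  half : Vertex × Bool × Bool → Half
  half_injective : Function.Injective half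
  opp_half : ∀ v s e, opp (half (v, s, e)) = half (v, s, !e)

attribute [instance] FramedGraph.finiteHalf Tangle.finiteHalf

/-- The image of a range, if the two families correspond to each other up to a reparametrization. -/
theorem Set.image_range_eq_range {α β ι : Type*} {e : α → β} {a : ι → α} {b : ι → β} (g : ι → ι)
    (hg : Function.Surjective g) (h : ∀ i, e (a i) = b (g i)) : e '' Set.range a = Set.range b := by
  rw [← Set.range_comp, ← hg.range_comp b]
  exact congrArg Set.range (funext h)

namespace Tangle

variable {P : Type}

/-- The half-edges at a vertex of a tangle. -/
def star (T : Tangle P) (v : T.Vertex) : Set T.Half :=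
  Set.range fun i : Bool × Bool => T.half (v, i)

/-- The map that exchanges opposite half-edges after two tangles have been glued. -/
def glueOpp (O T : Tangle P) :
    (O.Half ⊕ P) ⊕ (T.Half ⊕ P) → (O.Half ⊕ P) ⊕ (T.Half ⊕ P)
  | Sum.inl (Sum.inl h) => Sum.inl (Sum.inl (O.opp h))
  | Sum.inl (Sum.inr p) => Sum.inr (Sum.inr p)
  | Sum.inr (Sum.inl h) => Sum.inr (Sum.inl (T.opp h))
  | Sum.inr (Sum.inr p) => Sum.inl (Sum.inr p)

/-- The framed 4-graph obtained by gluing two tangles along their free ends; there is a two-valent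
point at each of the places where they meet. -/
abbrev glue [Finite P] (O T : Tangle P) : FramedGraph where
  Half := (O.Half ⊕ P) ⊕ (T.Half ⊕ P)
  Vertex := O.Vertex ⊕ T.Vertex
  edge := Sum.map O.edge T.edge
  edge_edge := by rintro (h | h) <;> simp [O.edge_edge, T.edge_edge]
  edge_ne := by rintro (h | h) <;> simp [O.edge_ne, T.edge_ne]
  opp := glueOpp O T
  opp_opp := by rintro ((h | h) | (h | h)) <;> simp [glueOpp, O.opp_opp, T.opp_opp]
  opp_ne := by rintro ((h | h) | (h | h)) <;> simp [glueOpp, O.opp_ne, T.opp_ne]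
  half := fun i => match i.1 with
    | Sum.inl v => Sum.inl (Sum.inl (O.half (v, i.2)))
    | Sum.inr v => Sum.inr (Sum.inl (T.half (v, i.2)))
  half_injective := by
    rintro ⟨v | v, i⟩ ⟨w | w, l⟩ h
    · simp only [Sum.inl.injEq] at h
      have := O.half_injective h
      simp_all
    · simp at h
    · simp at h
    · simp only [Sum.inl.injEq, Sum.inr.injEq] at h
      have := T.half_injective h
      simp_all
  opp_half := by
    rintro (v | v) s e <;> simp [glueOpp, O.opp_half, T.opp_half]

/-- `T.Reaches K x y`: starting along the edge at `x`, the first end or half-edge in `K` that is met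
is `y`. -/
inductive Reaches (T : Tangle P) (K : Set T.Half) : T.Half ⊕ P → T.Half ⊕ P → Prop
  | port {x p} (h : T.edge x = Sum.inr p) : Reaches T K x (Sum.inr p)
  | kept {x h} (hx : T.edge x = Sum.inl h) (hK : h ∈ K) : Reaches T K x (Sum.inl h)
  | step {x h y} (hx : T.edge x = Sum.inl h) (hK : h ∉ K)
      (r : Reaches T K (Sum.inl (T.opp h)) y) : Reaches T K x y

/-- Each step of a path is forced by the one before it. This is what later identifies the edges of
`core`, which are obtained by choice, with paths found by computation. -/
theorem Reaches.unique {T : Tangle P} {K : Set T.Half} {x y z : T.Half ⊕ P}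
    (h : T.Reaches K x y) (h' : T.Reaches K x z) : y = z := by
  induction h with
  | port h =>
    cases h' with
    | port h' => rw [← h, h']
    | kept h' _ => rw [← h, h']
    | step h' => rw [h] at h'; cases h'
  | kept h hK =>
    cases h' with
    | port h' => rw [← h, h']
    | kept h' _ => rw [← h, h']
    | step h' hK' => rw [h] at h'; cases h'; exact absurd hK hK'
  | step h hK _ ih =>
    cases h' with
    | port h' => rw [h] at h'; cases h'
    | kept h' hK' => rw [h] at h'; cases h'; exact absurd hK' hK
    | step h' _ r' => rw [h] at h'; cases h'; exact ih r'

theorem Reaches.mem_range {T : Tangle P} {H : Type} {e : H → T.Half} {x y : T.Half ⊕ P}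
    (h : T.Reaches (Set.range e) x y) : y ∈ Set.range (Sum.map e (id : P → P)) := by
  induction h with
  | port h => exact ⟨Sum.inr _, rfl⟩
  | kept h hK =>
    obtain ⟨l, rfl⟩ := hK
    exact ⟨Sum.inl l, rfl⟩
  | step _ _ _ ih => exact ih

/-- In a glued graph one follows the paths of the inner tangle. -/
theorem Reaches.exists_iterate [Finite P] {O T : Tangle P} {K : Set T.Half} {x y : T.Half ⊕ P}
    (h : T.Reaches K x y) :
    ∃ n : ℕ, (glue O T).edge (((glue O T).opp ∘ (glue O T).edge)^[n] (Sum.inr x)) = Sum.inr y ∧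
      ∀ i < n, ∃ l, l ∉ K ∧ (glue O T).edge (((glue O T).opp ∘ (glue O T).edge)^[i] (Sum.inr x)) =
        Sum.inr (Sum.inl l) := by
  induction h with
  | port h => exact ⟨0, by simp [glue, h]⟩
  | kept h hK => exact ⟨0, by simp [glue, h]⟩
  | @step x h y hx hK _ ih =>
    obtain ⟨n, hn, hi⟩ := ih
    have key : ∀ i, ((glue O T).opp ∘ (glue O T).edge)^[i + 1] (Sum.inr x) =
        ((glue O T).opp ∘ (glue O T).edge)^[i] (Sum.inr (Sum.inl (T.opp h))) := by
      intro i
      rw [Function.iterate_succ_apply]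
      congr 1
      simp [glue, hx, glueOpp]
    refine ⟨n + 1, by rw [key, hn], ?_⟩
    rintro (_ | i) h'
    · exact ⟨h, hK, by simp [glue, hx]⟩
    · rw [key]
      exact hi i (by omega)

/-- `Reduction T N`: up to isomorphism, `N` is obtained from `T` by forgetting some two-valent
points. -/
structure Reduction (T N : Tangle P) where
  toHalf : N.Half → T.Half
  toVertex : N.Vertex ≃ T.Vertex
  toHalf_injective : Function.Injective toHalf
  image_star : ∀ v, toHalf '' N.star v = T.star (toVertex v)
  opp_toHalf : ∀ h, T.opp (toHalf h) = toHalf (N.opp h)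
  reaches : ∀ x, T.Reaches (Set.range toHalf) (Sum.map toHalf id x) (Sum.map toHalf id (N.edge x))
  meets : ∀ h, ∃ y, T.Reaches (Set.range toHalf) (Sum.inl h) y

/-- A reduction of the inner tangle gives a homeomorphism of the glued graphs. -/
def Reduction.homeo [Finite P] {T N : Tangle P} (φ : Reduction T N) (O : Tangle P) :
    FramedGraph.Homeo (glue O T) (glue O N) where
  toHalf := Sum.map id (Sum.map φ.toHalf id)
  toVertex := Equiv.sumCongr (Equiv.refl _) φ.toVertex
  toHalf_injective := Function.injective_id.sumMap (φ.toHalf_injective.sumMap Function.injective_id)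
  image_star := by
    rintro (v | v)
    · exact Set.image_range_eq_range id Function.surjective_id fun i => rfl
    · have h := congrArg (fun s => (fun x => Sum.inr (Sum.inl x) : T.Half →
        (O.Half ⊕ P) ⊕ (T.Half ⊕ P)) '' s) (φ.image_star v)
      simp only [star, ← Set.range_comp] at h
      exact (Set.range_comp _ _).symm.trans h
  opp_toHalf := by
    rintro ((h | h) | (h | h)) <;> simp [glue, glueOpp, φ.opp_toHalf]
  edge_toHalf := by
    rintro (x | x)
    · exact ⟨0, by simp [glue]⟩
    · obtain ⟨n, hn, hi⟩ := (φ.reaches x).exists_iterate (O := O)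
      refine ⟨n, hn, fun i h => ?_⟩
      obtain ⟨l, hl, e⟩ := hi i h
      rintro ⟨y, hy⟩
      have hy' := hy.trans e
      rcases y with y | y | y
      · cases hy'
      · exact hl ⟨y, Sum.inl_injective (Sum.inr_injective hy')⟩
      · cases hy'
  meets := by
    rintro (x | (x | x))
    · exact ⟨0, ⟨Sum.inl x, rfl⟩⟩
    · obtain ⟨y, hy⟩ := φ.meets x
      obtain ⟨n, hn, -⟩ := hy.exists_iterate (O := O)
      -- The path ends with an edge, while the iterate of `opp ∘ edge` ends with `opp`. So one more
      -- step leads to the half-edge opposite to the end of the path, and that one is kept as well.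
      refine ⟨n + 1, ?_⟩
      rw [Function.iterate_succ_apply', Function.comp_apply]
      have hy' : y ∈ Set.range (Sum.map φ.toHalf (id : P → P)) := hy.mem_range
      obtain ⟨w, rfl⟩ := hy'
      have hn' : (glue O T).edge (((glue O T).opp ∘ (glue O T).edge)^[n] (Sum.inr (Sum.inl x))) =
        Sum.inr (Sum.map φ.toHalf id w) := hn
      erw [hn']
      cases w with
      | inl w => exact ⟨Sum.inr (Sum.inl (N.opp w)), by simp [glue, glueOpp, φ.opp_toHalf]⟩
      | inr w => exact ⟨Sum.inl (Sum.inr w), by simp [glue, glueOpp]⟩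
    · exact ⟨0, ⟨Sum.inr (Sum.inr x), rfl⟩⟩

/-- The disjoint union of a tangle and a circle with one two-valent point. -/
abbrev addCircle (T : Tangle P) : Tangle P where
  Half := T.Half ⊕ Bool
  Vertex := T.Vertex
  edge
    | Sum.inl (Sum.inl h) => Sum.map Sum.inl id (T.edge (Sum.inl h))
    | Sum.inl (Sum.inr b) => Sum.inl (Sum.inr !b)
    | Sum.inr p => Sum.map Sum.inl id (T.edge (Sum.inr p))
  edge_edge := by
    rintro ((h | h) | h)
    · have := T.edge_edge (Sum.inl h)
      cases e : T.edge (Sum.inl h) <;> rw [e] at this <;> simp [e, this]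
    · simp
    · have := T.edge_edge (Sum.inr h)
      cases e : T.edge (Sum.inr h) <;> rw [e] at this <;> simp [e, this]
  edge_ne := by
    rintro ((h | h) | h)
    · have := T.edge_ne (Sum.inl h)
      cases e : T.edge (Sum.inl h) <;> rw [e] at this <;> simp_all
    · simp
    · have := T.edge_ne (Sum.inr h)
      cases e : T.edge (Sum.inr h) <;> rw [e] at this <;> simp_all
  opp := Sum.map T.opp not
  opp_opp := by rintro (h | b) <;> simp [T.opp_opp]
  opp_ne := by rintro (h | b) <;> simp [T.opp_ne]
  half := fun i => Sum.inl (T.half i)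
  half_injective := Sum.inl_injective.comp T.half_injective
  opp_half := fun v s e => by simp [T.opp_half]

end Tangle

/-- A bijection of half-edges that respects all the structure is a homeomorphism. -/
def FramedGraph.Homeo.ofBijective {G G' : FramedGraph} (e : G'.Half → G.Half)
    (he : Function.Bijective e) (ev : G'.Vertex ≃ G.Vertex)
    (hstar : ∀ v, e '' G'.star v = G.star (ev v)) (hopp : ∀ h, G.opp (e h) = e (G'.opp h))
    (hedge : ∀ h, G.edge (e h) = e (G'.edge h)) : FramedGraph.Homeo G G' where
  toHalf := e
  toVertex := ev
  toHalf_injective := he.1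
  image_star := hstar
  opp_toHalf := hopp
  edge_toHalf := fun h => ⟨0, hedge h, by simp⟩
  meets := fun h => ⟨0, he.2 h⟩

namespace Tangle

variable {P : Type}

/-- A circle in the inner tangle is a circle in the glued graph. -/
def glueAddCircle [Finite P] (O T : Tangle P) :
    FramedGraph.Homeo (glue O T.addCircle) (glue O T).addCircle :=
  FramedGraph.Homeo.ofBijective (G := glue O T.addCircle) (G' := (glue O T).addCircle)
    (fun
      | Sum.inl (Sum.inl x) => Sum.inl x
      | Sum.inl (Sum.inr (Sum.inl h)) => Sum.inr (Sum.inl (Sum.inl h))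
      | Sum.inl (Sum.inr (Sum.inr p)) => Sum.inr (Sum.inr p)
      | Sum.inr b => Sum.inr (Sum.inl (Sum.inr b)))
    (by
      constructor
      · rintro ((x | (x | x)) | x) ((y | (y | y)) | y) h <;> simp_all <;> rfl
      · rintro (x | ((x | x) | x))
        · exact ⟨Sum.inl (Sum.inl x), rfl⟩
        · exact ⟨Sum.inl (Sum.inr (Sum.inl x)), rfl⟩
        · exact ⟨Sum.inr x, rfl⟩
        · exact ⟨Sum.inl (Sum.inr (Sum.inr x)), rfl⟩)
    (Equiv.refl _)
    (by
      rintro (v | v) <;>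
        exact Set.image_range_eq_range id Function.surjective_id fun i => rfl)
    (by
      rintro (((x | x) | (x | x)) | x) <;> rfl)
    (by
      rintro ((x | (x | x)) | x)
      · rfl
      · simp only [glue, FramedGraph.addCircle, addCircle, Sum.map_inr, Sum.map_inl]
        cases T.edge (Sum.inl x) <;> rfl
      · simp only [glue, FramedGraph.addCircle, addCircle, Sum.map_inr, Sum.map_inl]
        cases T.edge (Sum.inr x) <;> rfl
      · rfl)

/-- The vertices in `S` are resolved into pairs of two-valent points. -/
abbrev resolve (T : Tangle P) (S : Set T.Vertex) : Tangle P where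
  Half := T.Half
  Vertex := {v // v ∉ S}
  edge := T.edge
  edge_edge := T.edge_edge
  edge_ne := T.edge_ne
  opp := T.opp
  opp_opp := T.opp_opp
  opp_ne := T.opp_ne
  half := fun i => T.half (i.1.1, i.2)
  half_injective := by
    rintro ⟨⟨v, hv⟩, i⟩ ⟨⟨w, hw⟩, l⟩ h
    have := T.half_injective h
    simp only [Prod.mk.injEq] at this
    simp [this]
  opp_half := fun v s e => T.opp_half v.1 s e

/-- Resolving commutes with gluing. -/
def glueResolve [Finite P] (O T : Tangle P) (S : Set T.Vertex) (S' : Set (glue O T).Vertex)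
    (h₁ : ∀ v, Sum.inl v ∉ S') (h₂ : ∀ v, Sum.inr v ∈ S' ↔ v ∈ S) :
    FramedGraph.Homeo ((glue O T).resolve S') (glue O (T.resolve S)) :=
  FramedGraph.Homeo.ofBijective (G := (glue O T).resolve S') (G' := glue O (T.resolve S)) id
    Function.bijective_id
    { toFun := fun
        | Sum.inl v => ⟨Sum.inl v, h₁ v⟩
        | Sum.inr v => ⟨Sum.inr v.1, fun h => v.2 ((h₂ _).1 h)⟩
      invFun := fun
        | ⟨Sum.inl v, _⟩ => Sum.inl v
        | ⟨Sum.inr v, h⟩ => Sum.inr ⟨v, fun h' => h ((h₂ _).2 h')⟩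
      left_inv := by rintro (v | v) <;> rfl
      right_inv := by rintro ⟨v | v, h⟩ <;> rfl }
    (by rintro (v | v) <;> exact Set.image_id _)
    (by rintro ((x | x) | (x | x)) <;> rfl) (fun h => rfl)

end Tangle

/-! ### Equalities of pictures -/

/-- A function on framed 4-graphs with values in an `R`-module that satisfies the relations of
the module of pictures, a circle having the value `δ`. -/
structure PictureInvariant (j : Version) (R M : Type*) [CommRing R] [AddCommGroup M]
    [Module R M] where
  toFun : FramedGraph → M
  δ : R
  move : ∀ {G G' : FramedGraph}, FramedGraph.Move j G G' → toFun G = toFun G'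
  circle : ∀ G : FramedGraph, Nonempty G.Half → toFun G.addCircle = δ • toFun G

instance {j : Version} {R M : Type*} [CommRing R] [AddCommGroup M] [Module R M] :
    CoeFun (PictureInvariant j R M) fun _ => FramedGraph → M :=
  ⟨PictureInvariant.toFun⟩

section

variable {j : Version} {R M : Type*} [CommRing R] [AddCommGroup M] [Module R M]

theorem FramedGraph.Homeo.apply_eq {G G' : FramedGraph} (φ : FramedGraph.Homeo G G')
    (I : PictureInvariant j R M) : I G = I G' :=
  I.move (.homeo φ)

end

namespace Tangle

variable {P : Type}

/-- A tangle without circles, in which paths between ends and vertices can be followed both ways. -/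
def Traversable (T : Tangle P) : Prop :=
  ∀ x : (T.Vertex × Bool × Bool) ⊕ P, ∃ y, y ≠ x ∧
    T.Reaches (Set.range T.half) (Sum.map T.half id x) (Sum.map T.half id y) ∧
    T.Reaches (Set.range T.half) (Sum.map T.half id y) (Sum.map T.half id x)

/-- All two-valent points of a tangle are forgotten. -/
noncomputable abbrev core (T : Tangle P) [Finite T.Vertex] (h : T.Traversable) : Tangle P where
  Half := T.Vertex × Bool × Bool
  Vertex := T.Vertex
  edge := fun x => (h x).choose
  edge_edge := fun x => by
    have h₁ := (h x).choose_spec.2.2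
    have h₂ := (h (h x).choose).choose_spec.2.1
    exact T.half_injective.sumMap Function.injective_id (h₂.unique h₁)
  edge_ne := fun x => (h x).choose_spec.1
  opp := fun i => (i.1, i.2.1, !i.2.2)
  opp_opp := by simp
  opp_ne := by simp [Prod.ext_iff]
  half := id
  half_injective := Function.injective_id
  opp_half := fun _ _ _ => rfl

/-- `T` reduces to the tangle obtained from `U` by forgetting all two-valent points, if the same
vertices and ends are joined by paths in `T` as in `U`. -/
def reductionCore (T U : Tangle P) [Finite U.Vertex] (h : U.Traversable)
    (e : U.Vertex × Bool × Bool → T.Half) (ev : U.Vertex ≃ T.Vertex)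
    (g : U.Vertex → Bool × Bool → Bool × Bool) (hg : ∀ v, Function.Bijective (g v))
    (he : ∀ v i, e (v, i) = T.half (ev v, g v i))
    (hopp : ∀ v s b, T.opp (e (v, s, b)) = e (v, s, !b))
    (reaches : ∀ x y, U.Reaches (Set.range U.half) (Sum.map U.half id x) (Sum.map U.half id y) →
      T.Reaches (Set.range e) (Sum.map e id x) (Sum.map e id y))
    (meets : ∀ h, ∃ y, T.Reaches (Set.range e) (Sum.inl h) y) : Reduction T (U.core h) where
  toHalf := e
  toVertex := ev
  toHalf_injective := by
    rintro ⟨v, i⟩ ⟨w, l⟩ hvw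
    rw [he, he] at hvw
    have := T.half_injective hvw
    simp only [Prod.mk.injEq, EmbeddingLike.apply_eq_iff_eq] at this
    obtain ⟨rfl, this⟩ := this
    rw [(hg v).1 this]
  image_star := fun v => Set.image_range_eq_range (g v) (hg v).2 fun i => he v i
  opp_toHalf := fun x => hopp _ _ _
  reaches := fun x => reaches _ _ (h x).choose_spec.2.1
  meets := meets

/-- The reduction of a tangle to its core. -/
def reductionSelf (T : Tangle P) [Finite T.Vertex] (h : T.Traversable)
    (meets : ∀ h, ∃ y, T.Reaches (Set.range T.half) (Sum.inl h) y) : Reduction T (T.core h) :=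
  reductionCore T T h T.half (Equiv.refl _) (fun _ => id) (fun _ => Function.bijective_id)
    (fun _ _ => rfl) T.opp_half (fun _ _ r => r) meets

/-- Resolving vertices commutes with forgetting two-valent points. -/
def Reduction.resolve {T N : Tangle P} (φ : Reduction T N) (S : Set T.Vertex) :
    Reduction (T.resolve S) (N.resolve (φ.toVertex ⁻¹' S)) where
  toHalf := φ.toHalf
  toVertex := φ.toVertex.subtypeEquiv fun v => Iff.rfl
  toHalf_injective := φ.toHalf_injective
  image_star := fun v => φ.image_star v.1
  opp_toHalf := φ.opp_toHalf
  reaches := fun x => by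
    have h : ∀ {x y}, T.Reaches (Set.range φ.toHalf) x y →
        (T.resolve S).Reaches (Set.range φ.toHalf) x y := by
      intro x y r
      induction r with
      | port h => exact .port h
      | kept h hK => exact .kept h hK
      | step h hK _ ih => exact .step h hK ih
    exact h (φ.reaches x)
  meets := fun x => by
    have h : ∀ {x y}, T.Reaches (Set.range φ.toHalf) x y →
        (T.resolve S).Reaches (Set.range φ.toHalf) x y := by
      intro x y r
      induction r with
      | port h => exact .port h
      | kept h hK => exact .kept h hK
      | step h hK _ ih => exact .step h hK ih
    exact (φ.meets x).imp fun _ => h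

section Moves

variable [Finite P] {j : Version} {R M : Type*} [CommRing R] [AddCommGroup M] [Module R M]

/-- The graph moves speak of single edges, but the loops and bigons in a state are usually
subdivided by two-valent points. Passing to the core removes these points. -/
theorem picture_glue_core (I : PictureInvariant j R M) (O T : Tangle P) [Finite T.Vertex]
    (h : T.Traversable)
    (meets : ∀ h, ∃ y, T.Reaches (Set.range T.half) (Sum.inl h) y) :
    I (glue O T) = I (glue O (T.core h)) :=
  ((T.reductionSelf h meets).homeo O).apply_eq I

/-- The first move for a loop that contains two-valent points. -/
theorem picture_glue_omega₁ (I : PictureInvariant .two R M) (O T : Tangle P) [Finite T.Vertex]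
    (h : T.Traversable)
    (meets : ∀ h, ∃ y, T.Reaches (Set.range T.half) (Sum.inl h) y) (v : T.Vertex)
    (a b : Bool × Bool) (hab : T.half (v, b) ≠ T.opp (T.half (v, a)))
    (r : T.Reaches (Set.range T.half) (Sum.inl (T.half (v, a))) (Sum.inl (T.half (v, b)))) :
    I (glue O T) = I (glue O (T.resolve {v})) := by
  -- The edge of the core comes from a choice; uniqueness of the end of a path shows that it is the
  -- loop.
  have hedge : (T.core h).edge (Sum.inl (v, a)) = Sum.inl (v, b) :=
    T.half_injective.sumMap Function.injective_id ((h (Sum.inl (v, a))).choose_spec.2.1.unique r)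
  rw [picture_glue_core I O T h meets,
    ((((T.reductionSelf h meets).resolve {v})).homeo O).apply_eq I]
  have hedge' : (glue O (T.core h)).edge (Sum.inr (Sum.inl (v, a))) = Sum.inr (Sum.inl (v, b)) :=
    congrArg Sum.inr hedge
  rw [I.move (FramedGraph.Move.omega₁ (G := glue O (T.core h)) (Sum.inr v)
    (Sum.inr (Sum.inl (v, a))) ⟨a, rfl⟩ (hedge' ▸ ⟨b, rfl⟩) ?_)]
  · refine (glueResolve O (T.core h) {v} _ (by simp) (by simp)).apply_eq I
  · rw [hedge']
    intro h'
    simp only [glueOpp, Sum.inr.injEq, Sum.inl.injEq, Prod.mk.injEq] at h'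
    apply hab
    rw [show b = (a.1, !a.2) from h'.2]
    exact (T.opp_half _ _ _).symm

/-- The second move for a bigon whose edges contain two-valent points. -/
theorem picture_glue_omega₂ (I : PictureInvariant j R M) (O T : Tangle P) [Finite T.Vertex]
    (h : T.Traversable)
    (meets : ∀ h, ∃ y, T.Reaches (Set.range T.half) (Sum.inl h) y) (u v : T.Vertex) (huv : u ≠ v)
    (a b c d : Bool × Bool) (hab : a ≠ b) (hab' : b ≠ (a.1, !a.2)) (hcd : d ≠ (c.1, !c.2))
    (r : T.Reaches (Set.range T.half) (Sum.inl (T.half (u, a))) (Sum.inl (T.half (v, c))))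
    (r' : T.Reaches (Set.range T.half) (Sum.inl (T.half (u, b))) (Sum.inl (T.half (v, d)))) :
    I (glue O T) = I (glue O (T.resolve {u, v})) := by
  have hac : (T.core h).edge (Sum.inl (u, a)) = Sum.inl (v, c) :=
    T.half_injective.sumMap Function.injective_id ((h (Sum.inl (u, a))).choose_spec.2.1.unique r)
  have hbd : (T.core h).edge (Sum.inl (u, b)) = Sum.inl (v, d) :=
    T.half_injective.sumMap Function.injective_id ((h (Sum.inl (u, b))).choose_spec.2.1.unique r')
  rw [picture_glue_core I O T h meets,
    ((((T.reductionSelf h meets).resolve {u, v})).homeo O).apply_eq I]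
  have hac' : (glue O (T.core h)).edge (Sum.inr (Sum.inl (u, a))) = Sum.inr (Sum.inl (v, c)) :=
    congrArg Sum.inr hac
  have hbd' : (glue O (T.core h)).edge (Sum.inr (Sum.inl (u, b))) = Sum.inr (Sum.inl (v, d)) :=
    congrArg Sum.inr hbd
  rw [I.move (FramedGraph.Move.omega₂ (G := glue O (T.core h)) (Sum.inr u) (Sum.inr v)
    (Sum.inr (Sum.inl (u, a))) (Sum.inr (Sum.inl (u, b))) (by simpa using huv) ⟨a, rfl⟩ ⟨b, rfl⟩
    (hac' ▸ ⟨c, rfl⟩) (hbd' ▸ ⟨d, rfl⟩) ?_ ?_ ?_)]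
  · refine (glueResolve O (T.core h) {u, v} _ (by simp) (by simp)).apply_eq I
  · intro h'
    simp only [Sum.inr.injEq, Sum.inl.injEq, Prod.mk.injEq] at h'
    exact hab h'.2
  · intro h'
    simp only [glueOpp, Sum.inr.injEq, Sum.inl.injEq, Prod.mk.injEq] at h'
    exact hab' h'.2
  · rw [hac', hbd']
    intro h'
    simp only [glueOpp, Sum.inr.injEq, Sum.inl.injEq, Prod.mk.injEq] at h'
    exact hcd h'.2

end Moves

end Tangle

/-! ### The tangles of states -/

/-- How the crossings in `C` are passed by the strands in `S`, each of which passes through two of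
them: `pos (s, i)` is the first (`i = false`) or second (`i = true`) pass of `s`; a pass is a
crossing together with the information whether it is the upper pass. -/
abbrev StrandPattern (S C : Type) : Type := S × Bool ≃ C × Bool

namespace StrandPattern

variable {S C : Type}

/-- The edges of a strand pattern: the ends of the strand `s` are `(s, false)` and `(s, true)`. -/
def edge (p : StrandPattern S C) : (C × Bool) × Bool ⊕ S × Bool → (C × Bool) × Bool ⊕ S × Bool
  | Sum.inl (q, e) =>
    if (p.symm q).2 = e then Sum.inr ((p.symm q).1, e)
    else Sum.inl (p ((p.symm q).1, !(p.symm q).2), !e)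
  | Sum.inr (s, e) => Sum.inl (p (s, e), e)

theorem edge_edge (p : StrandPattern S C) (x) : p.edge (p.edge x) = x := by
  rcases x with ⟨q, e⟩ | ⟨s, e⟩
  · obtain ⟨⟨s, i⟩, rfl⟩ := p.surjective q
    cases i <;> cases e <;> simp [edge]
  · simp [edge]

theorem edge_ne (p : StrandPattern S C) (x) : p.edge x ≠ x := by
  rcases x with ⟨q, e⟩ | ⟨s, e⟩
  · simp only [edge]
    split_ifs <;> simp
  · simp [edge]

/-- How half-edges are connected at a place that is smoothed, replaced by a vertex, or replaced by
two two-valent points where one goes straight on (`none`). -/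
def opp (t : C → Option Smoothing) : (C × Bool) × Bool → (C × Bool) × Bool
  | ((c, b), e) =>
    match t c with
    | some Smoothing.oriented => ((c, !b), !e)
    | some Smoothing.unoriented => ((c, !b), e)
    | _ => ((c, b), !e)

/-- A vertex and a resolved vertex connect half-edges in the same way and differ only in being
counted as a vertex or not. Hence `none` can stand for a vertex that a graph move has removed. -/
theorem opp_update_none [DecidableEq C] {t : C → Option Smoothing} {c : C}
    (hc : t c = some Smoothing.vertex) :
    opp (Function.update t c none) = opp t := by
  ext1 ⟨⟨c', b⟩, e⟩
  rcases eq_or_ne c' c with rfl | h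
  · simp [opp, hc]
  · simp [opp, h]

/-- The tangle that is obtained when each crossing is smoothed or replaced by a vertex. -/
abbrev tangle [Finite C] (p : StrandPattern S C) (t : C → Option Smoothing) :
    Tangle (S × Bool) where
  Half := (C × Bool) × Bool
  Vertex := {c // t c = some Smoothing.vertex}
  edge := p.edge
  edge_edge := p.edge_edge
  edge_ne := p.edge_ne
  opp := opp t
  opp_opp := by
    rintro ⟨⟨c, b⟩, e⟩
    rcases h : t c with _ | _ | _ | _ <;> simp [opp, h]
  opp_ne := by
    rintro ⟨⟨c, b⟩, e⟩
    rcases h : t c with _ | _ | _ | _ <;> simp [opp, h]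
  half := fun i => ((i.1.1, i.2.1), i.2.2)
  half_injective := by
    rintro ⟨⟨c, hc⟩, b, e⟩ ⟨⟨c', hc'⟩, b', e'⟩ h
    simp only [Prod.mk.injEq] at h
    simp [h]
  opp_half := by
    rintro ⟨c, hc⟩ s e
    simp [opp, hc]

/-- The first end or half-edge in `K` that is met after `x`, if it is met after at most `n` edges. -/
def follow (p : StrandPattern S C) (t : C → Option Smoothing) (K : (C × Bool) × Bool → Bool) :
    ℕ → (C × Bool) × Bool ⊕ S × Bool → Option ((C × Bool) × Bool ⊕ S × Bool)
  | 0, _ => none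
  | n + 1, x =>
    match p.edge x with
    | Sum.inr s => some (Sum.inr s)
    | Sum.inl h => if K h then some (Sum.inl h) else follow p t K n (Sum.inl (opp t h))

/-- The half-edges at vertices. -/
def atVertex (t : C → Option Smoothing) (h : (C × Bool) × Bool) : Bool :=
  t h.1.1 = some Smoothing.vertex

/-- The first end or half-edge at a vertex that is met after `x`. -/
abbrev next (p : StrandPattern S C) (t : C → Option Smoothing) :
    (C × Bool) × Bool ⊕ S × Bool → Option ((C × Bool) × Bool ⊕ S × Bool) :=
  -- The bound 8 suffices for patterns with at most three crossings. A search that ran out of steps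
  -- would return `none`, and the checks below would fail.
  p.follow t (atVertex t) 8

variable [Finite C] {p : StrandPattern S C} {t : C → Option Smoothing}
  {j : Version} {R M : Type*} [CommRing R] [AddCommGroup M] [Module R M]

/-- Soundness of the bounded search. Together with the decidability instances it turns statements
about paths in the small patterns into finite computations. -/
theorem reaches_of_follow {K : (C × Bool) × Bool → Bool} {n : ℕ}
    {x y : (C × Bool) × Bool ⊕ S × Bool} (h : p.follow t K n x = some y) :
    (p.tangle t).Reaches {l | K l} x y := by
  induction n generalizing x with
  | zero => cases h
  | succ n ih =>
    rw [follow] at h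
    rcases hx : p.edge x with l | s <;> simp only [hx] at h
    · split_ifs at h with hl
      · cases h
        exact .kept hx hl
      · exact .step hx hl (ih h)
    · cases h
      exact .port hx

theorem range_half : Set.range (p.tangle t).half = {h | atVertex t h} := by
  ext h
  constructor
  · rintro ⟨⟨⟨c, hc⟩, i⟩, rfl⟩
    simpa [atVertex] using hc
  · intro hc
    exact ⟨(⟨h.1.1, by simpa [atVertex] using hc⟩, h.1.2, h.2), rfl⟩

theorem reaches_of_next {x y : (C × Bool) × Bool ⊕ S × Bool} (h : p.next t x = some y) :
    (p.tangle t).Reaches (Set.range (p.tangle t).half) x y :=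
  range_half (p := p) (t := t) ▸ reaches_of_follow h

/-- Whether there are no circles, and paths between ends and vertices can be followed both ways. -/
def Traversable (p : StrandPattern S C) (t : C → Option Smoothing) : Prop :=
  (∀ h, (p.next t (Sum.inl h)).isSome) ∧
    (∀ h, atVertex t h → ∃ y, p.next t (Sum.inl h) = some y ∧ y ≠ Sum.inl h ∧
      p.next t y = some (Sum.inl h)) ∧
    ∀ s, ∃ y, p.next t (Sum.inr s) = some y ∧ y ≠ Sum.inr s ∧ p.next t y = some (Sum.inr s)

set_option synthInstance.maxSize 1000 in
set_option synthInstance.maxHeartbeats 100000 in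
instance [Fintype S] [Fintype C] [DecidableEq S] [DecidableEq C] : Decidable (p.Traversable t) := by
  delta StrandPattern.Traversable
  infer_instance

theorem Traversable.tangle (h : p.Traversable t) : (p.tangle t).Traversable := by
  have key : ∀ x z : (C × Bool) × Bool ⊕ S × Bool, z ≠ x → p.next t x = some z →
      p.next t z = some x → ∀ x', Sum.map (p.tangle t).half id x' = x →
      ∃ y, y ≠ x' ∧
      (p.tangle t).Reaches (Set.range (p.tangle t).half) (Sum.map (p.tangle t).half id x')
        (Sum.map (p.tangle t).half id y) ∧
      (p.tangle t).Reaches (Set.range (p.tangle t).half) (Sum.map (p.tangle t).half id y)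
        (Sum.map (p.tangle t).half id x') := by
    rintro x z hne hz hz' x' rfl
    obtain ⟨y, rfl⟩ := (reaches_of_next hz).mem_range
    exact ⟨y, fun e => hne (e ▸ rfl), reaches_of_next hz, reaches_of_next hz'⟩
  rintro (x | s)
  · obtain ⟨z, hz, hne, hz'⟩ := h.2.1 ((p.tangle t).half x)
      ((Set.ext_iff.1 range_half _).1 (Set.mem_range_self x))
    exact key _ z hne hz hz' _ rfl
  · obtain ⟨z, hz, hne, hz'⟩ := h.2.2 s
    exact key _ z hne hz hz' _ rfl

theorem Traversable.meets (h : p.Traversable t) (x : (C × Bool) × Bool) :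
    ∃ y, (p.tangle t).Reaches (Set.range (p.tangle t).half) (Sum.inl x) y := by
  obtain ⟨y, hy⟩ := Option.isSome_iff_exists.1 (h.1 x)
  exact ⟨y, reaches_of_next hy⟩

/-- A map of half-edges that is given by a permutation of the places, and at each place by an
exchange of the two strands and by reversals of the strands. -/
def relabel (v : Equiv.Perm C) (σ : C → Bool) (ε : C × Bool → Bool) :
    (C × Bool) × Bool → (C × Bool) × Bool
  | ((c, b), e) => ((v c, b ^^ σ c), e ^^ ε (c, b))

/-- Whether the vertices and ends are joined by paths in the same way, up to relabelling. -/
def Similar (p q : StrandPattern S C) (t u : C → Option Smoothing) (v : Equiv.Perm C)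
    (σ : C → Bool) (ε : C × Bool → Bool) : Prop :=
  (∀ c, u c = some Smoothing.vertex ↔ t (v c) = some Smoothing.vertex) ∧
    (∀ h, (p.next t (Sum.inl h)).isSome) ∧
    (∀ h, atVertex u h → p.next t (Sum.inl (relabel v σ ε h)) =
      (q.next u (Sum.inl h)).map (Sum.map (relabel v σ ε) id)) ∧
    ∀ s, p.next t (Sum.inr s) = (q.next u (Sum.inr s)).map (Sum.map (relabel v σ ε) id)

set_option synthInstance.maxSize 1000 in
set_option synthInstance.maxHeartbeats 100000 in
instance [Fintype S] [Fintype C] [DecidableEq S] [DecidableEq C] {q : StrandPattern S C}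
    {u : C → Option Smoothing} {v : Equiv.Perm C} {σ : C → Bool} {ε : C × Bool → Bool} :
    Decidable (Similar p q t u v σ ε) := by
  delta Similar
  infer_instance

/-- Up to two-valent points, a tangle without circles is determined by which vertices and ends are
joined, so both tangles reduce to the core of `q.tangle u`. Relabellings are harmless because a
framed graph remembers only the pairs of opposite half-edges at a vertex, neither the order of the
two pairs nor the order within a pair. -/
theorem picture_eq_of_similar (I : PictureInvariant j R M) [Finite S] {q : StrandPattern S C}
    {u : C → Option Smoothing} (v : Equiv.Perm C) (σ : C → Bool) (ε : C × Bool → Bool)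
    (hu : q.Traversable u) (h : Similar p q t u v σ ε) (O : Tangle (S × Bool)) :
    I (O.glue (p.tangle t)) = I (O.glue (q.tangle u)) := by
  obtain ⟨h₁, h₂, h₃, h₄⟩ := h
  have hrange : Set.range (relabel v σ ε ∘ (q.tangle u).half) = Set.range (p.tangle t).half := by
    rw [Set.range_comp, range_half, range_half]
    ext ⟨⟨c, b⟩, e⟩
    simp only [Set.mem_image, Set.mem_ofPred_eq, atVertex, decide_eq_true_eq]
    constructor
    · rintro ⟨⟨⟨c', b'⟩, e'⟩, h, h'⟩
      simp only [relabel, Prod.mk.injEq] at h'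
      rw [← h'.1.1]
      exact (h₁ _).1 h
    · intro h
      -- The preimage under `relabel`: exchanging twice is the identity, and the reversal is read
      -- off at the source.
      refine ⟨((v.symm c, b ^^ σ (v.symm c)), e ^^ ε (v.symm c, b ^^ σ (v.symm c))), ?_, ?_⟩
      · rw [h₁]
        simpa using h
      · simp [relabel]
  rw [Tangle.picture_glue_core I O (q.tangle u) hu.tangle hu.meets]
  refine ((Tangle.reductionCore (p.tangle t) (q.tangle u) hu.tangle
    (relabel v σ ε ∘ (q.tangle u).half) (v.subtypeEquiv h₁)
    (fun c i => (i.1 ^^ σ c.1, i.2 ^^ ε (c.1, i.1))) ?_ ?_ ?_ ?_ ?_).homeo O).apply_eq I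
  · rintro ⟨c, hc⟩
    constructor
    · rintro ⟨b, e⟩ ⟨b', e'⟩ h
      simp only [Prod.mk.injEq, Bool.xor_left_inj] at h
      obtain ⟨rfl, h⟩ := h
      simpa using h
    · rintro ⟨b, e⟩
      exact ⟨(b ^^ σ c, e ^^ ε (c, b ^^ σ c)), by simp⟩
  · rintro ⟨c, hc⟩ i
    rfl
  · rintro ⟨c, hc⟩ s b
    have := (h₁ c).1 hc
    simp [relabel, opp, this]
  · rw [hrange]
    rintro (x | s) y r
    · obtain ⟨z, hz⟩ := Option.isSome_iff_exists.1 (hu.1 ((q.tangle u).half x))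
      have hzy := (reaches_of_next hz).unique r
      have := h₃ _ ((Set.ext_iff.1 range_half _).1 (Set.mem_range_self x))
      rw [hz, hzy] at this
      have := reaches_of_next this
      rw [Option.map_some] at *
      simpa using this
    · obtain ⟨z, hz, -⟩ := hu.2.2 s
      have hzy := (reaches_of_next hz).unique r
      have := h₄ s
      rw [hz, hzy] at this
      have := reaches_of_next this
      rw [Option.map_some] at *
      simpa using this
  · rw [hrange]
    intro x
    obtain ⟨y, hy⟩ := Option.isSome_iff_exists.1 (h₂ x)
    exact ⟨y, reaches_of_next hy⟩

/-- Whether the half-edge `a` belongs to a circle, without which the ends are joined by paths in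
the same way as in `q`. -/
def CircleAt [DecidableEq C] (p q : StrandPattern S C) (t u : C → Option Smoothing)
    (a : (C × Bool) × Bool) : Prop :=
  (∀ h, (p.follow t (fun l => l = a ∨ l = opp t a) 8 (Sum.inl h)).isSome) ∧
    p.follow t (fun l => l = a ∨ l = opp t a) 8 (Sum.inl a) = some (Sum.inl (opp t a)) ∧
    p.follow t (fun l => l = a ∨ l = opp t a) 8 (Sum.inl (opp t a)) = some (Sum.inl a) ∧
    ∀ s, p.follow t (fun l => l = a ∨ l = opp t a) 8 (Sum.inr s) = q.next u (Sum.inr s)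

set_option synthInstance.maxSize 1000 in
set_option synthInstance.maxHeartbeats 100000 in
instance [Fintype S] [Fintype C] [DecidableEq S] [DecidableEq C] {q : StrandPattern S C}
    {u : C → Option Smoothing} {a : (C × Bool) × Bool} : Decidable (CircleAt p q t u a) := by
  delta CircleAt
  infer_instance

/-- No vertices occur here, so the core of `q.tangle u` has no half-edges, and with an added circle
it has two. The tangle `p.tangle t` reduces to that if the only two-valent point kept is the one on
its circle with the half-edges `a` and `opp t a`. -/
theorem picture_eq_of_circle (I : PictureInvariant j R M) [Finite S] [Nonempty S] [DecidableEq C]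
    {q : StrandPattern S C} {u : C → Option Smoothing} (a : (C × Bool) × Bool)
    (hu : q.Traversable u) (hu' : ∀ c, u c ≠ some Smoothing.vertex)
    (ht : ∀ c, t c ≠ some Smoothing.vertex)
    (h : CircleAt p q t u a)
    (O : Tangle (S × Bool)) :
    I (O.glue (p.tangle t)) = I.δ • I (O.glue (q.tangle u)) := by
  obtain ⟨h₁, h₂, h₃, h₄⟩ := h
  have : IsEmpty {c // u c = some Smoothing.vertex} := ⟨fun c => hu' _ c.2⟩
  have : IsEmpty {c // t c = some Smoothing.vertex} := ⟨fun c => ht _ c.2⟩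
  -- A circle may be replaced by `δ` only beside a non-empty graph; a free end provides the
  -- half-edge that is needed.
  rw [Tangle.picture_glue_core I O (q.tangle u) hu.tangle hu.meets, ← I.circle _
    ⟨Sum.inl (Sum.inr (Classical.arbitrary _, true))⟩,
    ← (Tangle.glueAddCircle O _).apply_eq I]
  let f : (q.tangle u).Vertex × Bool × Bool ⊕ Bool → (C × Bool) × Bool
    | Sum.inl x => isEmptyElim x.1
    | Sum.inr b => if b then a else opp t a
  have hrange : Set.range f = {l | decide (l = a ∨ l = opp t a) = true} := by
    ext l
    simp only [Set.mem_range, Sum.exists, Set.mem_ofPred_eq, decide_eq_true_eq]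
    constructor
    · rintro (⟨x, -⟩ | ⟨b, rfl⟩)
      · exact isEmptyElim x.1
      · cases b <;> simp [f]
    · rintro (rfl | rfl)
      · exact Or.inr ⟨true, rfl⟩
      · exact Or.inr ⟨false, rfl⟩
  refine (Tangle.Reduction.homeo (T := p.tangle t) (N := ((q.tangle u).core hu.tangle).addCircle)
    ⟨f, Equiv.equivOfIsEmpty _ _, ?_, fun v => isEmptyElim v, ?_, ?_, ?_⟩ O).apply_eq I
  · rintro (x | b) (y | b') e
    · exact isEmptyElim x.1
    · exact isEmptyElim x.1
    · exact isEmptyElim y.1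
    · have := (p.tangle t).opp_ne a
      cases b <;> cases b'
      · rfl
      · exact absurd e this
      · exact absurd e.symm this
      · rfl
  · rintro (x | b)
    · exact isEmptyElim x.1
    · cases b
      · exact (p.tangle t).opp_opp a
      · rfl
  · rw [hrange]
    rintro ((x | b) | s)
    · exact isEmptyElim x.1
    · cases b
      · exact reaches_of_follow h₃
      · exact reaches_of_follow h₂
    · obtain ⟨z, hz, -⟩ := hu.2.2 s
      have r := reaches_of_next hz
      have hzy := r.unique (hu.tangle (Sum.inr s)).choose_spec.2.1
      have := reaches_of_follow ((h₄ s).trans hz)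
      obtain ⟨y | y, rfl⟩ := r.mem_range
      · exact isEmptyElim y.1
      · have e : ((q.tangle u).core hu.tangle).edge (Sum.inr s) = Sum.inr y :=
          ((q.tangle u).half_injective.sumMap Function.injective_id hzy).symm
        change (p.tangle t).Reaches _ _
          (Sum.map f id (Sum.map Sum.inl id (((q.tangle u).core hu.tangle).edge (Sum.inr s))))
        rw [e]
        exact this
  · rw [hrange]
    intro x
    obtain ⟨y, hy⟩ := Option.isSome_iff_exists.1 (h₁ x)
    exact ⟨y, reaches_of_follow hy⟩

/-- A resolved vertex is a place where one goes straight on. -/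
def tangleResolve [Finite S] (O : Tangle (S × Bool)) {u : C → Option Smoothing}
    (Z : Set (p.tangle t).Vertex) (hopp : opp t = opp u)
    (h : ∀ c, (∃ hc : t c = some Smoothing.vertex, (⟨c, hc⟩ : (p.tangle t).Vertex) ∉ Z) ↔
      u c = some Smoothing.vertex) :
    FramedGraph.Homeo (O.glue ((p.tangle t).resolve Z)) (O.glue (p.tangle u)) :=
  FramedGraph.Homeo.ofBijective (G := O.glue ((p.tangle t).resolve Z)) (G' := O.glue (p.tangle u))
    id Function.bijective_id
    (Equiv.sumCongr (Equiv.refl _)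
      { toFun := fun c => ⟨⟨c.1, ((h _).2 c.2).choose⟩, ((h _).2 c.2).choose_spec⟩
        invFun := fun c => ⟨c.1.1, (h _).1 ⟨c.1.2, c.2⟩⟩
        left_inv := fun _ => rfl
        right_inv := fun _ => rfl })
    (by rintro (v | v) <;> exact Set.image_id _)
    (by rintro ((x | x) | (x | x)) <;> simp [Tangle.glueOpp, hopp]) (fun _ => rfl)

/-- The vertex is resolved in place, not deleted, so the result is again a state of the same pattern
and can be compared with other states by `picture_eq_of_similar`. The same holds for bigons below.
-/
theorem picture_eq_of_loop (I : PictureInvariant .two R M) [Finite S] [DecidableEq C]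
    (h : p.Traversable t) (c : C) (a b : Bool × Bool)
    (hab : t c = some Smoothing.vertex ∧ b ≠ (a.1, !a.2) ∧
      p.next t (Sum.inl ((c, a.1), a.2)) = some (Sum.inl ((c, b.1), b.2)))
    (O : Tangle (S × Bool)) :
    I (O.glue (p.tangle t)) =
      I (O.glue (p.tangle (Function.update t c none))) := by
  obtain ⟨hc, hab, r⟩ := hab
  rw [Tangle.picture_glue_omega₁ I O (p.tangle t) h.tangle h.meets ⟨c, hc⟩ a b ?_
    (reaches_of_next r)]
  · refine (tangleResolve O _ (opp_update_none hc).symm fun c' => ?_).apply_eq I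
    rcases eq_or_ne c' c with rfl | h
    · simp
    · simp [h]
  · simp only [opp, hc]
    intro h'
    exact hab (by simpa [Prod.ext_iff] using h')

theorem picture_eq_of_bigon (I : PictureInvariant j R M) [Finite S] [DecidableEq C]
    (h : p.Traversable t) (c c' : C) (a b d d' : Bool × Bool)
    (hab : t c = some Smoothing.vertex ∧ t c' = some Smoothing.vertex ∧ c ≠ c' ∧ a ≠ b ∧
      b ≠ (a.1, !a.2) ∧ d' ≠ (d.1, !d.2) ∧
      p.next t (Sum.inl ((c, a.1), a.2)) = some (Sum.inl ((c', d.1), d.2)) ∧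
      p.next t (Sum.inl ((c, b.1), b.2)) = some (Sum.inl ((c', d'.1), d'.2)))
    (O : Tangle (S × Bool)) :
    I (O.glue (p.tangle t)) =
      I (O.glue (p.tangle (Function.update (Function.update t c none) c' none))) := by
  obtain ⟨hc, hc', hne, hab, hab', hd, r, r'⟩ := hab
  rw [Tangle.picture_glue_omega₂ I O (p.tangle t) h.tangle h.meets ⟨c, hc⟩ ⟨c', hc'⟩
    (by simpa using hne) a b d d' hab hab' hd (reaches_of_next r) (reaches_of_next r')]
  refine (tangleResolve O _ ?_ fun z => ?_).apply_eq I
  · rw [opp_update_none, opp_update_none hc]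
    rw [Function.update_of_ne hne.symm, hc']
  · rcases eq_or_ne z c' with rfl | h'
    · simp
    · rcases eq_or_ne z c with rfl | h
      · simp [h']
      · simp [h, h']

end StrandPattern

/-! ### Local skein identities for the three Reidemeister moves -/

namespace StrandPattern

/-- A kink, in which the lower pass comes first (`b = false`) or the upper one. -/
abbrev kink (b : Bool) : StrandPattern Unit Unit where
  toFun i := (i.1, i.2 ^^ b)
  invFun i := (i.1, i.2 ^^ b)
  left_inv i := by simp
  right_inv i := by simp

/-- Two crossings as in the second Reidemeister move: the strand `true` lies over the strand
`false`, which has the same direction (`r = false`) or the opposite one. -/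
abbrev clasp (r : Bool) : StrandPattern Bool Bool where
  toFun i := (i.2 ^^ (r && !i.1), i.1)
  invFun i := (i.2, i.1 ^^ (r && !i.2))
  left_inv i := by simp
  right_inv i := by simp

/-- Three crossings as in the third Reidemeister move, numbered in the order `ij`, `ik`, `jk`; the
strands `i`, `j`, `k` all point upwards. The crossings are passed in this order or, if `r = true`,
in the opposite one. -/
abbrev triangle (r : Bool) : StrandPattern (Fin 3) (Fin 3) where
  toFun
    | (0, i) => (if i ^^ r then 1 else 0, false)
    | (1, i) => if i ^^ r then (2, false) else (0, true)
    | (2, i) => (if i ^^ r then 2 else 1, true)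
  invFun
    | (0, false) => (0, r)
    | (0, true) => (1, r)
    | (1, false) => (0, !r)
    | (1, true) => (2, r)
    | (2, false) => (1, !r)
    | (2, true) => (2, !r)
  left_inv := by revert r; decide
  right_inv := by revert r; decide

section

variable {j : Version} {R M : Type*} [CommRing R] [AddCommGroup M] [Module R M]

theorem sum_smoothing {M : Type*} [AddCommMonoid M] (f : Smoothing → M) :
    ∑ s, f s = f .oriented + (f .unoriented + f .vertex) := by
  have : (Finset.univ : Finset Smoothing) = {.oriented, .unoriented, .vertex} := rfl
  rw [this, Finset.sum_insert (by decide), Finset.sum_insert (by decide), Finset.sum_singleton]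

/-- The oriented smoothing splits off a circle, the other smoothing leaves the bare strand, and at
the vertex there is a loop that the first graph move removes. In version one this move is missing,
but the coefficient of the vertex is zero. -/
theorem kink_skein (I : PictureInvariant j R M) (b : Bool) (O : Tangle (Unit × Bool))
    (p : Smoothing → R) (h : I.δ * p .oriented + p .unoriented + p .vertex = 1)
    (h' : j = Version.one → p .vertex = 0) :
    ∑ s, p s • I (O.glue ((kink b).tangle fun _ => some s)) =
      I (O.glue ((kink b).tangle fun _ => none)) := by
  have hv : p .vertex • I (O.glue ((kink b).tangle fun _ => some .vertex)) =
      p .vertex • I (O.glue ((kink b).tangle fun _ => none)) := by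
    cases j with
    | one => rw [h' rfl, zero_smul, zero_smul]
    | two =>
      rw [picture_eq_of_loop I (by cases b <;> decide) () (b, true) (!b, false)
        (by cases b <;> decide)]
      rfl
  have hn : (kink b).Traversable fun _ => none := by cases b <;> decide
  -- The half-edge by which the second pass is entered lies on the loop of the kink, hence on the
  -- circle that is split off.
  rw [sum_smoothing, hv,
    picture_eq_of_circle I (((), !b), false) hn (by decide) (by decide) (by cases b <;> decide),
    picture_eq_of_similar I (t := fun _ => some .unoriented) 1 (fun _ => false) (fun _ => false)
      hn (by cases b <;> decide)]
  linear_combination (norm := module) h • I (O.glue ((kink b).tangle fun _ => none))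

/-- The state of two crossings. -/
abbrev pair (s₁ s₂ : Option Smoothing) (c : Bool) : Option Smoothing :=
  if c then s₂ else s₁

/-- The relations between the coefficients at two crossings of opposite signs and the same label. -/
structure ClaspRelations (j : Version) (δ : R) (p q : Smoothing → R) : Prop where
  unit : p .oriented * q .oriented + p .vertex * q .vertex = 1
  turn : p .oriented * q .oriented = p .unoriented * q .unoriented
  circle : δ * p .oriented * q .oriented + p .oriented * q .unoriented +
    p .unoriented * q .oriented = 0
  vertex : p .oriented * q .vertex + p .vertex * q .oriented = 0
  vertex' : p .unoriented * q .vertex + p .vertex * q .unoriented = 0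
  one : j = Version.one → (p .oriented * q .vertex = 0 ∧ p .vertex * q .oriented = 0) ∧
    p .unoriented * q .vertex = 0 ∧ p .vertex * q .unoriented = 0

/-- The smoothing at the crossings of a clasp that does not change the strands (`b = false`), or the
other one. -/
abbrev claspSmoothing (r b : Bool) : Smoothing :=
  if r ^^ b then .unoriented else .oriented

/-- Let `a` be the smoothing that keeps the two strands and `b` the one that turns them back. The
states `aa` and vertex-vertex (a bigon) give the two strands; `ab`, `ba` and `bb`, the last with a
circle, give the strands turned back; `a` with a vertex gives one vertex in either order; `b` with a
vertex gives a loop. Each normal form but the first gets total coefficient zero. For opposite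
directions `a` and `b` change places, and the relation `turn` passes from one case to the other. -/
theorem clasp_skein (I : PictureInvariant j R M) (r : Bool) (O : Tangle (Bool × Bool))
    (p q : Smoothing → R) (h : ClaspRelations j I.δ p q) :
    ∑ s, ∑ s', (p s * q s') • I (O.glue ((clasp r).tangle (pair (some s) (some s')))) =
      I (O.glue ((clasp r).tangle fun _ => none)) := by
  let J : Smoothing → Smoothing → M :=
    fun s s' => I (O.glue ((clasp r).tangle (pair (some s) (some s'))))
  obtain ⟨a, ha⟩ : ∃ a, a = claspSmoothing r false := ⟨_, rfl⟩
  obtain ⟨b, hb⟩ : ∃ b, b = claspSmoothing r true := ⟨_, rfl⟩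
  have hn : (clasp r).Traversable fun _ => none := by cases r <;> decide
  have hab : (clasp r).Traversable (pair (some a) (some b)) := by subst ha hb; cases r <;> decide
  have hva : (clasp r).Traversable (pair (some .vertex) (some a)) := by
    subst ha; cases r <;> decide
  have h₁ : J .vertex .vertex = I (O.glue ((clasp r).tangle fun _ => none)) := by
    refine (picture_eq_of_bigon I (by cases r <;> decide) false true (true, true) (false, !r)
      (true, false) (false, r) (by cases r <;> decide) O).trans ?_
    congr 3
    decide
  have h₂ : J a a = I (O.glue ((clasp r).tangle fun _ => none)) :=
    picture_eq_of_similar I 1 (fun _ => false) (fun _ => false) hn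
      (by subst ha; cases r <;> decide) O
  have h₃ : J b b = I.δ • J a b :=
    picture_eq_of_circle I ((false, true), true) hab
      (by subst ha hb; cases r <;> decide) (by subst hb; cases r <;> decide)
      (by subst ha hb; cases r <;> decide) O
  have h₄ : J b a = J a b :=
    picture_eq_of_similar I 1 (fun _ => false) (fun _ => false) hab
      (by subst ha hb; cases r <;> decide) O
  -- The remaining vertex can stand at either crossing. The smoothing before it exchanges the two
  -- strands there, and reverses them if their directions are opposite.
  have h₅ : J a .vertex = J .vertex a :=
    picture_eq_of_similar I (Equiv.swap false true) (fun _ => true) (fun _ => r) hva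
      (by subst ha; cases r <;> decide) O
  -- In version two both loops can be removed and only the sum of the coefficients has to vanish; in
  -- version one each coefficient vanishes by itself.
  have h₆ : (p b * q .vertex) • J b .vertex + (p .vertex * q b) • J .vertex b = 0 := by
    cases j with
    | one =>
      obtain ⟨⟨e₁, e₂⟩, e₃, e₄⟩ := h.one rfl
      subst hb
      cases r
      · change (p .unoriented * q .vertex) • _ + (p .vertex * q .unoriented) • _ = 0
        rw [e₃, e₄, zero_smul, zero_smul, add_zero]
      · change (p .oriented * q .vertex) • _ + (p .vertex * q .oriented) • _ = 0
        rw [e₁, e₂, zero_smul, zero_smul, add_zero]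
    | two =>
      have h₇ : J b .vertex = J a b :=
        (picture_eq_of_loop I (by subst hb; cases r <;> decide) true (true, false) (false, r)
          (by subst hb; cases r <;> decide) O).trans
        (picture_eq_of_similar I 1 (fun _ => false) (fun _ => false) hab
          (by subst ha hb; cases r <;> decide) O)
      have h₈ : J .vertex b = J a b :=
        (picture_eq_of_loop I (by subst hb; cases r <;> decide) false (true, true) (false, !r)
          (by subst hb; cases r <;> decide) O).trans
        (picture_eq_of_similar I 1 (fun _ => false) (fun _ => false) hab
          (by subst ha hb; cases r <;> decide) O)
      rw [h₇, h₈, ← add_smul]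
      have : p b * q .vertex + p .vertex * q b = 0 := by
        subst hb
        cases r
        · exact h.vertex'
        · exact h.vertex
      rw [this, zero_smul]
  have h₇ : p a * q a + p .vertex * q .vertex = 1 := by
    subst ha
    cases r
    · exact h.unit
    · exact h.turn ▸ h.unit
  have h₈ : I.δ * (p b * q b) + p a * q b + p b * q a = 0 := by
    subst ha hb
    cases r
    · change I.δ * (p .unoriented * q .unoriented) + p .oriented * q .unoriented +
        p .unoriented * q .oriented = 0
      linear_combination h.circle - I.δ * h.turn
    · change I.δ * (p .oriented * q .oriented) + p .unoriented * q .oriented +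
        p .oriented * q .unoriented = 0
      linear_combination h.circle
  have h₉ : p a * q .vertex + p .vertex * q a = 0 := by
    subst ha
    cases r
    · exact h.vertex
    · exact h.vertex'
  have hsum : ∀ f : Smoothing → M, ∑ s, f s = f a + (f b + f .vertex) := by
    subst ha hb
    cases r <;> intro f <;> simp only [sum_smoothing]
    · rfl
    · exact add_left_comm _ _ _
  change ∑ s, ∑ s', (p s * q s') • J s s' = _
  simp only [hsum, h₁, h₂, h₃, h₄, h₅]
  linear_combination (norm := module) h₆ + h₇ • I (O.glue ((clasp r).tangle fun _ => none)) +
    h₈ • J a b + h₉ • J .vertex a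

/-- The relations between the coefficients at the three crossings, before (`L`) and after (`K`) the
third Reidemeister move. -/
structure TriangleRelations (j : Version) (δ : R) (L K : Smoothing → Smoothing → Smoothing → R) :
    Prop where
  aaa : L .oriented .oriented .oriented + L .vertex .vertex .oriented = K .oriented .oriented
    .oriented + K .oriented .vertex .vertex
  abb : L .oriented .unoriented .unoriented + L .vertex .unoriented .vertex = K .unoriented
    .unoriented .oriented + K .vertex .unoriented .vertex
  bab : L .unoriented .oriented .unoriented + L .unoriented .vertex .vertex = K .unoriented
    .oriented .unoriented + K .vertex .vertex .unoriented
  aca : L .oriented .vertex .oriented + L .vertex .oriented .oriented = K .vertex .oriented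
    .oriented
  aac : L .oriented .oriented .vertex = K .oriented .oriented .vertex + K .oriented .vertex
    .oriented
  acb : L .oriented .vertex .unoriented = K .unoriented .unoriented .vertex + K .vertex
    .unoriented .oriented
  bac : L .unoriented .vertex .unoriented + L .unoriented .oriented .vertex = K .unoriented
    .oriented .vertex
  abc : L .oriented .unoriented .vertex + L .vertex .unoriented .unoriented = K .unoriented
    .vertex .oriented
  cab : L .vertex .oriented .unoriented = K .unoriented .vertex .unoriented + K .vertex .oriented
    .unoriented
  ccb : L .vertex .vertex .unoriented = K .unoriented .vertex .vertex
  acc : L .oriented .vertex .vertex = K .vertex .vertex .oriented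
  cac : L .vertex .oriented .vertex = K .vertex .oriented .vertex
  ccc : L .vertex .vertex .vertex = 0
  ccc' : K .vertex .vertex .vertex = 0
  aab : L .oriented .oriented .unoriented = K .oriented .unoriented .oriented + K .oriented
    .oriented .unoriented + δ * K .oriented .unoriented .unoriented + K .unoriented .unoriented
    .unoriented + K .oriented .unoriented .vertex + K .oriented .vertex .unoriented + K .vertex
    .unoriented .unoriented
  baa : K .unoriented .oriented .oriented = L .unoriented .oriented .oriented + L .oriented
    .unoriented .oriented + δ * L .unoriented .unoriented .oriented + L .unoriented .unoriented
    .unoriented + L .unoriented .vertex .oriented + L .vertex .unoriented .oriented + L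
    .unoriented .unoriented .vertex
  one : j = Version.one → L .unoriented .vertex .oriented = 0 ∧ L .vertex .unoriented .oriented =
    0 ∧ L .unoriented .unoriented .vertex = 0 ∧ K .oriented .unoriented .vertex = 0 ∧ K .oriented
    .vertex .unoriented = 0 ∧ K .vertex .unoriented .unoriented = 0

/-- The state of three crossings. -/
abbrev triple (s₁ s₂ s₃ : Smoothing) : Fin 3 → Option Smoothing :=
  ![some s₁, some s₂, some s₃]

theorem triangle_similar (I : PictureInvariant j R M) (O : Tangle (Fin 3 × Bool)) {r r' : Bool}
    {t u : Fin 3 → Option Smoothing} (a b : Fin 3) (σ : Bool) (ε : Fin 3 × Bool → Bool)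
    (h : (triangle r').Traversable u ∧
      Similar (triangle r) (triangle r') t u (Equiv.swap a b) (fun _ => σ) ε) :
    I (O.glue ((triangle r).tangle t)) = I (O.glue ((triangle r').tangle u)) :=
  picture_eq_of_similar I _ _ _ h.1 h.2 O

theorem triangle_circle (I : PictureInvariant j R M) (O : Tangle (Fin 3 × Bool)) {r r' : Bool}
    {t u : Fin 3 → Option Smoothing} (a : (Fin 3 × Bool) × Bool)
    (h : (triangle r').Traversable u ∧ (∀ c, u c ≠ some .vertex) ∧ (∀ c, t c ≠ some .vertex) ∧
      CircleAt (triangle r) (triangle r') t u a) :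
    I (O.glue ((triangle r).tangle t)) = I.δ • I (O.glue ((triangle r').tangle u)) :=
  picture_eq_of_circle I a h.1 h.2.1 h.2.2.1 h.2.2.2 O

theorem triangle_bigon (I : PictureInvariant j R M) (O : Tangle (Fin 3 × Bool)) {r r' : Bool}
    {t u : Fin 3 → Option Smoothing} (c c' : Fin 3) (a b d d' : Bool × Bool)
    (h : ((triangle r).Traversable t ∧ t c = some .vertex ∧ t c' = some .vertex ∧ c ≠ c' ∧ a ≠ b ∧
      b ≠ (a.1, !a.2) ∧ d' ≠ (d.1, !d.2) ∧
      (triangle r).next t (Sum.inl ((c, a.1), a.2)) = some (Sum.inl ((c', d.1), d.2)) ∧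
      (triangle r).next t (Sum.inl ((c, b.1), b.2)) = some (Sum.inl ((c', d'.1), d'.2))) ∧
      (triangle r').Traversable u ∧ Similar (triangle r) (triangle r')
        (Function.update (Function.update t c none) c' none) u 1 (fun _ => false)
        (fun _ => false)) :
    I (O.glue ((triangle r).tangle t)) = I (O.glue ((triangle r').tangle u)) :=
  (picture_eq_of_bigon I h.1.1 c c' a b d d' h.1.2 O).trans
    (picture_eq_of_similar I _ _ _ h.2.1 h.2.2 O)

/-- The factor `x` has to be kept: in version one the two pictures need not be equal, and the
equation holds because the coefficient is zero. -/
theorem triangle_loop (I : PictureInvariant j R M) (O : Tangle (Fin 3 × Bool)) {r r' : Bool}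
    {t u : Fin 3 → Option Smoothing} {x : R} (hx : j = Version.one → x = 0) (c : Fin 3)
    (a b : Bool × Bool)
    (h : ((triangle r).Traversable t ∧ t c = some .vertex ∧ b ≠ (a.1, !a.2) ∧
      (triangle r).next t (Sum.inl ((c, a.1), a.2)) = some (Sum.inl ((c, b.1), b.2))) ∧
      (triangle r').Traversable u ∧ Similar (triangle r) (triangle r')
        (Function.update t c none) u 1 (fun _ => false) (fun _ => false)) :
    x • I (O.glue ((triangle r).tangle t)) = x • I (O.glue ((triangle r').tangle u)) := by
  cases j with
  | one => rw [hx rfl, zero_smul, zero_smul]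
  | two => rw [picture_eq_of_loop I h.1.1 c a b h.1.2 O, picture_eq_of_similar I _ _ _ h.2.1 h.2.2 O]

/-- The arguments of `L` belong to the crossings `ij`, `jk`, `ik` and those of `K` to `ik`, `jk`,
`ij`, as in the products that define the ideal; `triple` takes them in the order `ij`, `ik`, `jk`.
Fifteen of the states before the move serve as normal forms. All other states before the move, and
all states after it except the one with three vertices, are reduced to these. Each normal form then
yields one relation, and the two states with three vertices have coefficient zero. -/
theorem triangle_skein (I : PictureInvariant j R M) (O : Tangle (Fin 3 × Bool))
    (L K : Smoothing → Smoothing → Smoothing → R) (h : TriangleRelations j I.δ L K) :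
    ∑ s₁, ∑ s₂, ∑ s₃, L s₁ s₂ s₃ • I (O.glue ((triangle false).tangle (triple s₁ s₃ s₂))) =
      ∑ s₁, ∑ s₂, ∑ s₃, K s₁ s₂ s₃ • I (O.glue ((triangle true).tangle (triple s₃ s₁ s₂))) := by
  let J : Smoothing → Smoothing → Smoothing → M :=
    fun s₁ s₂ s₃ => I (O.glue ((triangle false).tangle (triple s₁ s₃ s₂)))
  let J' : Smoothing → Smoothing → Smoothing → M :=
    fun s₁ s₂ s₃ => I (O.glue ((triangle true).tangle (triple s₃ s₁ s₂)))
  change ∑ s₁, ∑ s₂, ∑ s₃, L s₁ s₂ s₃ • J s₁ s₂ s₃ = ∑ s₁, ∑ s₂, ∑ s₃, K s₁ s₂ s₃ • J' s₁ s₂ s₃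
  have hl_baa : J .unoriented .oriented .oriented = J .oriented .unoriented .oriented :=
    triangle_similar I O 0 0 false (fun _ => false) (by decide)
  have hl_bba : J .unoriented .unoriented .oriented = I.δ • J .oriented .unoriented .oriented :=
    triangle_circle I O ((0, false), true) (by decide)
  have hl_bbb : J .unoriented .unoriented .unoriented = J .oriented .unoriented .oriented :=
    triangle_similar I O 0 0 false (fun _ => false) (by decide)
  have hl_bbc : L .unoriented .unoriented .vertex • J .unoriented .unoriented .vertex = L
      .unoriented .unoriented .vertex • J .oriented .unoriented .oriented :=
    triangle_loop I O (fun e => (h.one e).2.2.1)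
      1 (false, false) (true, true) (by decide)
  have hl_bca : L .unoriented .vertex .oriented • J .unoriented .vertex .oriented = L
      .unoriented .vertex .oriented • J .oriented .unoriented .oriented :=
    triangle_loop I O (fun e => (h.one e).1)
      2 (false, false) (true, false) (by decide)
  have hl_bcb : J .unoriented .vertex .unoriented = J .unoriented .oriented .vertex :=
    triangle_similar I O 1 2 true (fun x => !x.2) (by decide)
  have hl_bcc : J .unoriented .vertex .vertex = J .unoriented .oriented .unoriented :=
    triangle_bigon I O 2 1 (false, false) (true, false) (false, false) (true, true) (by decide)
  have hl_caa : J .vertex .oriented .oriented = J .oriented .vertex .oriented :=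
    triangle_similar I O 0 2 false (fun _ => false) (by decide)
  have hl_cba : L .vertex .unoriented .oriented • J .vertex .unoriented .oriented = L .vertex
      .unoriented .oriented • J .oriented .unoriented .oriented :=
    triangle_loop I O (fun e => (h.one e).2.1)
      0 (false, true) (true, true) (by decide)
  have hl_cbb : J .vertex .unoriented .unoriented = J .oriented .unoriented .vertex :=
    triangle_similar I O 0 1 true (fun x => x.2) (by decide)
  have hl_cbc : J .vertex .unoriented .vertex = J .oriented .unoriented .unoriented :=
    triangle_bigon I O 0 1 (false, true) (true, true) (false, false) (true, true) (by decide)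
  have hl_cca : J .vertex .vertex .oriented = J .oriented .oriented .oriented :=
    triangle_bigon I O 0 2 (false, true) (true, true) (true, false) (false, false) (by decide)
  have hr_aaa : J' .oriented .oriented .oriented = J .oriented .oriented .oriented :=
    triangle_similar I O 0 0 false (fun _ => false) (by decide)
  have hr_aab : J' .oriented .oriented .unoriented = J .oriented .oriented .unoriented :=
    triangle_similar I O 0 0 false (fun _ => false) (by decide)
  have hr_aac : J' .oriented .oriented .vertex = J .oriented .oriented .vertex :=
    triangle_similar I O 0 1 false (fun _ => false) (by decide)
  have hr_aba : J' .oriented .unoriented .oriented = J .oriented .oriented .unoriented :=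
    triangle_similar I O 0 0 false (fun _ => false) (by decide)
  have hr_abb : J' .oriented .unoriented .unoriented = I.δ • J .oriented .oriented .unoriented :=
    triangle_circle I O ((1, false), true) (by decide)
  have hr_abc : K .oriented .unoriented .vertex • J' .oriented .unoriented .vertex = K .oriented
      .unoriented .vertex • J .oriented .oriented .unoriented :=
    triangle_loop I O (fun e => (h.one e).2.2.2.1)
      0 (false, false) (true, false) (by decide)
  have hr_aca : J' .oriented .vertex .oriented = J .oriented .oriented .vertex :=
    triangle_similar I O 1 2 false (fun _ => false) (by decide)
  have hr_acb : K .oriented .vertex .unoriented • J' .oriented .vertex .unoriented = K .oriented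
      .vertex .unoriented • J .oriented .oriented .unoriented :=
    triangle_loop I O (fun e => (h.one e).2.2.2.2.1)
      2 (false, true) (true, true) (by decide)
  have hr_acc : J' .oriented .vertex .vertex = J .oriented .oriented .oriented :=
    triangle_bigon I O 2 0 (false, true) (true, true) (true, false) (false, false) (by decide)
  have hr_baa : J' .unoriented .oriented .oriented = J .oriented .unoriented .oriented :=
    triangle_similar I O 0 0 false (fun _ => false) (by decide)
  have hr_bab : J' .unoriented .oriented .unoriented = J .unoriented .oriented .unoriented :=
    triangle_similar I O 0 0 false (fun _ => false) (by decide)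
  have hr_bac : J' .unoriented .oriented .vertex = J .unoriented .oriented .vertex :=
    triangle_similar I O 0 1 false (fun _ => false) (by decide)
  have hr_bba : J' .unoriented .unoriented .oriented = J .oriented .unoriented .unoriented :=
    triangle_similar I O 0 0 false (fun _ => false) (by decide)
  have hr_bbb : J' .unoriented .unoriented .unoriented = J .oriented .oriented .unoriented :=
    triangle_similar I O 0 0 false (fun _ => false) (by decide)
  have hr_bbc : J' .unoriented .unoriented .vertex = J .oriented .vertex .unoriented :=
    triangle_similar I O 0 2 true (fun x => x.2) (by decide)
  have hr_bca : J' .unoriented .vertex .oriented = J .oriented .unoriented .vertex :=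
    triangle_similar I O 1 2 false (fun _ => false) (by decide)
  have hr_bcb : J' .unoriented .vertex .unoriented = J .vertex .oriented .unoriented :=
    triangle_similar I O 0 2 true (fun x => !x.2) (by decide)
  have hr_bcc : J' .unoriented .vertex .vertex = J .vertex .vertex .unoriented :=
    triangle_similar I O 0 2 true (fun x => x.2 ^^ x.1 == 0) (by decide)
  have hr_caa : J' .vertex .oriented .oriented = J .oriented .vertex .oriented :=
    triangle_similar I O 1 2 false (fun _ => false) (by decide)
  have hr_cab : J' .vertex .oriented .unoriented = J .vertex .oriented .unoriented :=
    triangle_similar I O 0 1 false (fun _ => false) (by decide)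
  have hr_cac : J' .vertex .oriented .vertex = J .vertex .oriented .vertex :=
    triangle_similar I O 0 1 false (fun _ => false) (by decide)
  have hr_cba : J' .vertex .unoriented .oriented = J .oriented .vertex .unoriented :=
    triangle_similar I O 1 2 false (fun _ => false) (by decide)
  have hr_cbb : K .vertex .unoriented .unoriented • J' .vertex .unoriented .unoriented = K
      .vertex .unoriented .unoriented • J .oriented .oriented .unoriented :=
    triangle_loop I O (fun e => (h.one e).2.2.2.2.2)
      1 (false, true) (true, false) (by decide)
  have hr_cbc : J' .vertex .unoriented .vertex = J .oriented .unoriented .unoriented :=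
    triangle_bigon I O 1 0 (false, true) (true, false) (false, false) (true, false) (by decide)
  have hr_cca : J' .vertex .vertex .oriented = J .oriented .vertex .vertex :=
    triangle_similar I O 1 2 false (fun _ => false) (by decide)
  have hr_ccb : J' .vertex .vertex .unoriented = J .unoriented .oriented .unoriented :=
    triangle_bigon I O 1 2 (false, true) (true, false) (false, true) (true, true) (by decide)
  simp only [sum_smoothing, hl_baa, hl_bba, hl_bbb, hl_bcb, hl_bcc, hl_caa, hl_cbb, hl_cbc,
      hl_cca, hr_aaa, hr_aab, hr_aac, hr_aba, hr_abb, hr_aca, hr_acc, hr_baa, hr_bab, hr_bac,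
      hr_bba, hr_bbb, hr_bbc, hr_bca, hr_bcb, hr_bcc, hr_caa, hr_cab, hr_cac, hr_cba, hr_cbc,
      hr_cca, hr_ccb, hl_bbc, hl_bca, hl_cba, hr_abc, hr_acb, hr_cbb]
  -- What remains is linear algebra in which the pictures are indeterminates. The relation `baa` has
  -- the terms of `K` on its left-hand side, whence its negative sign below.
  clear_value J J'
  obtain ⟨e_aaa, e_abb, e_bab, e_aca, e_aac, e_acb, e_bac, e_abc, e_cab, e_ccb, e_acc, e_cac,
    e_ccc, e_ccc', e_aab, e_baa, -⟩ := h
  linear_combination (norm := module) e_aaa • J .oriented .oriented .oriented +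
    e_abb • J .oriented .unoriented .unoriented +
    e_bab • J .unoriented .oriented .unoriented +
    e_aca • J .oriented .vertex .oriented +
    e_aac • J .oriented .oriented .vertex +
    e_acb • J .oriented .vertex .unoriented +
    e_bac • J .unoriented .oriented .vertex +
    e_abc • J .oriented .unoriented .vertex +
    e_cab • J .vertex .oriented .unoriented +
    e_ccb • J .vertex .vertex .unoriented +
    e_acc • J .oriented .vertex .vertex +
    e_cac • J .vertex .oriented .vertex +
    e_ccc • J .vertex .vertex .vertex - e_ccc' • J' .vertex .vertex .vertex +
    e_aab • J .oriented .oriented .unoriented -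
    e_baa • J .oriented .unoriented .oriented

end

end StrandPattern

/-! ### Cutting the graph of a state along a pattern of crossings -/

namespace Tangle

variable {P : Type} [Finite P]

/-- A decomposition of a graph into two tangles; the half-edge `f p` of the inner tangle is joined to
its end `p`. -/
def decomposition (O T : Tangle P) (G : FramedGraph) (φ : O.Half ⊕ T.Half ≃ G.Half) (f : P → T.Half)
    (hf : ∀ p, T.edge (Sum.inr p) = Sum.inl (f p))
    (hopp : ∀ x, G.opp (φ x) = φ (Sum.map O.opp T.opp x))
    (hO : ∀ x, G.edge (Sum.elim (fun h => φ (Sum.inl h)) (fun p => φ (Sum.inr (f p))) x) =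
      Sum.elim (fun h => φ (Sum.inl h)) (fun p => φ (Sum.inr (f p))) (O.edge x))
    (hT : ∀ i l, T.edge (Sum.inl i) = Sum.inl l → G.edge (φ (Sum.inr i)) = φ (Sum.inr l))
    (ev : G.Vertex ≃ O.Vertex ⊕ T.Vertex)
    (hvO : ∀ v i, φ (Sum.inl (O.half (v, i))) = G.half (ev.symm (Sum.inl v), i))
    (hvT : ∀ v i, φ (Sum.inr (T.half (v, i))) = G.half (ev.symm (Sum.inr v), i)) :
    FramedGraph.Homeo (glue O T) G := by
  let g : O.Half ⊕ T.Half → (O.Half ⊕ P) ⊕ (T.Half ⊕ P) := Sum.map Sum.inl Sum.inl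
  have hg : Function.Injective g := Sum.inl_injective.sumMap Sum.inl_injective
  have hr : Set.range (g ∘ φ.symm) = Set.range g := φ.symm.surjective.range_comp g
  have hgo : ∀ x, glueOpp O T (g x) = g (Sum.map O.opp T.opp x) := by
    rintro (x | x) <;> rfl
  -- An edge of `G` crosses the boundary between the two tangles at most twice: it may leave `T`,
  -- run through `O` from end to end, and return. The number `n` counts the gluing points on the
  -- way.
  have main : ∀ x, ∃ n : ℕ,
      (glue O T).edge (((glue O T).opp ∘ (glue O T).edge)^[n] (g x)) = g (φ.symm (G.edge (φ x))) ∧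
      ∀ i < n, (glue O T).edge (((glue O T).opp ∘ (glue O T).edge)^[i] (g x)) ∉ Set.range g := by
    rintro (x | x)
    · have h := hO (Sum.inl x)
      rw [Sum.elim_inl] at h
      rcases hx : O.edge (Sum.inl x) with y | p <;> rw [hx] at h
      · exact ⟨0, by simp [g, h, hx], by simp⟩
      · refine ⟨1, by simp [g, h, hx, glueOpp, hf], ?_⟩
        rintro (_ | i) hi
        · simp [g, hx]
        · omega
    · rcases hx : T.edge (Sum.inl x) with y | p
      · exact ⟨0, by simp [g, hT x y hx, hx], by simp⟩
      · have hfp : f p = x := by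
          have := T.edge_edge (Sum.inl x)
          rw [hx, hf] at this
          exact Sum.inl_injective this
        subst hfp
        have h := hO (Sum.inr p)
        rw [Sum.elim_inr] at h
        rcases hy : O.edge (Sum.inr p) with y | q <;> rw [hy] at h
        · refine ⟨1, by simp [g, h, hx, hy, glueOpp], ?_⟩
          rintro (_ | i) hi
          · simp [g, hx]
          · omega
        · refine ⟨2, by simp [g, h, hx, hy, glueOpp, hf], ?_⟩
          rintro (_ | _ | i) hi
          · simp [g, hx]
          · simp [g, hx, hy, glueOpp]
          · omega
  exact
  { toHalf := g ∘ φ.symm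
    toVertex := ev
    toHalf_injective := hg.comp φ.symm.injective
    image_star := by
      intro v
      obtain ⟨v | v, rfl⟩ := ev.symm.surjective v
      · refine Set.image_range_eq_range id Function.surjective_id fun i => ?_
        simp [← hvO, g]
      · refine Set.image_range_eq_range id Function.surjective_id fun i => ?_
        simp [← hvT, g]
    opp_toHalf := by
      intro h
      obtain ⟨x, rfl⟩ := φ.surjective h
      simp only [Function.comp_apply, Equiv.symm_apply_apply, hopp, hgo]
    edge_toHalf := by
      intro h
      obtain ⟨x, rfl⟩ := φ.surjective h
      obtain ⟨n, hn, hi⟩ := main x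
      rw [hr, Function.comp_apply, Equiv.symm_apply_apply]
      exact ⟨n, hn, hi⟩
    meets := by
      rw [hr]
      have hO' : ∀ p, ∃ n : ℕ, ((glue O T).opp ∘ (glue O T).edge)^[n] (Sum.inl (Sum.inr p)) ∈
          Set.range g := by
        intro p
        rcases hy : O.edge (Sum.inr p) with y | q
        · exact ⟨1, Sum.inl (O.opp y), by simp [g, hy, glueOpp]⟩
        · exact ⟨2, Sum.inr (T.opp (f q)), by simp [g, hy, glueOpp, hf]⟩
      rintro ((x | p) | (x | p))
      · exact ⟨0, Sum.inl x, rfl⟩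
      · exact hO' p
      · exact ⟨0, Sum.inr x, rfl⟩
      · exact ⟨1, Sum.inr (T.opp (f p)), by simp [g, glueOpp, hf]⟩ }

end Tangle

namespace VirtualLinkDiagram

variable (D : VirtualLinkDiagram) {S C : Type} (κ : C ↪ D.Crossing)

/-- The passes through the crossings in the range of `κ`. -/
def innerPass (q : C × Bool) : D.Pass :=
  Sum.inl (κ q.1, q.2)

theorem innerPass_injective : Function.Injective (D.innerPass κ) := by
  rintro ⟨c, b⟩ ⟨c', b'⟩ h
  simpa [innerPass] using h

/-- The other passes. -/
abbrev OuterPass : Type :=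
  {q : D.Pass // q ∉ Set.range (D.innerPass κ)}

theorem inl_mem_range_innerPass {c : D.Crossing} {b : Bool} :
    (Sum.inl (c, b) : D.Pass) ∈ Set.range (D.innerPass κ) ↔ c ∈ Set.range κ := by
  simp [innerPass]

/-- The diagram `D` contains the crossings in the range of `κ` in the pattern `p`. -/
def HasPattern (p : StrandPattern S C) : Prop :=
  ∀ s, D.next (D.innerPass κ (p (s, false))) = D.innerPass κ (p (s, true))

/-- The half-edges that are not on the inner edges of a pattern. -/
def outerHalf (p : StrandPattern S C) : D.OuterPass κ × Bool ⊕ S × Bool → D.Pass × Bool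
  | Sum.inl (q, e) => (q, e)
  | Sum.inr i => (D.innerPass κ (p i), i.2)

variable {D κ}

theorem outerHalf_injective (p : StrandPattern S C) : Function.Injective (D.outerHalf κ p) := by
  rintro (⟨q, e⟩ | ⟨s, e⟩) (⟨q', e'⟩ | ⟨s', e'⟩) h <;> simp only [outerHalf, Prod.mk.injEq] at h
  · rw [Subtype.ext h.1, h.2]
  · exact absurd ⟨_, h.1.symm⟩ q.2
  · exact absurd ⟨_, h.1⟩ q'.2
  · have := p.injective (innerPass_injective D κ h.1)
    rw [this]

/-- The half-edges outside the image are those on inner edges of strands, and an inner edge has both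
of its half-edges there. So the complement of the image is closed under the involution `stateEdge`,
and hence so is the image; this provides the edges of the exterior. -/
theorem HasPattern.exists_outerHalf_eq {p : StrandPattern S C} (h : D.HasPattern κ p) (x) :
    ∃ y, D.outerHalf κ p y = D.stateEdge (D.outerHalf κ p x) := by
  have key : ∀ q e, (∃ y, D.outerHalf κ p y = (q, e)) ∨
      ∃ y, D.stateEdge (q, e) = (D.innerPass κ (p y), !y.2) := by
    intro q e
    by_cases hq : q ∈ Set.range (D.innerPass κ)
    · obtain ⟨i, rfl⟩ := hq
      obtain ⟨⟨s, i⟩, rfl⟩ := p.surjective i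
      -- Half-edge `e` of pass `i` of a strand faces outwards exactly when `i = e`: the first pass
      -- is entered from outside, and the second is left towards the outside.
      rcases eq_or_ne i e with rfl | hi
      · exact Or.inl ⟨Sum.inr (s, i), rfl⟩
      · right
        obtain rfl : e = !i := by revert hi; cases i <;> cases e <;> simp
        cases i
        · exact ⟨(s, true), by simp [stateEdge, h s]⟩
        · exact ⟨(s, false), by simp [stateEdge, ← h s]⟩
    · exact Or.inl ⟨Sum.inl (⟨q, hq⟩, e), rfl⟩
  rcases key (D.stateEdge (D.outerHalf κ p x)).1 (D.stateEdge (D.outerHalf κ p x)).2 with h' | h'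
  · exact h'
  · exfalso
    obtain ⟨y, hy⟩ := h'
    have e : D.stateEdge (D.stateEdge (D.outerHalf κ p x)) = D.outerHalf κ p x :=
      (D.stateGraph fun _ => .vertex).edge_edge _
    rw [Prod.mk.eta, e] at hy
    rcases x with ⟨q, e⟩ | i <;> simp only [outerHalf, Prod.mk.injEq] at hy
    · exact q.2 ⟨_, hy.1.symm⟩
    · have := p.injective (innerPass_injective D κ hy.1)
      subst this
      simp at hy

variable (D κ)

/-- The part of the graph of the state `s` outside the crossings of a pattern. -/
noncomputable abbrev exterior (p : StrandPattern S C) (h : D.HasPattern κ p)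
    (s : D.Crossing → Smoothing) : Tangle (S × Bool) where
  Half := D.OuterPass κ × Bool
  Vertex := {c // c ∉ Set.range κ ∧ s c = Smoothing.vertex}
  edge := fun x => (h.exists_outerHalf_eq x).choose
  edge_edge := fun x => by
    have h₁ := (h.exists_outerHalf_eq x).choose_spec
    have h₂ := (h.exists_outerHalf_eq (h.exists_outerHalf_eq x).choose).choose_spec
    exact outerHalf_injective p ((h₂.trans (congrArg D.stateEdge h₁)).trans ((D.stateGraph fun _ => .vertex).edge_edge _))
  edge_ne := fun x e => (D.stateGraph fun _ => .vertex).edge_ne (D.outerHalf κ p x) (by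
    have h₁ := (h.exists_outerHalf_eq x).choose_spec
    rw [e] at h₁
    exact h₁.symm)
  opp := fun x => (⟨(D.stateOpp s (x.1, x.2)).1, by
    obtain ⟨⟨⟨c, b⟩ | q, hq⟩, e⟩ := x
    · have hc : c ∉ Set.range κ := fun h => hq ((D.inl_mem_range_innerPass κ).2 h)
      cases hs : s c <;> simp only [stateOpp, hs] <;>
        exact fun h => hc ((D.inl_mem_range_innerPass κ).1 h)
    · exact hq⟩, (D.stateOpp s (x.1, x.2)).2)
  opp_opp := fun x => Prod.ext (Subtype.ext (congrArg Prod.fst ((D.stateGraph s).opp_opp _)))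
    (congrArg (fun y : D.Pass × Bool => y.2) ((D.stateGraph s).opp_opp (x.1.1, x.2)))
  opp_ne := fun x e => (D.stateGraph s).opp_ne (x.1, x.2)
    (Prod.ext (congrArg (fun y : D.OuterPass κ × Bool => y.1.1) e)
      (congrArg (fun y : D.OuterPass κ × Bool => y.2) e))
  half := fun i => (⟨Sum.inl (i.1.1, i.2.1), fun h =>
    i.1.2.1 ((D.inl_mem_range_innerPass κ).1 h)⟩, i.2.2)
  half_injective := by
    rintro ⟨⟨c, hc⟩, b, e⟩ ⟨⟨c', hc'⟩, b', e'⟩ h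
    simp only [Prod.mk.injEq, Subtype.mk.injEq, Sum.inl.injEq] at h
    simp [h]
  opp_half := by
    rintro ⟨c, hc, hs⟩ b e
    simp [stateOpp, hs]

theorem exterior_edge (p : StrandPattern S C) (h : D.HasPattern κ p) (s : D.Crossing → Smoothing)
    (x) : D.outerHalf κ p ((D.exterior κ p h s).edge x) = D.stateEdge (D.outerHalf κ p x) :=
  (h.exists_outerHalf_eq x).choose_spec

/-- The diagram `D` with another order of the passes. -/
abbrev withNext (ν : Equiv.Perm D.Pass) : VirtualLinkDiagram :=
  { D with next := ν }

/-- The graph of a state is glued from the exterior and the tangle of the crossings in a pattern.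
The vertices in `Z` have been resolved. -/
theorem nonempty_homeo_stateGraph [Finite S] [Finite C] (p q : StrandPattern S C)
    (h : D.HasPattern κ p)
    (s s' : D.Crossing → Smoothing) (hs : ∀ c, c ∉ Set.range κ → s c = s' c)
    (ν : Equiv.Perm D.Pass) (hν : (D.withNext ν).HasPattern κ q)
    (hedge : ∀ x, (D.withNext ν).stateEdge (D.outerHalf κ q x) =
      D.outerHalf κ q ((D.exterior κ p h s).edge x))
    (Z : Set D.Crossing) (hZ : Z ⊆ Set.range κ) (t : C → Option Smoothing)
    (ht : ∀ c, κ c ∈ Z → t c = none ∧ s' (κ c) = .vertex)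
    (ht' : ∀ c, κ c ∉ Z → t c = some (s' (κ c))) :
    Nonempty (FramedGraph.Homeo ((D.exterior κ p h s).glue (q.tangle t))
      (((D.withNext ν).stateGraph s').resolve {v | v.1 ∈ Z})) := by
  let φ : (D.OuterPass κ × Bool) ⊕ (C × Bool) × Bool → D.Pass × Bool :=
    Sum.elim (fun x => (x.1, x.2)) (fun x => (D.innerPass κ x.1, x.2))
  have hφ : Function.Bijective φ := by
    constructor
    · rintro (⟨x, e⟩ | ⟨x, e⟩) (⟨y, e'⟩ | ⟨y, e'⟩) hxy <;>
        simp only [φ, Sum.elim_inl, Sum.elim_inr, Prod.mk.injEq] at hxy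
      · rw [Subtype.ext hxy.1, hxy.2]
      · exact absurd ⟨_, hxy.1.symm⟩ x.2
      · exact absurd ⟨_, hxy.1⟩ y.2
      · rw [innerPass_injective D κ hxy.1, hxy.2]
    · rintro ⟨x, e⟩
      by_cases hx : x ∈ Set.range (D.innerPass κ)
      · obtain ⟨y, rfl⟩ := hx
        exact ⟨Sum.inr (y, e), rfl⟩
      · exact ⟨Sum.inl (⟨x, hx⟩, e), rfl⟩
  let g : {c // c ∉ Set.range κ ∧ s c = Smoothing.vertex} ⊕ {c // t c = some Smoothing.vertex} →
      {v : {c // s' c = Smoothing.vertex} // v ∉ {v : {c // s' c = Smoothing.vertex} | v.1 ∈ Z}} :=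
    Sum.elim (fun c => ⟨⟨c.1, hs c.1 c.2.1 ▸ c.2.2⟩, fun h => c.2.1 (hZ h)⟩)
      (fun c => ⟨⟨κ c.1, by
        by_cases hc : κ c.1 ∈ Z
        · exact (ht _ hc).2
        · simpa [c.2] using (ht' _ hc).symm⟩, fun h => by
          have := (ht c.1 h).1
          rw [c.2] at this
          cases this⟩)
  have hg : Function.Bijective g := by
    constructor
    · rintro (x | x) (y | y) hxy <;>
        simp only [g, Sum.elim_inl, Sum.elim_inr, Subtype.mk.injEq] at hxy
      · rw [Subtype.ext hxy]
      · exact absurd ⟨_, hxy.symm⟩ x.2.1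
      · exact absurd ⟨_, hxy⟩ y.2.1
      · rw [Subtype.ext (κ.injective hxy)]
    · rintro ⟨⟨c, hc⟩, hc'⟩
      by_cases hk : c ∈ Set.range κ
      · obtain ⟨c, rfl⟩ := hk
        exact ⟨Sum.inr ⟨c, by rw [ht' c hc', hc]⟩, rfl⟩
      · exact ⟨Sum.inl ⟨c, hk, by rw [hs c hk, hc]⟩, rfl⟩
  refine ⟨Tangle.decomposition (D.exterior κ p h s) (q.tangle t)
    (((D.withNext ν).stateGraph s').resolve {v | v.1 ∈ Z}) (Equiv.ofBijective φ hφ)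
    (fun i => (q i, i.2)) (fun i => rfl) ?_ ?_ ?_ (Equiv.ofBijective g hg).symm ?_ ?_⟩
  · rintro (⟨⟨⟨c, b⟩ | x, hx⟩, e⟩ | ⟨⟨c, b⟩, e⟩)
    · have hc : c ∉ Set.range κ := fun h => hx ((D.inl_mem_range_innerPass κ).2 h)
      change (D.withNext ν).stateOpp s' (Sum.inl (c, b), e) = D.stateOpp s (Sum.inl (c, b), e)
      simp only [stateOpp, hs c hc]
    · rfl
    · change (D.withNext ν).stateOpp s' (Sum.inl (κ c, b), e) =
        φ (Sum.inr (StrandPattern.opp t ((c, b), e)))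
      by_cases hc : κ c ∈ Z
      · obtain ⟨h₁, h₂⟩ := ht c hc
        simp [stateOpp, StrandPattern.opp, h₁, h₂, φ, innerPass]
      · have h₁ := ht' c hc
        cases h₂ : s' (κ c) <;> rw [h₂] at h₁ <;>
          simp [stateOpp, StrandPattern.opp, h₁, h₂, φ, innerPass]
  · have e : ∀ x, Sum.elim (fun h => φ (Sum.inl h)) (fun p => φ (Sum.inr (q p, p.2))) x =
        D.outerHalf κ q x := by rintro (x | x) <;> rfl
    intro x
    exact (congrArg _ (e x)).trans ((hedge x).trans (e _).symm)
  · rintro ⟨x, e⟩ l hl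
    obtain ⟨⟨r, i⟩, rfl⟩ := q.surjective x
    simp only [StrandPattern.edge, Equiv.symm_apply_apply] at hl
    split_ifs at hl with hi
    cases hl
    obtain rfl : e = !i := by revert hi; cases i <;> cases e <;> simp
    change (D.withNext ν).stateEdge (D.innerPass κ (q (r, i)), !i) =
      (D.innerPass κ (q (r, !i)), !!i)
    cases i
    · exact congrArg (fun y => (y, false)) (hν r)
    · exact congrArg (fun y => (y, true)) ((Equiv.symm_apply_eq _).2 (hν r).symm)
  · rintro v i
    rfl
  · rintro v i
    rfl

end VirtualLinkDiagram

/-! ### Deletion of crossings as a homeomorphism of graphs of states -/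

namespace VirtualLinkDiagram

section Deletion

variable {D D' : VirtualLinkDiagram}

/-- The pass after `p` (`e = true`) or before it. -/
def adjacent (D : VirtualLinkDiagram) (e : Bool) (p : D.Pass) : D.Pass :=
  if e then D.next p else D.next.symm p

theorem stateEdge_eq (p : D.Pass) (e : Bool) : D.stateEdge (p, e) = (D.adjacent e p, !e) := by
  cases e <;> rfl

variable {S : Set D.Crossing} {T : Set D.Virtual} (d : Deletion D D' S T)

namespace Deletion

/-- The passes of the new diagram as passes of the old one. -/
def pass : D'.Pass → D.Pass :=
  passMap d.crossing d.virtual d.mark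

theorem pass_injective : Function.Injective d.pass :=
  (d.crossing_injective.prodMap Function.injective_id).sumMap
    ((d.virtual_injective.prodMap Function.injective_id).sumMap d.mark_injective)

theorem inl_mem_range_pass {c : D.Crossing} {b : Bool} :
    (Sum.inl (c, b) : D.Pass) ∈ Set.range d.pass ↔ c ∉ S := by
  rw [← Set.mem_compl_iff, ← d.range_crossing]
  constructor
  · rintro ⟨⟨c', b'⟩ | q, h⟩
    · simp only [pass, passMap, Sum.map_inl, Prod.map_apply, id_eq, Sum.inl.injEq,
        Prod.mk.injEq] at h
      exact ⟨c', h.1⟩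
    · simp [pass, passMap] at h
  · rintro ⟨c', rfl⟩
    exact ⟨Sum.inl (c', b), rfl⟩

/-- Backwards, one reads in reverse the path that leads forwards from the previous surviving pass.
-/
theorem exists_adjacent (e : Bool) (q : D'.Pass) : ∃ n : ℕ,
    (D.adjacent e)^[n + 1] (d.pass q) = d.pass (D'.adjacent e q) ∧
      ∀ i < n, (D.adjacent e)^[i + 1] (d.pass q) ∉ Set.range d.pass := by
  cases e with
  | true => exact d.next_pass q
  | false =>
    obtain ⟨n, hn, hi⟩ := d.next_pass (D'.next.symm q)
    rw [Equiv.apply_symm_apply] at hn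
    have key : ∀ i ≤ n + 1, (D.adjacent false)^[i] (d.pass q) =
        D.next^[n + 1 - i] (d.pass (D'.next.symm q)) := by
      intro i hi
      have h : (D.adjacent false)^[i] (D.next^[i] (D.next^[n + 1 - i] (d.pass (D'.next.symm q)))) =
          D.next^[n + 1 - i] (d.pass (D'.next.symm q)) :=
        Function.LeftInverse.iterate (g := D.adjacent false) (f := D.next)
          D.next.symm_apply_apply i _
      rw [← Function.iterate_add_apply D.next, Nat.add_sub_cancel' hi] at h
      rw [← h]
      exact congrArg _ hn.symm
    refine ⟨n, ?_, fun i h => ?_⟩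
    · rw [key _ le_rfl, Nat.sub_self]
      rfl
    · rw [key _ (by omega), show n + 1 - (i + 1) = n - i - 1 + 1 by omega]
      exact hi _ (by omega)

theorem exists_iterate_mem (e : Bool) (q : D.Pass) :
    ∃ n : ℕ, (D.adjacent e)^[n] q ∈ Set.range d.pass := by
  obtain ⟨n, hn⟩ := d.meets q
  cases e with
  | true => exact ⟨n, hn⟩
  | false =>
    have hpos := orderOf_pos D.next
    have hpow := pow_orderOf_eq_one D.next
    -- Since `next` has finite order, this many steps backwards have the same effect as `n` steps
    -- forwards.
    refine ⟨n * (orderOf D.next - 1), ?_⟩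
    have h : (D.adjacent false)^[n * (orderOf D.next - 1)]
        (D.next^[n * (orderOf D.next - 1)] (D.next^[n] q)) = D.next^[n] q :=
      Function.LeftInverse.iterate (g := D.adjacent false) (f := D.next)
        D.next.symm_apply_apply _ _
    rw [← Function.iterate_add_apply D.next, ← Nat.mul_succ, Nat.succ_eq_add_one,
      Nat.sub_add_cancel hpos, ← Equiv.Perm.coe_pow, mul_comm n (orderOf D.next), pow_mul, hpow, one_pow] at h
    exact h ▸ hn

/-- Deleting crossings, in a state in which they are graphical vertices that are resolved. -/
noncomputable def homeo (s : D.Crossing → Smoothing) (s' : D'.Crossing → Smoothing)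
    (hs : ∀ c, s (d.crossing c) = s' c) (hS : ∀ c ∈ S, s c = Smoothing.vertex) :
    FramedGraph.Homeo ((D.stateGraph s).resolve {v | v.1 ∈ S}) (D'.stateGraph s') := by
  have opp_removed : ∀ p e, p ∉ Set.range d.pass → D.stateOpp s (p, e) = (p, !e) := by
    rintro (⟨c, b⟩ | q) e hp
    · rw [inl_mem_range_pass, not_not] at hp
      simp [stateOpp, hS c hp]
    · rfl
  have opp_pass : ∀ p e, D.stateOpp s (d.pass p, e) =
      (d.pass (D'.stateOpp s' (p, e)).1, (D'.stateOpp s' (p, e)).2) := by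
    rintro (⟨c, b⟩ | q) e
    · simp only [pass, passMap, Sum.map_inl, Prod.map_apply, id_eq, stateOpp, hs]
      cases s' c <;> rfl
    · rfl
  -- Deleted passes are traversed straight on, so a walk in the graph of the state that meets no
  -- others keeps its direction `e` and follows the strand.
  have iter : ∀ (p : D.Pass) (e : Bool) (n : ℕ),
      (∀ i < n, (D.adjacent e)^[i + 1] p ∉ Set.range d.pass) →
      (D.stateOpp s ∘ D.stateEdge)^[n] (p, e) = ((D.adjacent e)^[n] p, e) := by
    intro p e n hn
    induction n with
    | zero => rfl
    | succ n ih =>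
      rw [Function.iterate_succ_apply', ih fun i hi => hn i (by omega), Function.comp_apply,
        stateEdge_eq, ← Function.iterate_succ_apply' (D.adjacent e), opp_removed _ _ (hn n (by omega)),
        Bool.not_not]
  have hmem : ∀ p e, (p, e) ∈ Set.range (fun x : D'.Pass × Bool => (d.pass x.1, x.2)) ↔
      p ∈ Set.range d.pass := by
    intro p e
    constructor
    · rintro ⟨x, hx⟩
      exact ⟨x.1, congrArg Prod.fst hx⟩
    · rintro ⟨x, rfl⟩
      exact ⟨(x, e), rfl⟩
  let g : {c // s' c = Smoothing.vertex} →
      {v : {c // s c = Smoothing.vertex} // v ∉ {v : {c // s c = Smoothing.vertex} | v.1 ∈ S}} :=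
    fun c => ⟨⟨d.crossing c.1, (hs _).trans c.2⟩, by
      have : d.crossing c.1 ∈ Sᶜ := d.range_crossing ▸ Set.mem_range_self _
      exact this⟩
  have hg : Function.Bijective g := by
    constructor
    · intro x y h
      simp only [g, Subtype.mk.injEq] at h
      exact Subtype.ext (d.crossing_injective h)
    · rintro ⟨⟨c, hc⟩, hcS⟩
      have : c ∈ Set.range d.crossing := d.range_crossing ▸ hcS
      obtain ⟨c, rfl⟩ := this
      exact ⟨⟨c, (hs c).symm.trans hc⟩, rfl⟩
  exact
  { toHalf := fun x => (d.pass x.1, x.2)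
    toVertex := Equiv.ofBijective g hg
    toHalf_injective := d.pass_injective.prodMap Function.injective_id
    image_star := fun v =>
      Set.image_range_eq_range id Function.surjective_id fun i => rfl
    opp_toHalf := fun x => opp_pass x.1 x.2
    edge_toHalf := by
      rintro ⟨q, e⟩
      obtain ⟨n, hn, hi⟩ := d.exists_adjacent e q
      refine ⟨n, ?_, fun i h => ?_⟩
      · refine (congrArg D.stateEdge (iter _ e n hi)).trans ?_
        rw [stateEdge_eq, ← Function.iterate_succ_apply' (D.adjacent e), hn]
        exact congrArg (fun y : D'.Pass × Bool => (d.pass y.1, y.2)) (stateEdge_eq q e).symm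
      · have := congrArg D.stateEdge (iter (d.pass q) e i fun l hl => hi l (by omega))
        rw [stateEdge_eq ((D.adjacent e)^[i] (d.pass q)) e,
          ← Function.iterate_succ_apply' (D.adjacent e)] at this
        intro h'
        exact hi i h ((hmem _ (!e)).1 (this ▸ h'))
    meets := by
      classical
      rintro ⟨q, e⟩
      by_cases hq : q ∈ Set.range d.pass
      · obtain ⟨q, rfl⟩ := hq
        exact ⟨0, (q, e), rfl⟩
      · have hex := d.exists_iterate_mem e q
        obtain ⟨n, hn⟩ : ∃ n, Nat.find hex = n + 1 := by
          refine Nat.exists_eq_add_one.2 (Nat.pos_of_ne_zero fun h => ?_)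
          have := Nat.find_spec hex
          rw [h] at this
          exact hq this
        have hlast := Nat.find_spec hex
        rw [hn] at hlast
        obtain ⟨y, hy⟩ := hlast
        -- The first surviving pass ahead is `y`. The walk enters it from the side `!e`, and its
        -- last step goes on to the half-edge opposite to that one, which belongs to a surviving
        -- pass too.
        refine ⟨n + 1, D'.stateOpp s' (y, !e), ?_⟩
        refine (opp_pass y (!e)).symm.trans ?_
        rw [hy, Function.iterate_succ_apply' (D.adjacent e), ← stateEdge_eq, ← iter q e n]
        · exact (Function.iterate_succ_apply' (D.stateOpp s ∘ D.stateEdge) n (q, e)).symm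
        · intro i hi
          exact Nat.find_min hex (by omega) }

end Deletion

end Deletion

end VirtualLinkDiagram

/-! ### State sums, and local changes of a diagram -/

namespace VirtualLinkDiagram

variable {j : Version} {R M : Type*} [CommRing R] [AddCommGroup M] [Module R M]

section StateSum

open Classical in
/-- The sum over all states of a diagram, a state being weighted with the product of the given weights
of the smoothings. -/
noncomputable def stateSum (D : VirtualLinkDiagram) (I : PictureInvariant j R M)
    (w : D.Crossing → Smoothing → R) : M :=
  ∑ s : D.Crossing → Smoothing, (∏ c, w c (s c)) • I (D.stateGraph s)

variable (D : VirtualLinkDiagram) {S C : Type} (κ : C ↪ D.Crossing)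

/-- The crossings, split into those in the range of `κ` and the others. -/
noncomputable def splitCrossing : C ⊕ {c // c ∉ Set.range κ} ≃ D.Crossing :=
  Equiv.ofBijective (Sum.elim κ Subtype.val) (by
    constructor
    · rintro (x | x) (y | y) h
      · rw [κ.injective h]
      · exact absurd ⟨x, h⟩ y.2
      · exact absurd ⟨y, h.symm⟩ x.2
      · rw [Subtype.ext h]
    · intro c
      by_cases hc : c ∈ Set.range κ
      · obtain ⟨x, rfl⟩ := hc
        exact ⟨Sum.inl x, rfl⟩
      · exact ⟨Sum.inr ⟨c, hc⟩, rfl⟩)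

/-- The state given by states inside and outside the range of `κ`. -/
noncomputable def combine (t : C → Smoothing) (u : {c // c ∉ Set.range κ} → Smoothing) :
    D.Crossing → Smoothing :=
  Sum.elim t u ∘ (D.splitCrossing κ).symm

variable {κ}

theorem combine_inner (t : C → Smoothing) (u : {c // c ∉ Set.range κ} → Smoothing) (c : C) :
    D.combine κ t u (κ c) = t c := by
  have : (D.splitCrossing κ).symm (κ c) = Sum.inl c := (Equiv.symm_apply_eq _).2 rfl
  simp [combine, this]

theorem combine_outer (t : C → Smoothing) (u : {c // c ∉ Set.range κ} → Smoothing) (c) :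
    D.combine κ t u c.1 = u c := by
  have : (D.splitCrossing κ).symm c.1 = Sum.inr c := (Equiv.symm_apply_eq _).2 rfl
  simp [combine, this]

-- Grouping the states by what they do outside the pattern isolates the inner sum, which is taken
-- with a fixed exterior.
open Classical in
theorem stateSum_eq_sum_combine [Fintype C] [DecidableEq C] (I : PictureInvariant j R M)
    (w : D.Crossing → Smoothing → R) :
    D.stateSum I w = ∑ u : {c // c ∉ Set.range κ} → Smoothing, (∏ c, w c.1 (u c)) •
      ∑ t : C → Smoothing, (∏ c, w (κ c) (t c)) • I (D.stateGraph (D.combine κ t u)) := by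
  rw [stateSum, ← Fintype.sum_equiv ((Equiv.sumArrowEquivProdArrow C {c // c ∉ Set.range κ}
    Smoothing).symm.trans ((D.splitCrossing κ).arrowCongr (Equiv.refl _)))
    (fun x => ((∏ c, w c.1 (x.2 c)) * ∏ c, w (κ c) (x.1 c)) • I (D.stateGraph (D.combine κ x.1 x.2)))
    _ ?_, Fintype.sum_prod_type_right]
  · simp only [Finset.smul_sum, mul_smul]
  · rintro ⟨t, u⟩
    have h : ((Equiv.sumArrowEquivProdArrow C {c // c ∉ Set.range κ}
      Smoothing).symm.trans ((D.splitCrossing κ).arrowCongr (Equiv.refl _))) (t, u) =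
        D.combine κ t u := rfl
    rw [h, ← Fintype.prod_equiv (D.splitCrossing κ) (fun x => w (D.splitCrossing κ x)
      (D.combine κ t u (D.splitCrossing κ x))) _ (fun _ => rfl), Fintype.prod_sum_type, mul_comm]
    congr 2
    · exact Finset.prod_congr rfl fun c _ =>
        (congrArg (w (κ c)) (D.combine_inner t u c)).symm
    · exact Finset.prod_congr rfl fun c _ =>
        (congrArg (w c.1) (D.combine_outer t u c)).symm

/-- Resolving no vertex does not change the picture. -/
theorem _root_.PictureInvariant.resolve_empty (I : PictureInvariant j R M) (G : FramedGraph)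
    {Z : Set G.Vertex} (hZ : ∀ v, v ∉ Z) : I (G.resolve Z) = I G :=
  ((FramedGraph.Homeo.ofBijective (G := G) (G' := G.resolve Z) id Function.bijective_id
    (Equiv.subtypeUnivEquiv hZ) (fun _ => Set.image_id _) (fun _ => rfl)
    fun _ => rfl).apply_eq I).symm

variable [Fintype C] [Finite S] (I : PictureInvariant j R M) (p : StrandPattern S C)

/-- The exterior does not see the inner part `t'` of the state from which it is formed, so one
exterior serves for all inner states `t`. -/
theorem exterior_picture (h : D.HasPattern κ p) (t t' : C → Smoothing)
    (u : {c // c ∉ Set.range κ} → Smoothing) :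
    I ((D.exterior κ p h (D.combine κ t' u)).glue (p.tangle fun c => some (t c))) =
      I (D.stateGraph (D.combine κ t u)) := by
  obtain ⟨φ⟩ := D.nonempty_homeo_stateGraph κ p p h (D.combine κ t' u) (D.combine κ t u)
    (fun c hc => (D.combine_outer t' u ⟨c, hc⟩).trans (D.combine_outer t u ⟨c, hc⟩).symm) D.next h
    (fun x => (D.exterior_edge κ p h _ x).symm) ∅ (Set.empty_subset _) (fun c => some (t c))
    (fun _ h => h.elim) (fun c _ => congrArg some (D.combine_inner t u c).symm)
  exact (φ.apply_eq I).trans (I.resolve_empty _ fun v h => h)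

/-- Going straight on at all crossings of the pattern amounts to having vertices there and resolving
them, which is the form in which `Deletion.homeo` treats deleted crossings. -/
theorem exterior_picture_none (h : D.HasPattern κ p) (t' : C → Smoothing)
    (u : {c // c ∉ Set.range κ} → Smoothing) :
    I ((D.exterior κ p h (D.combine κ t' u)).glue (p.tangle fun _ => none)) =
      I ((D.stateGraph (D.combine κ (fun _ => .vertex) u)).resolve {v | v.1 ∈ Set.range κ}) := by
  obtain ⟨φ⟩ := D.nonempty_homeo_stateGraph κ p p h (D.combine κ t' u)
    (D.combine κ (fun _ => .vertex) u)
    (fun c hc => (D.combine_outer t' u ⟨c, hc⟩).trans (D.combine_outer _ u ⟨c, hc⟩).symm) D.next h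
    (fun x => (D.exterior_edge κ p h _ x).symm) (Set.range κ) le_rfl (fun _ => none)
    (fun c _ => ⟨rfl, D.combine_inner _ u c⟩) (fun c hc => absurd ⟨c, rfl⟩ hc)
  exact φ.apply_eq I

variable {D} {D' : VirtualLinkDiagram} {T : Set D.Virtual}

open Classical in
/-- If the crossings in a pattern can be removed locally, then they can be removed. -/
theorem stateSum_deletion [DecidableEq C] {Z : Set D.Crossing} (d : Deletion D D' Z T)
    (hZ : Z = Set.range κ)
    (h : D.HasPattern κ p)
    (w : D.Crossing → Smoothing → R)
    (hw : ∀ O : Tangle (S × Bool), ∑ t : C → Smoothing, (∏ c, w (κ c) (t c)) •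
      I (O.glue (p.tangle fun c => some (t c))) = I (O.glue (p.tangle fun _ => none))) :
    D'.stateSum I (fun c => w (d.crossing c)) = D.stateSum I w := by
  subst hZ
  have hd : ∀ c, d.crossing c ∉ Set.range κ := fun c => by
    rw [← Set.mem_compl_iff, ← d.range_crossing]
    exact Set.mem_range_self c
  let e : D'.Crossing ≃ {c // c ∉ Set.range κ} :=
    Equiv.ofBijective (fun c => ⟨d.crossing c, hd c⟩) (by
      constructor
      · intro x y hxy
        exact d.crossing_injective (congrArg Subtype.val hxy)
      · rintro ⟨c, hc⟩
        rw [← Set.mem_compl_iff, ← d.range_crossing] at hc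
        obtain ⟨x, rfl⟩ := hc
        exact ⟨x, rfl⟩)
  rw [D.stateSum_eq_sum_combine (κ := κ), stateSum]
  refine (Fintype.sum_equiv (e.arrowCongr (Equiv.refl _)).symm _ _ fun u => ?_).symm
  simp only [← D.exterior_picture I p h _ (fun _ => .vertex) u, hw, exterior_picture_none]
  congr 1
  · exact (Fintype.prod_equiv e _ _ fun c => rfl).symm
  · exact (d.homeo _ _ (fun c => D.combine_outer _ u (e c)) (by
      rintro _ ⟨c, rfl⟩
      exact D.combine_inner _ _ c)).apply_eq I

/-- The permutation `τ` exchanges the two passes on each strand of a triangle. -/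
structure Reverses (κ : Fin 3 ↪ D.Crossing) (τ : Equiv.Perm D.Pass) : Prop where
  inner : ∀ s i, τ (D.innerPass κ (StrandPattern.triangle false (s, i))) =
    D.innerPass κ (StrandPattern.triangle false (s, !i))
  outer : ∀ q, q ∉ Set.range (D.innerPass κ) → τ q = q

open StrandPattern in
theorem triangle_true (s : Fin 3) (i : Bool) : triangle true (s, i) = triangle false (s, !i) := by
  revert s i
  decide

/-- The half-edges on the boundary of the triangle move along with `τ`. This is why the diagrams
before and after the third move have the same exterior. -/
theorem Reverses.outerHalf {κ : Fin 3 ↪ D.Crossing} {τ : Equiv.Perm D.Pass} (h : Reverses κ τ) (x) :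
    D.outerHalf κ (StrandPattern.triangle true) x =
      (τ (D.outerHalf κ (StrandPattern.triangle false) x).1,
        (D.outerHalf κ (StrandPattern.triangle false) x).2) := by
  rcases x with ⟨q, e⟩ | ⟨s, e⟩
  · simp [VirtualLinkDiagram.outerHalf, h.outer _ q.2]
  · simp only [VirtualLinkDiagram.outerHalf, h.inner, triangle_true]

theorem rename_stateEdge (τ : Equiv.Perm D.Pass) (q : D.Pass) (e : Bool) :
    (D.rename τ).stateEdge (τ q, e) = (τ (D.stateEdge (q, e)).1, (D.stateEdge (q, e)).2) := by
  cases e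
  · refine congrArg (fun y => (y, true)) ?_
    change (τ * D.next * τ⁻¹).symm (τ q) = τ (D.next.symm q)
    rw [Equiv.symm_apply_eq]
    simp
  · refine congrArg (fun y => (y, false)) ?_
    change (τ * D.next * τ⁻¹) (τ q) = τ (D.next q)
    simp

open Classical in
/-- If the crossings in a triangle can be rearranged locally, then they can be rearranged. -/
theorem stateSum_rename {κ : Fin 3 ↪ D.Crossing} {τ : Equiv.Perm D.Pass} (hτ : Reverses κ τ)
    (h : D.HasPattern κ (StrandPattern.triangle false)) (w w' : D.Crossing → Smoothing → R)
    (hww' : ∀ c, c ∉ Set.range κ → w c = w' c)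
    (hw : ∀ O : Tangle (Fin 3 × Bool), ∑ t : Fin 3 → Smoothing, (∏ c, w (κ c) (t c)) •
      I (O.glue ((StrandPattern.triangle false).tangle fun c => some (t c))) =
        ∑ t : Fin 3 → Smoothing, (∏ c, w' (κ c) (t c)) •
      I (O.glue ((StrandPattern.triangle true).tangle fun c => some (t c)))) :
    D.stateSum I w = (D.rename τ).stateSum I w' := by
  rw [D.stateSum_eq_sum_combine (κ := κ)]
  refine Eq.trans ?_ ((D.rename τ).stateSum_eq_sum_combine (κ := κ) I w').symm
  refine Finset.sum_congr rfl fun u _ => ?_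
  have hpat : (D.rename τ).HasPattern κ (StrandPattern.triangle true) := by
    intro s
    have h₁ := congrArg Prod.fst (D.rename_stateEdge τ
      (D.innerPass κ (StrandPattern.triangle false (s, false))) true)
    rw [triangle_true, triangle_true]
    change (D.rename τ).next (D.innerPass κ _) = D.innerPass κ _
    rw [Bool.not_false, Bool.not_true]
    have h₂ := hτ.inner s false
    have h₃ := hτ.inner s true
    rw [Bool.not_false] at h₂
    rw [Bool.not_true] at h₃
    exact (congrArg (D.rename τ).next h₂.symm).trans (h₁.trans ((congrArg τ (h s)).trans h₃))
  -- The state of the renamed diagram is the old exterior, glued to the other triangle.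
  have key : ∀ t : Fin 3 → Smoothing, I ((D.exterior κ (StrandPattern.triangle false) h
      (D.combine κ (fun _ => .vertex) u)).glue
        ((StrandPattern.triangle true).tangle fun c => some (t c))) =
      I ((D.rename τ).stateGraph ((D.rename τ).combine κ t u)) := by
    intro t
    obtain ⟨φ⟩ := D.nonempty_homeo_stateGraph κ _ _ h (D.combine κ (fun _ => .vertex) u)
      (D.combine κ t u)
      (fun c hc => (D.combine_outer _ u ⟨c, hc⟩).trans (D.combine_outer t u ⟨c, hc⟩).symm)
      (τ * D.next * τ⁻¹) hpat (fun x => by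
        rw [hτ.outerHalf, hτ.outerHalf, D.exterior_edge]
        exact D.rename_stateEdge τ _ _) ∅ (Set.empty_subset _) (fun c => some (t c))
      (fun _ h => h.elim) (fun c _ => congrArg some (D.combine_inner t u c).symm)
    exact (φ.apply_eq I).trans (I.resolve_empty _ fun v h => h)
  have hl : ∀ t, I (D.stateGraph (D.combine κ t u)) = _ :=
    fun t => (D.exterior_picture I _ h t (fun _ => .vertex) u).symm
  simp only [hl, hw]
  congr 1
  · exact Finset.prod_congr rfl fun c _ => by rw [hww' c.1 c.2]
  · exact Finset.sum_congr rfl fun t _ =>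
      congrArg (fun m => (∏ c, w' (κ c) (t c)) • m) (key t)

end StateSum

section Sums

variable {A : Type*} [AddCommMonoid A]

theorem sum_unit_arrow (f : (Unit → Smoothing) → A) : ∑ t, f t = ∑ s, f fun _ => s :=
  Fintype.sum_equiv (Equiv.funUnique Unit Smoothing) _ _ fun _ => rfl

theorem sum_bool_arrow (f : (Bool → Smoothing) → A) :
    ∑ t, f t = ∑ s, ∑ s', f fun c => if c then s' else s := by
  rw [Fintype.sum_equiv (Equiv.boolArrowEquivProd Smoothing) f
    (fun x => f fun c => if c then x.2 else x.1) (fun t => congrArg f (by ext1 c; cases c <;> rfl)),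
    Fintype.sum_prod_type]

theorem sum_fin_three_arrow (f : (Fin 3 → Smoothing) → A) :
    ∑ t, f t = ∑ s₁, ∑ s₂, ∑ s₃, f ![s₁, s₂, s₃] := by
  let e : (Fin 3 → Smoothing) ≃ Smoothing × Smoothing × Smoothing :=
    { toFun := fun t => (t 0, t 1, t 2)
      invFun := fun x => ![x.1, x.2.1, x.2.2]
      left_inv := fun t => by ext i; fin_cases i <;> rfl
      right_inv := fun _ => rfl }
  rw [Fintype.sum_equiv e f (fun x => f (e.symm x)) (fun t => by rw [Equiv.symm_apply_apply]),
    Fintype.sum_prod_type]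
  exact Finset.sum_congr rfl fun _ _ => Fintype.sum_prod_type _

end Sums

end VirtualLinkDiagram

/-! ### Colourings inside and outside a pattern -/

namespace StrandPattern

variable {S C X : Type*}

/-- The colour of the edge that enters a pass, if the colours of the edges of the strand `s` are
`a s`, `m s` and `b s`. -/
def colourIn (a m : S → X) (i : S × Bool) : X :=
  if i.2 then m i.1 else a i.1

/-- The label of a crossing in a pattern, if the strands are coloured by `a`, `m` and `b`. -/
def label {S C : Type} (p : StrandPattern S C) (ε : C → Bool) (a m b : S → X) (c : C) : X × X :=
  if ε c then (colourIn a m (p.symm (c, false)), colourIn m b (p.symm (c, true)))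
  else (colourIn m b (p.symm (c, false)), colourIn a m (p.symm (c, true)))

/-- The colours of the other two edges at a crossing in a pattern. -/
def oppositeLabel {S C : Type} (p : StrandPattern S C) (ε : C → Bool) (a m b : S → X) (c : C) :
    X × X :=
  if ε c then (colourIn m b (p.symm (c, false)), colourIn a m (p.symm (c, true)))
  else (colourIn a m (p.symm (c, false)), colourIn m b (p.symm (c, true)))

/-- The rule for biquandle colourings at the crossings in a pattern. -/
def IsColoured [Biquandle X] {S C : Type} (p : StrandPattern S C) (ε : C → Bool) (a m b : S → X) :
    Prop :=
  ∀ c, p.oppositeLabel ε a m b c =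
    (Biquandle.circ (p.label ε a m b c).1 (p.label ε a m b c).2,
      Biquandle.star (p.label ε a m b c).2 (p.label ε a m b c).1)

end StrandPattern

/-- Two families that correspond to each other under a relation have the same values. -/
theorem Multiset.map_univ_eq_of_relation {α β M : Type*} [Fintype α] [Fintype β] {f : α → M}
    {g : β → M} (r : α → β → Prop) (h₁ : ∀ a, ∃! b, r a b) (h₂ : ∀ b, ∃! a, r a b)
    (h : ∀ a b, r a b → f a = g b) :
    (Finset.univ : Finset α).val.map f = (Finset.univ : Finset β).val.map g := by
  choose e he he' using h₁
  have hbij : Function.Bijective e := by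
    constructor
    · intro x y hxy
      exact (h₂ (e x)).unique (he x) (hxy ▸ he y)
    · intro b
      obtain ⟨a, ha, -⟩ := h₂ b
      exact ⟨a, (he' a b ha).symm⟩
  have huniv : (Finset.univ : Finset β) = Finset.univ.map (Equiv.ofBijective e hbij).toEmbedding :=
    (Finset.map_univ_equiv _).symm
  rw [huniv, Finset.map_val, Multiset.map_map]
  exact Multiset.map_congr rfl fun a _ => h a _ (he a)

namespace VirtualLinkDiagram

section Pattern

variable {D : VirtualLinkDiagram} {S C : Type} {κ : C ↪ D.Crossing} {p : StrandPattern S C}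
  {X : Type*}

variable (κ p) in
/-- The colours of the edges that enter a pattern. -/
def inColour (f : D.Pass → X) (s : S) : X :=
  f (D.next.symm (D.innerPass κ (p (s, false))))

variable (κ p) in
/-- The colours of the edges inside a pattern (`i = false`) or of those that leave it. -/
def outColour (i : Bool) (f : D.Pass → X) (s : S) : X :=
  f (D.innerPass κ (p (s, i)))

/-- An edge is named by the pass that it leaves. So the edge that enters the second pass of a strand
carries the name of the first pass, and here the pattern is needed. -/
theorem HasPattern.colourIn_eq (h : D.HasPattern κ p) (f : D.Pass → X) (x : C × Bool) :
    StrandPattern.colourIn (inColour κ p f) (outColour κ p false f) (p.symm x) =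
      f (D.next.symm (D.innerPass κ x)) := by
  obtain ⟨⟨s, i⟩, rfl⟩ := p.surjective x
  cases i
  · simp [StrandPattern.colourIn, inColour]
  · simp [StrandPattern.colourIn, outColour, ← h s]

theorem HasPattern.colourOut_eq (f : D.Pass → X) (x : C × Bool) :
    StrandPattern.colourIn (outColour κ p false f) (outColour κ p true f) (p.symm x) =
      f (D.innerPass κ x) := by
  obtain ⟨⟨s, i⟩, rfl⟩ := p.surjective x
  cases i <;> simp [StrandPattern.colourIn, outColour]

theorem HasPattern.label_eq (h : D.HasPattern κ p) (f : D.Pass → X) (c : C) :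
    D.label f (κ c) = p.label (fun c => D.positive (κ c)) (inColour κ p f) (outColour κ p false f)
      (outColour κ p true f) c := by
  simp only [StrandPattern.label, h.colourIn_eq, HasPattern.colourOut_eq]
  rfl

theorem HasPattern.oppositeLabel_eq (h : D.HasPattern κ p) (f : D.Pass → X) (c : C) :
    D.oppositeLabel f (κ c) = p.oppositeLabel (fun c => D.positive (κ c)) (inColour κ p f)
      (outColour κ p false f) (outColour κ p true f) c := by
  simp only [StrandPattern.oppositeLabel, h.colourIn_eq, HasPattern.colourOut_eq]
  rfl

variable (κ p) in
/-- The colours agree, except perhaps on the inner edges of a pattern. -/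
def AgreeOutside (f g : D.Pass → X) : Prop :=
  ∀ q, (∀ s, q ≠ D.innerPass κ (p (s, false))) → f q = g q

theorem HasPattern.symm_ne (h : D.HasPattern κ p) {q : D.Pass}
    (hq : ∀ s, q ≠ D.innerPass κ (p (s, true))) (s : S) :
    D.next.symm q ≠ D.innerPass κ (p (s, false)) := by
  intro h'
  rw [Equiv.symm_apply_eq, h s] at h'
  exact hq s h'

theorem AgreeOutside.inColour_eq {f g : D.Pass → X} (h : D.HasPattern κ p)
    (hfg : AgreeOutside κ p f g) : inColour κ p f = inColour κ p g := by
  ext1 s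
  refine hfg _ (h.symm_ne fun s' h' => ?_)
  simpa using p.injective (innerPass_injective D κ h')

theorem AgreeOutside.outColour_eq {f g : D.Pass → X}
    (hfg : AgreeOutside κ p f g) : outColour κ p true f = outColour κ p true g := by
  ext1 s
  refine hfg _ fun s' h' => ?_
  simpa using p.injective (innerPass_injective D κ h')

theorem AgreeOutside.eq_of_outer {f g : D.Pass → X} (h : D.HasPattern κ p)
    (hfg : AgreeOutside κ p f g) {q : D.Pass} (hq : q ∉ Set.range (D.innerPass κ)) :
    f q = g q ∧ f (D.next.symm q) = g (D.next.symm q) :=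
  ⟨hfg _ fun _ h' => hq ⟨_, h'.symm⟩, hfg _ (h.symm_ne fun _ h' => hq ⟨_, h'.symm⟩)⟩

theorem AgreeOutside.label_eq {f g : D.Pass → X} (h : D.HasPattern κ p)
    (hfg : AgreeOutside κ p f g) {c : D.Crossing} (hc : c ∉ Set.range κ) :
    D.label f c = D.label g c ∧ D.oppositeLabel f c = D.oppositeLabel g c := by
  have h₁ := hfg.eq_of_outer h (q := D.upper c) fun h => hc ((D.inl_mem_range_innerPass κ).1 h)
  have h₂ := hfg.eq_of_outer h (q := D.lower c) fun h => hc ((D.inl_mem_range_innerPass κ).1 h)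
  simp only [label, oppositeLabel, h₁.1, h₁.2, h₂.1, h₂.2, and_self]

theorem AgreeOutside.symm {f g : D.Pass → X} (h : AgreeOutside κ p f g) : AgreeOutside κ p g f :=
  fun q hq => (h q hq).symm

theorem AgreeOutside.trans {f g l : D.Pass → X} (h : AgreeOutside κ p f g)
    (h' : AgreeOutside κ p g l) : AgreeOutside κ p f l :=
  fun q hq => (h q hq).trans (h' q hq)

theorem AgreeOutside.eq {f g : D.Pass → X} (h : AgreeOutside κ p f g)
    (h' : outColour κ p false f = outColour κ p false g) : f = g := by
  ext1 q
  by_cases hq : ∃ s, q = D.innerPass κ (p (s, false))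
  · obtain ⟨s, rfl⟩ := hq
    exact congrFun h' s
  · exact h q fun s hs => hq ⟨s, hs⟩

variable (κ p) in
/-- The colours on the inner edges of a pattern can be prescribed. -/
theorem exists_agreeOutside (f : D.Pass → X) (m : S → X) :
    ∃ g, AgreeOutside κ p f g ∧ outColour κ p false g = m := by
  classical
  refine ⟨fun q => if hq : ∃ s, q = D.innerPass κ (p (s, false)) then m hq.choose else f q,
    fun q hq => ?_, ?_⟩
  · simp only [not_exists.2 hq, dite_false]
  · ext1 s
    have hq : ∃ s', D.innerPass κ (p (s, false)) = D.innerPass κ (p (s', false)) := ⟨s, rfl⟩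
    have hs : hq.choose = s := by
      have := p.injective (innerPass_injective D κ hq.choose_spec)
      exact (congrArg Prod.fst this).symm
    exact (dif_pos hq).trans (congrArg m hs)

variable [Biquandle X]

variable (κ) in
/-- The rules for colourings outside a pattern. -/
def IsOuterColouring (f : D.Pass → X) : Prop :=
  (∀ c, c ∉ Set.range κ → D.oppositeLabel f c =
    (Biquandle.circ (D.label f c).1 (D.label f c).2,
      Biquandle.star (D.label f c).2 (D.label f c).1)) ∧
  ∀ q : D.Virtual × Bool ⊕ D.Mark, f (D.next.symm (Sum.inr q)) = f (Sum.inr q)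

/-- The rules for colourings are local, and those at the crossings of the pattern involve only the
entering, the inner and the leaving edge of each strand. -/
theorem HasPattern.isColouring_iff (h : D.HasPattern κ p) (f : D.Pass → X) :
    D.IsColouring f ↔ IsOuterColouring κ f ∧ p.IsColoured (fun c => D.positive (κ c))
      (inColour κ p f) (outColour κ p false f) (outColour κ p true f) := by
  constructor
  · intro hf
    refine ⟨⟨fun c _ => hf.1 c, hf.2⟩, fun c => ?_⟩
    have := hf.1 (κ c)
    rwa [h.label_eq, h.oppositeLabel_eq] at this
  · rintro ⟨⟨h₁, h₂⟩, h₃⟩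
    refine ⟨fun c => ?_, h₂⟩
    by_cases hc : c ∈ Set.range κ
    · obtain ⟨c, rfl⟩ := hc
      rw [h.label_eq, h.oppositeLabel_eq]
      exact h₃ c
    · exact h₁ c hc

theorem AgreeOutside.isOuterColouring {f g : D.Pass → X} (h : D.HasPattern κ p)
    (hfg : AgreeOutside κ p f g) (hf : IsOuterColouring κ f) : IsOuterColouring κ g := by
  constructor
  · intro c hc
    rw [← (hfg.label_eq h hc).1, ← (hfg.label_eq h hc).2]
    exact hf.1 c hc
  · intro q
    have := hfg.eq_of_outer h (q := Sum.inr q) (by rintro ⟨x, hx⟩; cases hx)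
    rw [← this.1, ← this.2]
    exact hf.2 q

end Pattern

namespace Deletion

variable {D D' : VirtualLinkDiagram} {S : Set D.Crossing} {T : Set D.Virtual}
  (d : Deletion D D' S T) {X : Type*}

/-- The colour does not change at the places that are deleted. -/
def IsStraight (g : D.Pass → X) : Prop :=
  ∀ q, q ∉ Set.range d.pass → g (D.next.symm q) = g q

variable {d}

theorem IsStraight.iterate {g : D.Pass → X} (hg : d.IsStraight g) {n : ℕ} {q : D.Pass}
    (h : ∀ i < n, (D.adjacent false)^[i] q ∉ Set.range d.pass) :
    g ((D.adjacent false)^[n] q) = g q := by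
  induction n with
  | zero => rfl
  | succ n ih =>
    rw [Function.iterate_succ_apply', ← ih fun i hi => h i (by omega)]
    exact hg _ (h n (by omega))

theorem IsStraight.symm_apply {g : D.Pass → X} (hg : d.IsStraight g) (q : D'.Pass) :
    g (D.next.symm (d.pass q)) = g (d.pass (D'.next.symm q)) := by
  obtain ⟨n, hn, hi⟩ := d.exists_adjacent false q
  change g (D.adjacent false (d.pass q)) = g (d.pass (D'.adjacent false q))
  rw [← hn, Function.iterate_succ_apply, hg.iterate]
  intro i h
  rw [← Function.iterate_succ_apply (D.adjacent false)]
  exact hi i h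

theorem IsStraight.eq {g g' : D.Pass → X} (hg : d.IsStraight g) (hg' : d.IsStraight g')
    (h : ∀ q, g (d.pass q) = g' (d.pass q)) : g = g' := by
  classical
  ext1 q
  have hex := d.exists_iterate_mem false q
  have hmin : ∀ i < Nat.find hex, (D.adjacent false)^[i] q ∉ Set.range d.pass :=
    fun i hi => Nat.find_min hex hi
  obtain ⟨y, hy⟩ := Nat.find_spec hex
  rw [← hg.iterate hmin, ← hg'.iterate hmin, ← hy, h]

variable (d)

/-- Every map of the remaining passes extends to a map that is constant along what is deleted. -/
theorem exists_isStraight (f : D'.Pass → X) : ∃ g, d.IsStraight g ∧ ∀ q, g (d.pass q) = f q := by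
  classical
  have hex := d.exists_iterate_mem false
  -- An edge that leaves a deleted pass gets the colour of the last surviving pass before it.
  refine ⟨fun q => f (Nat.find_spec (hex q)).choose, fun q hq => ?_, fun q => ?_⟩
  · refine congrArg f (d.pass_injective ?_)
    rw [(Nat.find_spec (hex _)).choose_spec, (Nat.find_spec (hex q)).choose_spec]
    have h0 : Nat.find (hex q) = Nat.find (hex (D.next.symm q)) + 1 := by
      refine (Nat.find_eq_iff _).2 ⟨?_, ?_⟩
      · rw [Function.iterate_succ_apply]
        exact Nat.find_spec (hex (D.next.symm q))
      · rintro (_ | i) hi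
        · exact hq
        · rw [Function.iterate_succ_apply]
          exact Nat.find_min (hex (D.next.symm q)) (by omega)
    rw [h0, Function.iterate_succ_apply]
    rfl
  · refine congrArg f (d.pass_injective ?_)
    rw [(Nat.find_spec (hex _)).choose_spec, (Nat.find_eq_zero (hex (d.pass q))).2 ⟨q, rfl⟩]
    rfl

variable {d}

theorem IsStraight.label_eq {g : D.Pass → X} (hg : d.IsStraight g) (c : D'.Crossing) :
    D.label g (d.crossing c) = D'.label (g ∘ d.pass) c ∧
      D.oppositeLabel g (d.crossing c) = D'.oppositeLabel (g ∘ d.pass) c := by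
  have h₁ : ∀ b, g (D.next.symm (Sum.inl (d.crossing c, b))) =
    g (d.pass (D'.next.symm (Sum.inl (c, b)))) := fun b => hg.symm_apply (Sum.inl (c, b))
  simp only [label, oppositeLabel, d.positive_crossing, h₁]
  exact ⟨rfl, rfl⟩

/-- At a deleted mark or virtual crossing, being straight is the rule for colourings itself. At the
deleted classical crossings neither side imposes a rule. -/
theorem IsStraight.isColouring_iff [Biquandle X] {g : D.Pass → X} (hg : d.IsStraight g) {C : Type}
    {κ : C ↪ D.Crossing} (hκ : S = Set.range κ) :
    D'.IsColouring (g ∘ d.pass) ↔ IsOuterColouring κ g := by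
  have hc : ∀ c, c ∉ Set.range κ ↔ c ∈ Set.range d.crossing := by
    intro c
    rw [d.range_crossing, hκ]
    rfl
  constructor
  · rintro ⟨h₁, h₂⟩
    constructor
    · intro c hc'
      obtain ⟨c, rfl⟩ := (hc c).1 hc'
      rw [(hg.label_eq c).1, (hg.label_eq c).2]
      exact h₁ c
    · intro q
      by_cases hq : Sum.inr q ∈ Set.range d.pass
      · obtain ⟨⟨c, b⟩ | q', hq⟩ := hq
        · cases hq
        · rw [← hq, hg.symm_apply]
          exact h₂ q'
      · exact hg _ hq
  · rintro ⟨h₁, h₂⟩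
    constructor
    · intro c
      rw [← (hg.label_eq c).1, ← (hg.label_eq c).2]
      exact h₁ _ ((hc _).2 ⟨c, rfl⟩)
    · intro q
      exact (hg.symm_apply (Sum.inr q)).symm.trans (h₂ _)

end Deletion

end VirtualLinkDiagram

/-! ### The biquandle axioms as statements on coloured kinks, clasps and triangles -/

namespace Biquandle

variable {X : Type*} [Biquandle X]

theorem circ_injective (y : X) : Function.Injective fun x : X => circ x y :=
  (circ_bijective y).injective

theorem star_injective (y : X) : Function.Injective fun x : X => star x y :=
  (star_bijective y).injective

theorem sideways_injective {x y x' y' : X} (h₁ : star y x = star y' x')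
    (h₂ : circ x y = circ x' y') : x = x' ∧ y = y' :=
  Prod.mk.inj (sideways_bijective.injective (a₁ := (x, y)) (a₂ := (x', y')) (Prod.ext h₁ h₂))

/-- Because `x ∘ x = x ∗ x`, the sideways map sends `(x, x)` to the diagonal element with entries `x
∘ x`. Its injectivity thus passes to squaring, and finiteness gives surjectivity. -/
theorem circ_self_bijective [Finite X] : Function.Bijective fun x : X => circ x x := by
  refine Finite.injective_iff_bijective.1 fun x y h => ?_
  exact (sideways_injective (by rw [← circ_self, ← circ_self]; exact h) h).1

/-- The sideways image of `(x, y)` lies on the diagonal, so it is also the image of a diagonal pair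
`(w, w)` with `w ∘ w = x ∘ y`. Injectivity gives `x = w = y`. -/
theorem eq_of_circ_eq_star [Finite X] {x y : X} (h : circ x y = star y x) : x = y := by
  obtain ⟨w, hw⟩ := circ_self_bijective.surjective (circ x y)
  have hw : circ w w = circ x y := hw
  obtain ⟨h₁, h₂⟩ := sideways_injective (x := w) (y := w) (x' := x) (y' := y)
    (by rw [← circ_self, hw, h]) hw
  rw [← h₁, ← h₂]

end Biquandle

namespace StrandPattern

open Biquandle

variable {X : Type*} [Biquandle X]

/-- Depending on the sign and on which pass comes first, either both edges of the label are the
inner edge of the kink, and `circ_self` makes the two ends equal, or the other two edges at the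
crossing are the inner edge, and `eq_of_circ_eq_star` makes the label diagonal. -/
theorem kink_isColoured [Finite X] (b : Bool) (ε : Unit → Bool) (a m l : Unit → X)
    (h : (kink b).IsColoured ε a m l) :
    l = a ∧ ((kink b).label ε a m l ()).1 = ((kink b).label ε a m l ()).2 := by
  obtain ⟨e, rfl⟩ : ∃ e, ε = fun _ => e := ⟨ε (), rfl⟩
  have h₁ := congrArg Prod.fst (h ())
  have h₂ := congrArg Prod.snd (h ())
  have hext : l () = a () → l = a := fun h => funext fun _ => h
  revert h₁ h₂
  cases b <;> cases e <;> simp [label, oppositeLabel, colourIn] <;> intro h₁ h₂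
  · exact hext (h₂.trans ((circ_self _).symm.trans h₁.symm))
  · have := eq_of_circ_eq_star (h₁.symm.trans h₂)
    exact ⟨hext this.symm, this⟩
  · have := eq_of_circ_eq_star (h₁.symm.trans h₂)
    exact ⟨hext this, this⟩
  · exact hext (h₁.trans ((circ_self _).trans h₂.symm))

/-- The inner colour is the image of the outer one under `x ↦ x ∘ x` or its preimage, so bijectivity
of squaring is exactly what is needed. -/
theorem kink_existsUnique [Finite X] (b : Bool) (ε : Unit → Bool) (a : Unit → X) :
    ∃! m, (kink b).IsColoured ε a m a := by
  obtain ⟨e, rfl⟩ : ∃ e, ε = fun _ => e := ⟨ε (), rfl⟩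
  obtain ⟨x, rfl⟩ : ∃ x, a = fun _ => x := ⟨a (), rfl⟩
  have key : ∃! y : X, (if b ^^ e then circ x x = y else circ y y = x) := by
    cases b ^^ e
    · exact circ_self_bijective.existsUnique x
    · exact ⟨_, rfl, fun y h => h.symm⟩
  obtain ⟨y, hy, hy'⟩ := key
  refine ⟨fun _ => y, fun c => ?_, fun m hm => funext fun c => hy' _ ?_⟩
  · revert hy
    cases b <;> cases e <;> simp +contextual [label, oppositeLabel, colourIn, ← circ_self]
  · have h₁ := congrArg Prod.fst (hm ())
    revert h₁
    cases b <;> cases e <;> simp +contextual [label, oppositeLabel, colourIn]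

/-- Both crossings express the same inner colours, so the labels can be compared by cancellation.
According to directions and signs this uses `star_injective`, `circ_injective` or
`sideways_injective`. In the last case both labels consist of the inner edges, and nothing has to be
cancelled. -/
theorem clasp_isColoured (r : Bool) (ε : Bool → Bool) (hε : ε false ≠ ε true) (a m b : Bool → X)
    (h : (clasp r).IsColoured ε a m b) :
    b = a ∧ (clasp r).label ε a m b false = (clasp r).label ε a m b true := by
  have hext : b false = a false → b true = a true → b = a :=
    fun h h' => funext fun s => by cases s <;> assumption
  have h₁ := congrArg Prod.fst (h false)
  have h₂ := congrArg Prod.snd (h false)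
  have h₃ := congrArg Prod.fst (h true)
  have h₄ := congrArg Prod.snd (h true)
  revert h₁ h₂ h₃ h₄ hε
  cases r <;> rcases hf : ε false <;> rcases ht : ε true <;>
    simp [label, oppositeLabel, colourIn, hf, ht] <;> intro h₁ h₂ h₃ h₄
  · have := star_injective _ (h₄.symm.trans h₂)
    exact ⟨hext (by rw [h₃, h₁, this]) this, this.symm⟩
  · have := circ_injective _ (h₃.symm.trans h₁)
    exact ⟨hext this (by rw [h₄, h₂, this]), this.symm⟩
  · have := sideways_injective (h₂.symm.trans h₄) (h₁.symm.trans h₃)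
    exact ⟨hext this.1 this.2.symm, this⟩
  · exact hext (h₁.trans h₃.symm) (h₄.trans h₂.symm)

theorem clasp_existsUnique (r : Bool) (ε : Bool → Bool) (hε : ε false ≠ ε true) (a : Bool → X) :
    ∃! m, (clasp r).IsColoured ε a m a := by
  -- The pair `y` holds the inner colours of the lower and the upper strand. Three of the four cases
  -- give an equation to be solved or explicit formulas after solving one by a bijectivity axiom; in
  -- the remaining one the inner colours are explicit from the start.
  have key : ∃! y : X × X,
      if r then if ε false then star y.2 y.1 = a true ∧ circ y.1 y.2 = a false
        else y.1 = circ (a false) (a true) ∧ y.2 = star (a true) (a false)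
      else if ε false then star y.2 (a false) = a true ∧ y.1 = circ (a false) y.2
        else circ y.1 (a true) = a false ∧ y.2 = star (a true) y.1 := by
    cases r <;> cases ε false <;> simp only [if_true, if_false, Bool.false_eq_true]
    · obtain ⟨u, hu, hu'⟩ := (circ_bijective (a true)).existsUnique (a false)
      refine ⟨(u, star (a true) u), ⟨hu, rfl⟩, ?_⟩
      rintro ⟨v, w⟩ ⟨h₁, h₂⟩
      obtain rfl := hu' v h₁
      exact Prod.ext rfl h₂
    · obtain ⟨u, hu, hu'⟩ := (star_bijective (a false)).existsUnique (a true)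
      refine ⟨(circ (a false) u, u), ⟨hu, rfl⟩, ?_⟩
      rintro ⟨v, w⟩ ⟨h₁, h₂⟩
      obtain rfl := hu' w h₁
      exact Prod.ext h₂ rfl
    · exact ⟨(_, _), ⟨rfl, rfl⟩, fun y h => Prod.ext h.1 h.2⟩
    · obtain ⟨u, hu, hu'⟩ := sideways_bijective.existsUnique (a true, a false)
      exact ⟨u, Prod.mk.inj hu, fun y h => hu' y (Prod.ext h.1 h.2)⟩
  obtain ⟨y, hy, hy'⟩ := key
  refine ⟨fun c => if c then y.2 else y.1, fun c => ?_, fun m hm => ?_⟩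
  · revert hy hε
    cases r <;> rcases hf : ε false <;> rcases ht : ε true <;> cases c <;>
      simp +contextual [label, oppositeLabel, colourIn, hf, ht]
  · have h₁ := congrArg Prod.fst (hm false)
    have h₂ := congrArg Prod.snd (hm false)
    have := hy' (m false, m true) (by
      revert h₁ h₂
      cases r <;> rcases hf : ε false <;>
        simp +contextual [label, oppositeLabel, colourIn, hf])
    subst this
    ext1 c
    cases c <;> rfl

/-- The rule for colourings in a triangle of positive crossings. -/
theorem triangle_false_isColoured_iff (a m b : Fin 3 → X) :
    (triangle false).IsColoured (fun _ => true) a m b ↔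
      (m 0 = circ (a 0) (m 1) ∧ a 1 = star (m 1) (a 0)) ∧
      (b 0 = circ (m 0) (m 2) ∧ a 2 = star (m 2) (m 0)) ∧
      (b 1 = circ (m 1) (b 2) ∧ m 2 = star (b 2) (m 1)) := by
  simp [IsColoured, Fin.forall_fin_succ, label, oppositeLabel, colourIn]

theorem triangle_true_isColoured_iff (a m b : Fin 3 → X) :
    (triangle true).IsColoured (fun _ => true) a m b ↔
      (b 0 = circ (m 0) (b 1) ∧ m 1 = star (b 1) (m 0)) ∧
      (m 0 = circ (a 0) (b 2) ∧ m 2 = star (b 2) (a 0)) ∧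
      (m 1 = circ (a 1) (m 2) ∧ a 2 = star (m 2) (a 1)) := by
  simp [IsColoured, Fin.forall_fin_succ, label, oppositeLabel, colourIn]

/-- Only the inner colour of the middle strand has to be solved for, from `y ∘ b 2 = b 1`; the other
two are then explicit. After cancelling `∘ m 2`, the condition on `a 1` is `exchange₂`, and the
other two conditions are `exchange₁` and `exchange₃`. -/
theorem triangle_false_existsUnique {a m b : Fin 3 → X}
    (h : (triangle true).IsColoured (fun _ => true) a m b) :
    ∃! m', (triangle false).IsColoured (fun _ => true) a m' b := by
  obtain ⟨⟨h₁, h₂⟩, ⟨h₃, h₄⟩, h₅, h₆⟩ := (triangle_true_isColoured_iff a m b).1 h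
  obtain ⟨y, hy, hy'⟩ := (circ_bijective (b 2)).existsUnique (b 1)
  have hy : circ y (b 2) = b 1 := hy
  have ha : a 1 = star y (a 0) := by
    refine circ_injective (m 2) ?_
    change circ (a 1) (m 2) = circ _ (m 2)
    rw [← h₅, h₂, ← hy, h₃, h₄, exchange₂]
  refine ⟨![circ (a 0) y, y, star (b 2) y], (triangle_false_isColoured_iff _ _ _).2
    ⟨⟨rfl, ha⟩, ⟨?_, ?_⟩, hy.symm, rfl⟩, fun m' hm' => ?_⟩
  · change b 0 = circ (circ (a 0) y) (star (b 2) y)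
    rw [h₁, h₃, ← hy, exchange₁]
  · change a 2 = star (star (b 2) y) (circ (a 0) y)
    rw [h₆, h₄, ha, exchange₃]
  · obtain ⟨⟨h₁, -⟩, -, h₂, h₃⟩ := (triangle_false_isColoured_iff _ _ _).1 hm'
    obtain rfl := hy' _ h₂.symm
    ext1 s
    fin_cases s
    · exact h₁
    · rfl
    · exact h₃

/-- All inner colours are explicit here, and the three conditions that remain are the three exchange
laws. -/
theorem triangle_true_existsUnique {a m b : Fin 3 → X}
    (h : (triangle false).IsColoured (fun _ => true) a m b) :
    ∃! m', (triangle true).IsColoured (fun _ => true) a m' b := by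
  obtain ⟨⟨h₁, h₂⟩, ⟨h₃, h₄⟩, h₅, h₆⟩ := (triangle_false_isColoured_iff a m b).1 h
  refine ⟨![circ (a 0) (b 2), star (b 1) (circ (a 0) (b 2)), star (b 2) (a 0)],
    (triangle_true_isColoured_iff _ _ _).2 ⟨⟨?_, rfl⟩, ⟨rfl, rfl⟩, ?_, ?_⟩, fun m' hm' => ?_⟩
  · change b 0 = circ (circ (a 0) (b 2)) (b 1)
    rw [h₃, h₁, h₅, h₆, exchange₁]
  · change star (b 1) (circ (a 0) (b 2)) = circ (a 1) (star (b 2) (a 0))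
    rw [h₂, h₅, exchange₂]
  · change a 2 = star (star (b 2) (a 0)) (a 1)
    rw [h₄, h₁, h₂, h₆, exchange₃]
  · obtain ⟨⟨-, h₁⟩, ⟨h₂, h₃⟩, -⟩ := (triangle_true_isColoured_iff _ _ _).1 hm'
    ext1 s
    fin_cases s
    · exact h₂
    · exact h₁.trans (congrArg _ h₂)
    · exact h₃

/-- The labels of the crossings in a triangle of positive crossings. -/
theorem triangle_label {a m m' b : Fin 3 → X}
    (h : (triangle false).IsColoured (fun _ => true) a m b)
    (h' : (triangle true).IsColoured (fun _ => true) a m' b) :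
    ∃ x y z, (triangle false).label (fun _ => true) a m b =
      ![(x, y), (circ x y, star z y), (y, z)] ∧
      (triangle true).label (fun _ => true) a m' b =
        ![(circ x z, circ y z), (x, z), (star y x, star z x)] := by
  obtain ⟨⟨h₁, h₂⟩, -, h₅, h₆⟩ := (triangle_false_isColoured_iff a m b).1 h
  obtain ⟨-, ⟨h₃, h₄⟩, -⟩ := (triangle_true_isColoured_iff a m' b).1 h'
  -- These are the colours of the edge entering the lowest strand, of the inner edge of the middle
  -- strand before the move, and of the edge leaving the top strand.
  refine ⟨a 0, m 1, b 2, funext fun c => ?_, funext fun c => ?_⟩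
  · rw [← h₁, ← h₆]
    fin_cases c <;> rfl
  · rw [← h₂, ← h₃, ← h₄, ← h₅]
    fin_cases c <;> rfl

end StrandPattern

/-! ### Multisets of state sums under single moves -/

namespace VirtualLinkDiagram

open Biquandle

variable {j : Version} {R M X : Type*} [CommRing R] [AddCommGroup M] [Module R M] [Biquandle X]

/-- The relations between the coefficients of a bracket; `k b s x y` is the coefficient of the
smoothing `s` of a crossing of sign `b` with label `(x, y)`. -/
structure SkeinRelations (j : Version) (δ : R) (k : Bool → Smoothing → X → X → R) : Prop where
  kink : ∀ b x, δ * k b .oriented x x + k b .unoriented x x + k b .vertex x x = 1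
  kink_one : j = Version.one → ∀ b x, k b .vertex x x = 0
  clasp : ∀ b x y, StrandPattern.ClaspRelations j δ (fun s => k b s x y) (fun s => k (!b) s x y)
  triangle : ∀ x y z, StrandPattern.TriangleRelations j δ
    (fun s₁ s₂ s₃ => k true s₁ x y * k true s₂ y z * k true s₃ (circ x y) (star z y))
    (fun s₁ s₂ s₃ => k true s₁ x z * k true s₂ (star y x) (star z x) *
      k true s₃ (circ x z) (circ y z))

/-- The weights of the smoothings in a coloured diagram. -/
def weight (D : VirtualLinkDiagram) (k : Bool → Smoothing → X → X → R) (f : D.Pass → X)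
    (c : D.Crossing) (s : Smoothing) : R :=
  k (D.positive c) s (D.label f c).1 (D.label f c).2

open Classical in
/-- The multiset of the state sums of all colourings. -/
noncomputable def stateSums [Fintype X] (D : VirtualLinkDiagram) (I : PictureInvariant j R M)
    (k : Bool → Smoothing → X → X → R) : Multiset M :=
  (Finset.univ : Finset (D.Colouring X)).val.map fun f => D.stateSum I (D.weight k f.1)

variable {D D' : VirtualLinkDiagram} {Z : Set D.Crossing} {T : Set D.Virtual} {S C : Type}
  {κ : C ↪ D.Crossing} {p : StrandPattern S C}

/-- Straightness forces the inner edge of a strand to carry the colour of the entering edge. It then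
holds at the second pass too, as the leaving edge has the same colour. -/
theorem AgreeOutside.existsUnique_isStraight (d : Deletion D D' Z T) (hZ : Z = Set.range κ)
    (h : D.HasPattern κ p) {f : D.Pass → X} (hf : IsOuterColouring κ f)
    (hab : outColour κ p true f = inColour κ p f) :
    ∃! g, d.IsStraight g ∧ AgreeOutside κ p f g := by
  obtain ⟨g, hg, hm⟩ := exists_agreeOutside κ p f (inColour κ p f)
  refine ⟨g, ⟨?_, hg⟩, ?_⟩
  · rintro (⟨c, b⟩ | q) hq
    · have hc : Sum.inl (c, b) ∈ Set.range (D.innerPass κ) := by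
        rw [inl_mem_range_innerPass, ← hZ]
        rw [d.inl_mem_range_pass] at hq
        simpa using hq
      obtain ⟨x, hx⟩ := hc
      obtain ⟨⟨s, i⟩, rfl⟩ := p.surjective x
      rw [← hx]
      cases i
      · exact (congrFun (hg.inColour_eq h) s).symm.trans (congrFun hm s).symm
      · rw [← h s, Equiv.symm_apply_apply]
        exact (congrFun hm s).trans ((congrFun hab s).symm.trans ((congrFun hg.outColour_eq s).trans
          (congrArg g (h s).symm)))
    · exact (hg.isOuterColouring h hf).2 q
  · rintro g' ⟨hs', hg'⟩
    refine ((hg.symm.trans hg').eq ?_).symm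
    ext1 s
    rw [hm, hg'.inColour_eq h]
    refine hs' _ fun hr => ?_
    have : D.innerPass κ (p (s, false)) ∈ Set.range (D.innerPass κ) := ⟨_, rfl⟩
    have h₁ := (D.inl_mem_range_innerPass κ).1 this
    have h₂ := (d.inl_mem_range_pass).1 hr
    exact h₂ (hZ ▸ h₁)

end VirtualLinkDiagram

namespace VirtualLinkDiagram

open Biquandle

variable {j : Version} {R M X : Type*} [CommRing R] [AddCommGroup M] [Module R M]
  {D D' : VirtualLinkDiagram} {Z : Set D.Crossing} {T : Set D.Virtual} {S C : Type}
  {κ : C ↪ D.Crossing} {p : StrandPattern S C}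

section Rename

variable {κ : Fin 3 ↪ D.Crossing} {τ : Equiv.Perm D.Pass}

theorem withNext_symm_apply (τ : Equiv.Perm D.Pass) (q : D.Pass) :
    (D.withNext (τ * D.next * τ⁻¹)).next.symm (τ q) = τ (D.next.symm q) :=
  congrArg Prod.fst (D.rename_stateEdge τ q false)

open StrandPattern in
theorem Reverses.hasPattern (h : Reverses κ τ)
    (hp : D.HasPattern κ (triangle false)) :
    (D.withNext (τ * D.next * τ⁻¹)).HasPattern κ (triangle true) := by
  intro s
  rw [triangle_true, triangle_true]
  exact (congrArg (D.withNext (τ * D.next * τ⁻¹)).next (h.inner s false).symm).trans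
    ((congrArg Prod.fst (D.rename_stateEdge τ _ true)).trans
      ((congrArg τ (hp s)).trans (h.inner s true)))

open StrandPattern in
theorem Reverses.inColour_eq (h : Reverses κ τ) (f : D.Pass → X) :
    inColour (D := D.withNext (τ * D.next * τ⁻¹)) κ (triangle true) f = inColour κ (triangle false) (f ∘ τ) := by
  ext1 s
  rw [inColour, triangle_true]
  exact congrArg f ((congrArg (D.withNext (τ * D.next * τ⁻¹)).next.symm (h.inner s false).symm).trans
    (D.withNext_symm_apply τ _))

open StrandPattern in
theorem Reverses.outColour_eq (h : Reverses κ τ) (i : Bool) (f : D.Pass → X) :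
    outColour (D := D.withNext (τ * D.next * τ⁻¹)) κ (triangle true) i f =
      outColour κ (triangle false) i (f ∘ τ) := by
  ext1 s
  rw [outColour, triangle_true]
  exact congrArg f (h.inner s i).symm

theorem Reverses.label_eq (h : Reverses κ τ) (f : D.Pass → X) {c : D.Crossing}
    (hc : c ∉ Set.range κ) :
    (D.withNext (τ * D.next * τ⁻¹)).label f c = D.label (f ∘ τ) c ∧
      (D.withNext (τ * D.next * τ⁻¹)).oppositeLabel f c = D.oppositeLabel (f ∘ τ) c := by
  have h₁ : ∀ b, τ (Sum.inl (c, b)) = Sum.inl (c, b) :=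
    fun b => h.outer _ fun h => hc ((D.inl_mem_range_innerPass κ).1 h)
  have h₂ : ∀ b, (D.withNext (τ * D.next * τ⁻¹)).next.symm (Sum.inl (c, b)) = τ (D.next.symm (Sum.inl (c, b))) :=
    fun b => (congrArg (D.withNext (τ * D.next * τ⁻¹)).next.symm (h₁ b).symm).trans (D.withNext_symm_apply τ _)
  have h₃ : ∀ b, f ((D.withNext (τ * D.next * τ⁻¹)).next.symm (Sum.inl (c, b))) =
      (f ∘ τ) (D.next.symm (Sum.inl (c, b))) := fun b => congrArg f (h₂ b)
  have h₄ : ∀ b, f (Sum.inl (c, b)) = (f ∘ τ) (Sum.inl (c, b)) :=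
    fun b => congrArg f (h₁ b).symm
  have h₅ : (D.withNext (τ * D.next * τ⁻¹)).positive c = D.positive c := rfl
  constructor
  · unfold label
    rw [h₅]
    exact ite_congr rfl (fun _ => Prod.ext (h₃ _) (h₄ _)) fun _ => Prod.ext (h₄ _) (h₃ _)
  · unfold oppositeLabel
    rw [h₅]
    exact ite_congr rfl (fun _ => Prod.ext (h₄ _) (h₃ _)) fun _ => Prod.ext (h₃ _) (h₄ _)

variable [Biquandle X]

theorem Reverses.isOuterColouring_iff (h : Reverses κ τ) (f : D.Pass → X) :
    IsOuterColouring (D := D.withNext (τ * D.next * τ⁻¹)) κ f ↔ IsOuterColouring (D := D) κ (f ∘ τ) := by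
  refine and_congr (forall_congr' fun c => forall_congr' fun hc => ?_) (forall_congr' fun q => ?_)
  · rw [(h.label_eq f hc).1, (h.label_eq f hc).2]
  · have h₁ : τ (Sum.inr q) = Sum.inr q := h.outer _ (by rintro ⟨x, hx⟩; cases hx)
    have h₂ : (D.withNext (τ * D.next * τ⁻¹)).next.symm (Sum.inr q) = τ (D.next.symm (Sum.inr q)) :=
      (congrArg (D.withNext (τ * D.next * τ⁻¹)).next.symm h₁.symm).trans (D.withNext_symm_apply τ _)
    have h₃ : f ((D.withNext (τ * D.next * τ⁻¹)).next.symm (Sum.inr q)) = (f ∘ τ) (D.next.symm (Sum.inr q)) :=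
      congrArg f h₂
    have h₄ : f (Sum.inr q) = (f ∘ τ) (Sum.inr q) := congrArg f h₁.symm
    exact Iff.of_eq (congrArg₂ (· = ·) h₃ h₄)

variable [Fintype X] (I : PictureInvariant j R M) (k : Bool → Smoothing → X → X → R)

open StrandPattern in
/-- The third Reidemeister move for strands that all point upwards and positive crossings. -/
theorem stateSums_triangle (hk : SkeinRelations j I.δ k) (hτ : Reverses κ τ)
    (h : D.HasPattern κ (triangle false)) (hpos : ∀ c, D.positive (κ c) = true) :
    D.stateSums I k = (D.withNext (τ * D.next * τ⁻¹)).stateSums I k := by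
  classical
  have hpos : (fun c => D.positive (κ c)) = fun _ => true := funext hpos
  have h' := hτ.hasPattern h
  have hcol : ∀ f : D.Pass → X, (D.withNext (τ * D.next * τ⁻¹)).IsColouring f ↔
      IsOuterColouring (D := D) κ (f ∘ τ) ∧ (triangle true).IsColoured (fun _ => true)
        (inColour κ (triangle false) (f ∘ τ)) (outColour κ (triangle false) false (f ∘ τ))
        (outColour κ (triangle false) true (f ∘ τ)) := by
    intro f
    rw [h'.isColouring_iff, hτ.isOuterColouring_iff, hτ.inColour_eq, hτ.outColour_eq,
      hτ.outColour_eq, ← hpos]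
  have hcol₀ : ∀ f : D.Pass → X, D.IsColouring f ↔
      IsOuterColouring (D := D) κ f ∧ (triangle false).IsColoured (fun _ => true)
        (inColour κ (triangle false) f) (outColour κ (triangle false) false f)
        (outColour κ (triangle false) true f) := by
    intro f
    rw [h.isColouring_iff, hpos]
  -- Colourings correspond if, after renaming, they agree except on the inner edges of the triangle;
  -- there, each of them is determined by the colours outside.
  refine Multiset.map_univ_eq_of_relation (fun (f : D.Colouring X)
    (f' : (D.withNext (τ * D.next * τ⁻¹)).Colouring X) => AgreeOutside κ (triangle false) f.1 (f'.1 ∘ τ)) ?_ ?_ ?_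
  · rintro ⟨f, hf⟩
    obtain ⟨ho, hi⟩ := (hcol₀ f).1 hf
    obtain ⟨m, hm, hm'⟩ := triangle_true_existsUnique hi
    obtain ⟨g, hg, hgm⟩ := exists_agreeOutside κ (triangle false) f m
    have hgτ : (g ∘ τ.symm) ∘ τ = g := funext fun q => congrArg g (τ.symm_apply_apply q)
    refine ⟨⟨g ∘ τ.symm, (hcol _).2 ?_⟩, ?_, ?_⟩
    · rw [hgτ, hgm, ← hg.inColour_eq h, ← hg.outColour_eq]
      exact ⟨hg.isOuterColouring h ho, hm⟩
    · exact (congrArg (AgreeOutside κ (triangle false) f) hgτ).mpr hg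
    · rintro ⟨g', hg'⟩ hfg'
      obtain ⟨-, hi'⟩ := (hcol g').1 hg'
      have hfg' : AgreeOutside κ (triangle false) f (g' ∘ τ) := hfg'
      rw [← hfg'.inColour_eq h, ← hfg'.outColour_eq] at hi'
      have := (hfg'.symm.trans hg).eq (by rw [hgm, hm' _ hi'])
      refine Subtype.ext (funext fun q => ?_)
      have := congrFun this (τ.symm q)
      rwa [Function.comp_apply, Equiv.apply_symm_apply] at this
  · rintro ⟨f, hf⟩
    obtain ⟨ho, hi⟩ := (hcol f).1 hf
    obtain ⟨m, hm, hm'⟩ := triangle_false_existsUnique hi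
    obtain ⟨g, hg, hgm⟩ := exists_agreeOutside κ (triangle false) (f ∘ τ) m
    refine ⟨⟨g, (hcol₀ _).2 ?_⟩, hg.symm, ?_⟩
    · rw [hgm, ← hg.inColour_eq h, ← hg.outColour_eq]
      exact ⟨hg.isOuterColouring h ho, hm⟩
    · rintro ⟨g', hg'⟩ hfg'
      obtain ⟨-, hi'⟩ := (hcol₀ g').1 hg'
      have hfg' : AgreeOutside κ (triangle false) g' (f ∘ τ) := hfg'
      rw [hfg'.inColour_eq h, hfg'.outColour_eq] at hi'
      exact Subtype.ext ((hfg'.trans hg).eq (by rw [hgm, hm' _ hi']))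
  · rintro ⟨f, hf⟩ ⟨f', hf'⟩ hff'
    have hff' : AgreeOutside κ (triangle false) f (f' ∘ τ) := hff'
    obtain ⟨-, hi⟩ := (hcol₀ f).1 hf
    obtain ⟨-, hi'⟩ := (hcol f').1 hf'
    have hlab : ∀ c, D.label f (κ c) = _ := fun c => h.label_eq f c
    have hlab' : ∀ c, (D.withNext (τ * D.next * τ⁻¹)).label f' (κ c) = _ := fun c => h'.label_eq f' c
    rw [← hff'.inColour_eq h, ← hff'.outColour_eq] at hi'
    obtain ⟨x, y, z, hl, hl'⟩ := triangle_label hi hi'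
    rw [hpos, hl] at hlab
    have hpos' : (fun c => (D.withNext (τ * D.next * τ⁻¹)).positive (κ c)) = fun _ => true := hpos
    rw [hpos', hτ.inColour_eq, hτ.outColour_eq, hτ.outColour_eq, ← hff'.inColour_eq h,
      ← hff'.outColour_eq, hl'] at hlab'
    refine stateSum_rename I hτ h (D.weight k f) ((D.withNext (τ * D.next * τ⁻¹)).weight k f') ?_ ?_
    · intro c hc
      have : (D.withNext (τ * D.next * τ⁻¹)).label f' c = D.label f c :=
        (hτ.label_eq f' hc).1.trans (hff'.label_eq h hc).1.symm
      unfold weight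
      rw [this]
    · intro O
      have hw : ∀ c s, D.weight k f (κ c) s = _ := fun c s =>
        congrArg₂ (fun (b : Bool) (l : X × X) => k b s l.1 l.2) (congrFun hpos c) (hlab c)
      have hw' : ∀ c s, (D.withNext (τ * D.next * τ⁻¹)).weight k f' (κ c) s = _ := fun c s =>
        congrArg₂ (fun (b : Bool) (l : X × X) => k b s l.1 l.2) (congrFun hpos c) (hlab' c)
      simp only [hw]
      simp only [hw', sum_fin_three_arrow, Fin.prod_univ_three]
      have htriple : ∀ s₁ s₂ s₃ : Smoothing,
          (fun c => some (![s₁, s₂, s₃] c)) = triple s₁ s₂ s₃ := fun s₁ s₂ s₃ => by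
        ext1 c
        fin_cases c <;> rfl
      simp only [htriple]
      -- The sums run over the crossings in the order `ij`, `ik`, `jk`, whereas `triangle_skein`
      -- uses `ij`, `jk`, `ik` before the move and `ik`, `jk`, `ij` after it. So sums and factors
      -- are permuted.
      refine Eq.trans (Finset.sum_congr rfl fun s₁ _ => ?_)
        ((triangle_skein I O _ _ (hk.triangle x y z)).trans ?_)
      · rw [Finset.sum_comm]
        exact Finset.sum_congr rfl fun s₂ _ => Finset.sum_congr rfl fun s₃ _ =>
          congrArg (· • _) (mul_right_comm _ _ _)
      · refine (Finset.sum_congr rfl fun s₂ _ => Finset.sum_comm).trans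
          (Finset.sum_comm.trans ?_)
        exact Finset.sum_congr rfl fun s₁ _ => Finset.sum_congr rfl fun s₂ _ =>
          Finset.sum_congr rfl fun s₃ _ => congrArg (· • _) (mul_rotate _ _ _).symm

end Rename

variable [Biquandle X] [Fintype X] (I : PictureInvariant j R M) (k : Bool → Smoothing → X → X → R)

/-- If the crossings in a pattern can be removed locally, from all colourings, then they can be
removed. -/
theorem stateSums_deletion [Fintype C] [DecidableEq C] [Finite S] (d : Deletion D D' Z T)
    (hZ : Z = Set.range κ) (h : D.HasPattern κ p)
    (h₁ : ∀ a m b : S → X, p.IsColoured (fun c => D.positive (κ c)) a m b → b = a)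
    (h₂ : ∀ a : S → X, ∃! m, p.IsColoured (fun c => D.positive (κ c)) a m a)
    (hw : ∀ a m : S → X, p.IsColoured (fun c => D.positive (κ c)) a m a →
      ∀ O : Tangle (S × Bool), ∑ t : C → Smoothing, (∏ c, k (D.positive (κ c)) (t c)
        (p.label (fun c => D.positive (κ c)) a m a c).1
        (p.label (fun c => D.positive (κ c)) a m a c).2) •
          I (O.glue (p.tangle fun c => some (t c))) = I (O.glue (p.tangle fun _ => none))) :
    D.stateSums I k = D'.stateSums I k := by
  classical
  have hout : ∀ f : D.Colouring X, outColour κ p true f.1 = inColour κ p f.1 :=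
    fun f => h₁ _ _ _ ((h.isColouring_iff f.1).1 f.2).2
  -- The colourings are compared through a map `g` on `D` that is constant along everything deleted:
  -- it restricts to `f'`, and it differs from `f` at most on the inner edges of the pattern.
  refine Multiset.map_univ_eq_of_relation (fun (f : D.Colouring X) (f' : D'.Colouring X) =>
    ∃ g, d.IsStraight g ∧ AgreeOutside κ p f.1 g ∧ g ∘ d.pass = f'.1) ?_ ?_ ?_
  · intro f
    have hf := ((h.isColouring_iff f.1).1 f.2).1
    obtain ⟨g, ⟨hg, hfg⟩, hu⟩ := AgreeOutside.existsUnique_isStraight d hZ h hf (hout f)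
    refine ⟨⟨g ∘ d.pass, (hg.isColouring_iff hZ).2 (hfg.isOuterColouring h hf)⟩,
      ⟨g, hg, hfg, rfl⟩, ?_⟩
    rintro ⟨_, _⟩ ⟨g', hg', hfg', rfl⟩
    obtain rfl := hu g' ⟨hg', hfg'⟩
    rfl
  · intro f'
    obtain ⟨g, hg, hgf⟩ := d.exists_isStraight f'.1
    have hgf : g ∘ d.pass = f'.1 := funext hgf
    have ho := (hg.isColouring_iff hZ).1 (hgf ▸ f'.2)
    have hab : outColour κ p true g = inColour κ p g := by
      have hs : ∀ s i, D.innerPass κ (p (s, i)) ∉ Set.range d.pass := fun s i hr => by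
        have : D.innerPass κ (p (s, i)) ∈ Set.range (D.innerPass κ) := ⟨_, rfl⟩
        have h₁ := (D.inl_mem_range_innerPass κ).1 this
        exact (d.inl_mem_range_pass).1 hr (hZ ▸ h₁)
      ext1 s
      have e₁ := hg _ (hs s true)
      have e₂ := hg _ (hs s false)
      rw [← h s, Equiv.symm_apply_apply, h s] at e₁
      exact e₁.symm.trans e₂.symm
    obtain ⟨m, hm, hm'⟩ := h₂ (inColour κ p g)
    obtain ⟨f, hf, hfm⟩ := exists_agreeOutside κ p g m
    refine ⟨⟨f, (h.isColouring_iff f).2 ⟨hf.isOuterColouring h ho, ?_⟩⟩,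
      ⟨g, hg, hf.symm, hgf⟩, ?_⟩
    · rw [hfm, ← hf.inColour_eq h, ← hf.outColour_eq, hab]
      exact hm
    · rintro ⟨f₁, hf₁⟩ ⟨g₁, hg₁, hfg₁, hgf₁⟩
      obtain rfl := hg.eq hg₁ fun q => congrFun (hgf.trans hgf₁.symm) q
      refine Subtype.ext ((hfg₁.trans hf).eq ?_)
      rw [hfm]
      refine hm' _ ?_
      have := ((h.isColouring_iff f₁).1 hf₁).2
      rwa [hfg₁.inColour_eq h, hfg₁.outColour_eq, hab] at this
  · rintro f ⟨_, _⟩ ⟨g, hg, hfg, rfl⟩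
    have hf := ((h.isColouring_iff f.1).1 f.2).2
    rw [hout] at hf
    have hlab : D'.weight k (g ∘ d.pass) = fun c => D.weight k f.1 (d.crossing c) := by
      ext c s
      have hc : d.crossing c ∉ Set.range κ := by
        rw [← hZ, ← Set.mem_compl_iff, ← d.range_crossing]
        exact Set.mem_range_self c
      simp only [weight, d.positive_crossing, (hfg.label_eq h hc).1, (hg.label_eq c).1]
    change _ = D'.stateSum I (D'.weight k (g ∘ d.pass))
    rw [hlab]
    refine (stateSum_deletion I p d hZ h (D.weight k f.1) fun O => ?_).symm
    have := hw _ _ hf O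
    simp only [weight, h.label_eq, hout]
    convert this

end VirtualLinkDiagram

namespace VirtualLinkDiagram

open StrandPattern

variable {j : Version} {R M X : Type*} [CommRing R] [AddCommGroup M] [Module R M]
  {D D' : VirtualLinkDiagram} [Biquandle X] [Fintype X]
  (I : PictureInvariant j R M) (k : Bool → Smoothing → X → X → R)

/-- No classical crossing is involved, so this is the deletion of the empty pattern, for which the
local conditions are trivial. -/
theorem stateSums_detour {T : Set D.Virtual} (d : Deletion D D' ∅ T) :
    D.stateSums I k = D'.stateSums I k := by
  let κ : Empty ↪ D.Crossing := ⟨Empty.elim, fun x => x.elim⟩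
  refine stateSums_deletion (κ := κ) (S := Empty) (p := Equiv.equivOfIsEmpty _ _) I k d
    (Set.range_eq_empty _).symm (fun s => s.elim) (fun a m b _ => Subsingleton.elim _ _)
    (fun a => ⟨a, fun c => c.elim, fun _ _ => Subsingleton.elim _ _⟩) fun a m _ O => ?_
  rw [Fintype.sum_unique, Fintype.prod_empty, one_smul]
  congr 3
  ext1 c
  exact c.elim

theorem stateSums_kink (hk : SkeinRelations j I.δ k) (c : D.Crossing)
    (hc : D.next (D.upper c) = D.lower c ∨ D.next (D.lower c) = D.upper c)
    (d : Deletion D D' {c} ∅) : D.stateSums I k = D'.stateSums I k := by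
  let κ : Unit ↪ D.Crossing := ⟨fun _ => c, fun _ _ _ => rfl⟩
  obtain ⟨b, hb⟩ : ∃ b, D.HasPattern κ (kink b) := by
    rcases hc with hc | hc
    · exact ⟨true, fun _ => hc⟩
    · exact ⟨false, fun _ => hc⟩
  refine stateSums_deletion I k d Set.range_const.symm hb
    (fun a m l h => (kink_isColoured b _ a m l h).1) (fun a => kink_existsUnique b _ a)
    fun a m h O => ?_
  rw [sum_unit_arrow]
  simp only [Finset.univ_unique, Finset.prod_singleton]
  have hlab : ((kink b).label (fun _ => D.positive c) a m a ()).1 =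
    ((kink b).label (fun _ => D.positive c) a m a ()).2 := (kink_isColoured b _ a m a h).2
  have := kink_skein I b O (fun s => k (D.positive c) s
    ((kink b).label (fun _ => D.positive c) a m a ()).1
    ((kink b).label (fun _ => D.positive c) a m a ()).2)
    (by rw [← hlab]; exact hk.kink _ _) (fun e => by rw [← hlab]; exact hk.kink_one e _ _)
  exact this

theorem stateSums_clasp (hk : SkeinRelations j I.δ k) (c₁ c₂ : D.Crossing)
    (sign : D.positive c₁ ≠ D.positive c₂) (hover : D.next (D.upper c₁) = D.upper c₂)
    (hunder : D.next (D.lower c₁) = D.lower c₂ ∨ D.next (D.lower c₂) = D.lower c₁)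
    (d : Deletion D D' {c₁, c₂} ∅) : D.stateSums I k = D'.stateSums I k := by
  let κ : Bool ↪ D.Crossing := ⟨fun b => if b then c₂ else c₁, by
    have hne : c₁ ≠ c₂ := fun h => sign (congrArg _ h)
    rintro (_ | _) (_ | _) h
    · rfl
    · exact absurd h hne
    · exact absurd h.symm hne
    · rfl⟩
  have hκ : {c₁, c₂} = Set.range κ := (Bool.range_eq κ).symm
  obtain ⟨r, hr⟩ : ∃ r, D.HasPattern κ (clasp r) := by
    rcases hunder with h | h
    · refine ⟨false, ?_⟩
      rintro (_ | _)
      · exact h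
      · exact hover
    · refine ⟨true, ?_⟩
      rintro (_ | _)
      · exact h
      · exact hover
  have hs : D.positive (κ true) = !D.positive (κ false) := by
    have : D.positive (κ false) ≠ D.positive (κ true) := sign
    revert this
    cases D.positive (κ false) <;> cases D.positive (κ true) <;> simp
  refine stateSums_deletion I k d hκ hr
    (fun a m l h => (clasp_isColoured r _ sign a m l h).1) (fun a => clasp_existsUnique r _ sign a)
    fun a m h O => ?_
  rw [sum_bool_arrow]
  have hlab := (clasp_isColoured r _ sign a m a h).2
  have hp := hk.clasp (D.positive (κ false))
    ((clasp r).label (fun c => D.positive (κ c)) a m a true).1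
    ((clasp r).label (fun c => D.positive (κ c)) a m a true).2
  refine Eq.trans ?_ (clasp_skein I r O _ _ hp)
  refine Finset.sum_congr rfl fun s _ => Finset.sum_congr rfl fun s' _ => ?_
  rw [Fintype.prod_bool, ← hlab, hs, mul_comm]
  congr 4
  ext1 c
  cases c <;> rfl

end VirtualLinkDiagram

/-! ### Inserting a cancelling pair of crossings -/

/-- Iterating `f`, one comes from `x` to `y` without meeting `K` before. -/
def Leads {α : Type*} (f : α → α) (K : Set α) (x y : α) : Prop :=
  ∃ n : ℕ, f^[n] x = y ∧ ∀ i < n, f^[i] x ∉ K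

theorem Leads.refl {α : Type*} (f : α → α) (K : Set α) (x : α) : Leads f K x x :=
  ⟨0, rfl, fun _ h => (Nat.not_lt_zero _ h).elim⟩

theorem Leads.head {α : Type*} {f : α → α} {K : Set α} {x x' y : α} (hx : f x = x') (hK : x ∉ K)
    (h : Leads f K x' y) : Leads f K x y := by
  obtain ⟨n, hn, hi⟩ := h
  subst hx
  refine ⟨n + 1, hn, ?_⟩
  rintro (_ | i) h
  · exact hK
  · exact hi i (by omega)

namespace VirtualLinkDiagram

/-- `Insertion D E`: the diagram `E` is obtained from `D` by inserting two crossings, `first` and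
`second`, whose upper passes are adjacent, and whose lower passes are adjacent. They are inserted
next to the passes `point l`. On the strand through `point l` they come after that pass, `first`
before `second`, or they come before it, `second` before `first`. -/
structure Insertion (D E : VirtualLinkDiagram) where
  crossing : D.Crossing → E.Crossing
  virtual : D.Virtual ≃ E.Virtual
  mark : D.Mark ≃ E.Mark
  first : E.Crossing
  second : E.Crossing
  crossing_injective : Function.Injective crossing
  range_crossing : Set.range crossing = {first, second}ᶜ
  positive_crossing : ∀ c, E.positive (crossing c) = D.positive c
  sign : E.positive first ≠ E.positive second
  point : Bool → D.Pass
  after : Bool → Bool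
  /-- The first pass at or before `r` that comes directly after a pass of `D`, or after a pass
  that is inserted after one. -/
  enter : D.Pass → E.Pass
  enter_point : ∀ l, after l = false → enter (point l) = Sum.inl (second, l)
  enter_of_ne : ∀ r, (∀ l, after l = false → r ≠ point l) →
    enter r = passMap crossing virtual mark r
  next_enter : ∀ r, (∀ l, after l = true → r ≠ point l) →
    E.next (passMap crossing virtual mark r) = enter (D.next r)
  next_point : ∀ l, after l = true →
    E.next (passMap crossing virtual mark (point l)) = Sum.inl (first, l)
  next_first : ∀ l, E.next (Sum.inl (first, l)) =
    if after l then Sum.inl (second, l) else passMap crossing virtual mark (point l)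
  next_second : ∀ l, E.next (Sum.inl (second, l)) =
    if after l then enter (D.next (point l)) else Sum.inl (first, l)

namespace Insertion

variable {D E : VirtualLinkDiagram} (ins : Insertion D E)

/-- The passes of the old diagram as passes of the new one. -/
abbrev pass : D.Pass → E.Pass :=
  passMap ins.crossing ins.virtual ins.mark

theorem notMem_range_pass {c : E.Crossing} (h : c = ins.first ∨ c = ins.second) (l : Bool) :
    Sum.inl (c, l) ∉ Set.range ins.pass := by
  rintro ⟨⟨c', b⟩ | q, h'⟩
  · have h₁ : ins.crossing c' = c := by
      simpa using congrArg (Sum.elim (fun x => x.1) fun _ => c) h'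
    have h₂ : c ∈ Set.range ins.crossing := ⟨c', h₁⟩
    rw [ins.range_crossing] at h₂
    exact h₂ h
  · cases h'

theorem next_first_of_after {l : Bool} (hl : ins.after l = true) :
    E.next (Sum.inl (ins.first, l)) = Sum.inl (ins.second, l) :=
  (ins.next_first l).trans (if_pos hl)

theorem next_first_of_before {l : Bool} (hl : ins.after l = false) :
    E.next (Sum.inl (ins.first, l)) = ins.pass (ins.point l) :=
  (ins.next_first l).trans (if_neg (by simp [hl]))

theorem next_second_of_after {l : Bool} (hl : ins.after l = true) :
    E.next (Sum.inl (ins.second, l)) = ins.enter (D.next (ins.point l)) :=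
  (ins.next_second l).trans (if_pos hl)

theorem next_second_of_before {l : Bool} (hl : ins.after l = false) :
    E.next (Sum.inl (ins.second, l)) = Sum.inl (ins.first, l) :=
  (ins.next_second l).trans (if_neg (by simp [hl]))

theorem leads_enter (r : D.Pass) : Leads E.next (Set.range ins.pass) (ins.enter r) (ins.pass r) := by
  by_cases h : ∃ l, ins.after l = false ∧ r = ins.point l
  · obtain ⟨l, hl, rfl⟩ := h
    rw [ins.enter_point l hl]
    refine Leads.head (ins.next_second_of_before hl) (ins.notMem_range_pass (Or.inr rfl) l) ?_
    refine Leads.head (ins.next_first_of_before hl) (ins.notMem_range_pass (Or.inl rfl) l) ?_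
    exact Leads.refl _ _ _
  · rw [ins.enter_of_ne r fun l hl h' => h ⟨l, hl, h'⟩]
    exact Leads.refl _ _ _

theorem leads_next (r : D.Pass) :
    Leads E.next (Set.range ins.pass) (E.next (ins.pass r)) (ins.pass (D.next r)) := by
  by_cases h : ∃ l, ins.after l = true ∧ r = ins.point l
  · obtain ⟨l, hl, rfl⟩ := h
    rw [ins.next_point l hl]
    refine Leads.head (ins.next_first_of_after hl) (ins.notMem_range_pass (Or.inl rfl) l) ?_
    refine Leads.head (ins.next_second_of_after hl) (ins.notMem_range_pass (Or.inr rfl) l) ?_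
    exact ins.leads_enter _
  · rw [ins.next_enter r fun l hl h' => h ⟨l, hl, h'⟩]
    exact ins.leads_enter _

theorem leads_first (l : Bool) :
    ∃ r, Leads E.next (Set.range ins.pass) (Sum.inl (ins.first, l)) (ins.pass r) := by
  cases hl : ins.after l
  · exact ⟨_, Leads.head (ins.next_first_of_before hl)
      (ins.notMem_range_pass (Or.inl rfl) l) (Leads.refl _ _ _)⟩
  · exact ⟨_, Leads.head (ins.next_first_of_after hl)
      (ins.notMem_range_pass (Or.inl rfl) l) (Leads.head (ins.next_second_of_after hl)
        (ins.notMem_range_pass (Or.inr rfl) l) (ins.leads_enter _))⟩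

theorem leads_second (l : Bool) :
    ∃ r, Leads E.next (Set.range ins.pass) (Sum.inl (ins.second, l)) (ins.pass r) := by
  cases hl : ins.after l
  · obtain ⟨r, hr⟩ := ins.leads_first l
    exact ⟨r, Leads.head (ins.next_second_of_before hl)
      (ins.notMem_range_pass (Or.inr rfl) l) hr⟩
  · exact ⟨_, Leads.head (ins.next_second_of_after hl)
      (ins.notMem_range_pass (Or.inr rfl) l) (ins.leads_enter _)⟩

/-- The inserted crossings can be deleted again. -/
def deletion : Deletion E D {ins.first, ins.second} ∅ where
  crossing := ins.crossing
  virtual := ins.virtual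
  mark := ins.mark
  crossing_injective := ins.crossing_injective
  virtual_injective := ins.virtual.injective
  mark_injective := ins.mark.injective
  range_crossing := ins.range_crossing
  range_virtual := by rw [ins.virtual.surjective.range_eq, Set.compl_empty]
  positive_crossing := ins.positive_crossing
  next_pass p := ins.leads_next p
  meets := by
    rintro (⟨c, l⟩ | v | m)
    · by_cases hc : c ∈ Set.range ins.crossing
      · obtain ⟨c, rfl⟩ := hc
        exact ⟨0, Sum.inl (c, l), rfl⟩
      · rw [ins.range_crossing, Set.notMem_compl_iff] at hc
        rcases hc with rfl | rfl
        · obtain ⟨r, n, hn, -⟩ := ins.leads_first l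
          exact ⟨n, r, hn.symm⟩
        · obtain ⟨r, n, hn, -⟩ := ins.leads_second l
          exact ⟨n, r, hn.symm⟩
    · exact ⟨0, Sum.inr (Sum.inl (ins.virtual.symm v.1, v.2)), by simp⟩
    · exact ⟨0, Sum.inr (Sum.inr (ins.mark.symm m)), by simp⟩

end Insertion

/-- The value of `Φ` does not change under the second Reidemeister move. -/
def SecondInvariant {α : Type*} (Φ : VirtualLinkDiagram → α) : Prop :=
  ∀ ⦃D D' : VirtualLinkDiagram⦄ (c₁ c₂ : D.Crossing), D.positive c₁ ≠ D.positive c₂ →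
    D.next (D.upper c₁) = D.upper c₂ →
    (D.next (D.lower c₁) = D.lower c₂ ∨ D.next (D.lower c₂) = D.lower c₁) →
    Deletion D D' {c₁, c₂} ∅ → Φ D = Φ D'

/-- The second move has to be told which crossing comes first on the upper strand. This depends on
whether the pair stands after or before its point on that strand, and on the lower strand either
order is allowed. -/
theorem Insertion.apply_eq {D E : VirtualLinkDiagram} (ins : Insertion D E) {α : Type*}
    {Φ : VirtualLinkDiagram → α} (hΦ : SecondInvariant Φ) : Φ E = Φ D := by
  have h : ∀ l, if ins.after l then E.next (Sum.inl (ins.first, l)) = Sum.inl (ins.second, l)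
      else E.next (Sum.inl (ins.second, l)) = Sum.inl (ins.first, l) := by
    intro l
    cases hl : ins.after l
    · simpa [hl] using ins.next_second l
    · simpa [hl] using ins.next_first l
  have h₁ := h true
  have h₂ := h false
  cases ht : ins.after true
  · rw [ht] at h₁
    refine hΦ ins.second ins.first ins.sign.symm h₁ ?_ (Set.pair_comm _ _ ▸ ins.deletion)
    cases hf : ins.after false
    · rw [hf] at h₂
      exact Or.inl h₂
    · rw [hf] at h₂
      exact Or.inr h₂
  · rw [ht] at h₁
    refine hΦ ins.first ins.second ins.sign h₁ ?_ ins.deletion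
    cases hf : ins.after false
    · rw [hf] at h₂
      exact Or.inr h₂
    · rw [hf] at h₂
      exact Or.inl h₂

section AddPair

variable (D : VirtualLinkDiagram) (s : Bool) (b : Bool → D.Pass) (o : Bool → Bool)

/-- The passes of a diagram with two new crossings. -/
abbrev PairPass : Type :=
  (D.Crossing ⊕ Bool) × Bool ⊕ D.Virtual × Bool ⊕ D.Mark

/-- The old passes among the passes of a diagram with two new crossings. -/
abbrev oldPass : D.Pass → D.PairPass :=
  Sum.map (Prod.map Sum.inl id) (Sum.map (Prod.map (Equiv.refl D.Virtual) id) (Equiv.refl D.Mark))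

open Classical in
/-- The pass with which the part of the strand before `r` ends. -/
noncomputable def pairEnter (r : D.Pass) : D.PairPass :=
  if h : ∃ l, o l = false ∧ r = b l then Sum.inl (Sum.inr true, h.choose) else D.oldPass r

variable {b o}

theorem pairEnter_point (hb : Function.Injective b) (l : Bool) (hl : o l = false) :
    D.pairEnter b o (b l) = Sum.inl (Sum.inr true, l) := by
  have h : ∃ l', o l' = false ∧ b l = b l' := ⟨l, hl, rfl⟩
  rw [pairEnter, dif_pos h, ← hb h.choose_spec.2]

theorem pairEnter_of_ne (r : D.Pass) (h : ∀ l, o l = false → r ≠ b l) :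
    D.pairEnter b o r = D.oldPass r :=
  dif_neg fun ⟨l, hl, h'⟩ => h l hl h'

variable (b o)

open Classical in
/-- The successor of a pass after two crossings have been inserted. -/
noncomputable def pairNext : D.PairPass → D.PairPass :=
  fun q => match q with
  | Sum.inl (Sum.inr false, l) => if o l then Sum.inl (Sum.inr true, l) else D.oldPass (b l)
  | Sum.inl (Sum.inr true, l) =>
    if o l then D.pairEnter b o (D.next (b l)) else Sum.inl (Sum.inr false, l)
  | Sum.inl (Sum.inl c, l) => if h : ∃ l', o l' = true ∧ Sum.inl (c, l) = b l' then
      Sum.inl (Sum.inr false, h.choose) else D.pairEnter b o (D.next (Sum.inl (c, l)))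
  | Sum.inr q => if h : ∃ l', o l' = true ∧ Sum.inr q = b l' then
      Sum.inl (Sum.inr false, h.choose) else D.pairEnter b o (D.next (Sum.inr q))

open Classical in
theorem pairNext_oldPass (q : D.Pass) : D.pairNext b o (D.oldPass q) =
    if h : ∃ l', o l' = true ∧ q = b l' then
      Sum.inl (Sum.inr false, h.choose) else D.pairEnter b o (D.next q) := by
  rcases q with q | q | q <;> rfl

variable {b o}

theorem pairNext_point (hb : Function.Injective b) (l : Bool) (hl : o l = true) :
    D.pairNext b o (D.oldPass (b l)) = Sum.inl (Sum.inr false, l) := by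
  have h : ∃ l', o l' = true ∧ b l = b l' := ⟨l, hl, rfl⟩
  rw [pairNext_oldPass, dif_pos h, ← hb h.choose_spec.2]

theorem pairNext_of_ne (r : D.Pass) (h : ∀ l, o l = true → r ≠ b l) :
    D.pairNext b o (D.oldPass r) = D.pairEnter b o (D.next r) := by
  rw [pairNext_oldPass]
  exact dif_neg fun ⟨l, hl, h'⟩ => h l hl h'

theorem pairEnter_mem_range (r : D.Pass) : D.pairEnter b o r ∈ Set.range (D.pairNext b o) := by
  obtain ⟨r, rfl⟩ := D.next.surjective r
  by_cases h : ∃ l, o l = true ∧ r = b l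
  · obtain ⟨l, hl, rfl⟩ := h
    exact ⟨Sum.inl (Sum.inr true, l), by simp [pairNext, hl]⟩
  · exact ⟨D.oldPass r, D.pairNext_of_ne r fun l hl h' => h ⟨l, hl, h'⟩⟩

/-- As there are finitely many passes, surjectivity is enough to make this a permutation, and a
predecessor of each pass is easily named. -/
theorem pairNext_surjective (hb : Function.Injective b) :
    Function.Surjective (D.pairNext b o) := by
  have hold : ∀ r, D.oldPass r ∈ Set.range (D.pairNext b o) := by
    intro r
    by_cases h : ∃ l, o l = false ∧ r = b l
    · obtain ⟨l, hl, rfl⟩ := h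
      exact ⟨Sum.inl (Sum.inr false, l), by simp [pairNext, hl]⟩
    · rw [← D.pairEnter_of_ne (b := b) (o := o) r fun l hl h' => h ⟨l, hl, h'⟩]
      exact D.pairEnter_mem_range r
  rintro (⟨c | i, l⟩ | v | m)
  · exact hold (Sum.inl (c, l))
  · cases hl : o l <;> cases i
    · exact ⟨Sum.inl (Sum.inr true, l), by simp [pairNext, hl]⟩
    · rw [← D.pairEnter_point hb l hl]
      exact D.pairEnter_mem_range _
    · exact ⟨D.oldPass (b l), D.pairNext_point hb l hl⟩
    · exact ⟨Sum.inl (Sum.inr false, l), by simp [pairNext, hl]⟩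
  · exact hold (Sum.inr (Sum.inl v))
  · exact hold (Sum.inr (Sum.inr m))

/-- The diagram with two new crossings, of sign `!s` and `s`. -/
noncomputable abbrev addPair (s : Bool) (hb : Function.Injective b) : VirtualLinkDiagram where
  Crossing := D.Crossing ⊕ Bool
  Virtual := D.Virtual
  Mark := D.Mark
  positive := Sum.elim D.positive fun i => i ^^ !s
  next := Equiv.ofBijective (D.pairNext b o)
    (Finite.surjective_iff_bijective.1 (D.pairNext_surjective hb))

/-- Two new crossings can be inserted. -/
noncomputable def addPairInsertion (hb : Function.Injective b) :
    Insertion D (D.addPair (o := o) s hb) where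
  crossing := Sum.inl
  virtual := Equiv.refl _
  mark := Equiv.refl _
  first := Sum.inr false
  second := Sum.inr true
  crossing_injective := Sum.inl_injective
  range_crossing := by
    ext (c | i)
    · simp
    · cases i <;> simp
  positive_crossing _ := rfl
  sign := by cases s <;> simp
  point := b
  after := o
  enter := D.pairEnter b o
  enter_point := D.pairEnter_point hb
  enter_of_ne := D.pairEnter_of_ne
  next_enter := D.pairNext_of_ne
  next_point := D.pairNext_point hb
  next_first _ := rfl
  next_second _ := rfl

end AddPair

end VirtualLinkDiagram

/-! ### Trading the move at a crossing for the move at an inserted crossing -/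

namespace VirtualLinkDiagram

namespace Insertion

variable {D E : VirtualLinkDiagram} (ins : Insertion D E)

theorem withNext_apply (τ : Equiv.Perm D.Pass) (q : D.Pass) :
    (D.withNext (τ * D.next * τ⁻¹)).next (τ q) = τ (D.next q) := by
  simp

/-- Passes are exchanged on the strands of the crossing `x`, next to which two crossings are
inserted, so that then the first of these lies next to `x`. -/
structure Exchange (x : D.Crossing) (τ : Equiv.Perm D.Pass) (τ' : Equiv.Perm E.Pass) : Prop where
  next_eq : ∀ l, if ins.after l then D.next (Sum.inl (x, l)) = ins.point l
    else D.next (ins.point l) = Sum.inl (x, l)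
  point_injective : Function.Injective ins.point
  point_ne : ∀ l l', ins.point l ≠ Sum.inl (x, l')
  apply_crossing : ∀ l, τ (Sum.inl (x, l)) = ins.point l
  apply_point : ∀ l, τ (ins.point l) = Sum.inl (x, l)
  apply_first : ∀ l, τ' (Sum.inl (ins.first, l)) = ins.pass (ins.point l)
  apply_second : ∀ l, τ' (Sum.inl (ins.second, l)) = Sum.inl (ins.second, l)
  apply_pass_point : ∀ l, τ' (ins.pass (ins.point l)) = Sum.inl (ins.first, l)
  apply_pass_crossing : ∀ l, τ' (ins.pass (Sum.inl (x, l))) = ins.pass (Sum.inl (x, l))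
  apply_pass : ∀ q, (∀ l, q ≠ Sum.inl (x, l)) → (∀ l, q ≠ ins.point l) →
    τ' (ins.pass q) = ins.pass (τ q)

namespace Exchange

variable {ins} {x : D.Crossing} {τ : Equiv.Perm D.Pass} {τ' : Equiv.Perm E.Pass}

theorem next_of_after (h : ins.Exchange x τ τ') {l : Bool} (hl : ins.after l = true) :
    D.next (Sum.inl (x, l)) = ins.point l := by
  simpa [hl] using h.next_eq l

theorem next_of_before (h : ins.Exchange x τ τ') {l : Bool} (hl : ins.after l = false) :
    D.next (ins.point l) = Sum.inl (x, l) := by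
  simpa [hl] using h.next_eq l

open Classical in
/-- After the exchange, the crossing `x` is the second one that is inserted. -/
noncomputable abbrev crossing (ins : Insertion D E) (x : D.Crossing) (c : D.Crossing) : E.Crossing :=
  if c = x then ins.second else ins.crossing c

/-- The old passes among the new ones, if `x` is the second inserted crossing. -/
noncomputable abbrev pass (ins : Insertion D E) (x : D.Crossing) : D.Pass → E.Pass :=
  passMap (crossing ins x) ins.virtual ins.mark

theorem pass_crossing (l : Bool) : pass ins x (Sum.inl (x, l)) = Sum.inl (ins.second, l) := by
  simp

theorem pass_of_ne {q : D.Pass} (hq : ∀ l, q ≠ Sum.inl (x, l)) : pass ins x q = ins.pass q := by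
  rcases q with ⟨c, l⟩ | q
  · have hc : c ≠ x := fun h => hq l (by rw [h])
    simp [hc]
  · rfl

theorem pass_point (h : ins.Exchange x τ τ') (l : Bool) :
    pass ins x (ins.point l) = ins.pass (ins.point l) :=
  pass_of_ne (h.point_ne l)

open Classical in
/-- The first pass at or before `r` that comes directly after an old one. -/
noncomputable def enter (ins : Insertion D E) (x : D.Crossing) (r : D.Pass) : E.Pass :=
  if h : ∃ l, ins.after l = true ∧ r = ins.point l then ins.pass (Sum.inl (x, h.choose))
  else pass ins x r

theorem enter_point (h : ins.Exchange x τ τ') {l : Bool} (hl : ins.after l = true) :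
    enter ins x (ins.point l) = ins.pass (Sum.inl (x, l)) := by
  have hex : ∃ l', ins.after l' = true ∧ ins.point l = ins.point l' := ⟨l, hl, rfl⟩
  rw [enter, dif_pos hex, ← h.point_injective hex.choose_spec.2]

theorem enter_of_ne {r : D.Pass} (hr : ∀ l, ins.after l = true → r ≠ ins.point l) :
    enter ins x r = pass ins x r :=
  dif_neg fun ⟨l, hl, h'⟩ => hr l hl h'

/-- The exchange is compatible with the insertions. -/
theorem apply_enter (h : ins.Exchange x τ τ') {r : D.Pass}
    (hr : ∀ l, ins.after l = true → r ≠ ins.point l)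
    (hr' : ∀ l, ins.after l = false → r ≠ Sum.inl (x, l)) :
    τ' (ins.enter r) = enter ins x (τ r) := by
  by_cases hp : ∃ l, r = ins.point l
  · obtain ⟨l, rfl⟩ := hp
    have hl : ins.after l = false := by
      by_contra hl
      exact hr l (by simpa using hl) rfl
    rw [ins.enter_point l hl, h.apply_second, h.apply_point,
      enter_of_ne fun l' _ => (h.point_ne l' l).symm, pass_crossing]
  · have hp : ∀ l, r ≠ ins.point l := fun l hl => hp ⟨l, hl⟩
    rw [ins.enter_of_ne r fun l _ => hp l]
    by_cases hx : ∃ l, r = Sum.inl (x, l)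
    · obtain ⟨l, rfl⟩ := hx
      have hl : ins.after l = true := by
        by_contra hl
        exact hr' l (by simpa using hl) rfl
      rw [h.apply_crossing, h.enter_point hl]
      exact h.apply_pass_crossing l
    · have hx : ∀ l, r ≠ Sum.inl (x, l) := fun l hl => hx ⟨l, hl⟩
      have h₁ : ∀ l, τ r ≠ ins.point l := fun l hl =>
        hx l (τ.injective (hl.trans (h.apply_crossing l).symm))
      have h₂ : ∀ l, τ r ≠ Sum.inl (x, l) := fun l hl =>
        hp l (τ.injective (hl.trans (h.apply_point l).symm))
      rw [enter_of_ne fun l _ => h₁ l, pass_of_ne h₂]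
      exact h.apply_pass r hx hp

theorem injective_crossing : Function.Injective (crossing ins x) := by
  have hs : ∀ c, ins.second ≠ ins.crossing c := fun c hc => by
    have : ins.second ∈ Set.range ins.crossing := ⟨c, hc.symm⟩
    rw [ins.range_crossing] at this
    exact this (Or.inr rfl)
  intro c c' hcc
  by_cases h₁ : c = x <;> by_cases h₂ : c' = x <;>
    simp only [crossing, h₁, h₂, if_true, if_false] at hcc ⊢
  · exact absurd hcc (hs c')
  · exact absurd hcc.symm (hs c)
  · exact ins.crossing_injective hcc

theorem range_crossing :
    Set.range (crossing ins x) = {ins.first, ins.crossing x}ᶜ := by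
  have hr : ∀ y, y ∈ Set.range ins.crossing ↔ y ∉ ({ins.first, ins.second} : Set E.Crossing) :=
    fun y => by rw [ins.range_crossing]; rfl
  have hfs : ins.first ≠ ins.second := fun h => ins.sign (congrArg _ h)
  ext y
  constructor
  · rintro ⟨c, rfl⟩ hc
    by_cases hcx : c = x
    · rw [hcx, crossing, if_pos rfl] at hc
      rcases hc with hc | hc
      · exact hfs hc.symm
      · exact (hr _).1 ⟨x, hc.symm⟩ (Or.inr rfl)
    · rw [crossing, if_neg hcx] at hc
      rcases hc with hc | hc
      · exact (hr _).1 ⟨c, rfl⟩ (Or.inl hc)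
      · exact hcx (ins.crossing_injective hc)
  · intro hy
    by_cases hys : y = ins.second
    · exact ⟨x, by rw [crossing, if_pos rfl, hys]⟩
    · obtain ⟨c, rfl⟩ := (hr y).2 (by
        rintro (h | h)
        · exact hy (Or.inl h)
        · exact hys h)
      exact ⟨c, if_neg fun h => hy (Or.inr (congrArg _ h))⟩

theorem next_apply (τ' : Equiv.Perm E.Pass) {y z : E.Pass} (h : τ' y = z) :
    (E.withNext (τ' * E.next * τ'⁻¹)).next z = τ' (E.next y) := by
  rw [← h, withNext_apply]

/-- After the exchange, the crossing `x` and the first crossing of those inserted can be regarded as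
inserted. -/
noncomputable def insertion (h : ins.Exchange x τ τ') (hx : E.positive ins.second = D.positive x) :
    Insertion (D.withNext (τ * D.next * τ⁻¹)) (E.withNext (τ' * E.next * τ'⁻¹)) where
  -- On each strand through `x` the order in `E` is `x`, point, first, second, or the reverse of
  -- this. The exchange turns it into `x`, first, point, second. Forgetting `x` and the first
  -- crossing leaves point, second: this is `D` after its own exchange, with the second crossing in
  -- the place of `x`. The cancelling pair now stands on the other side of the point, so `after` is
  -- negated.
  crossing := crossing (D := D) (E := E) ins x
  virtual := ins.virtual
  mark := ins.mark
  first := ins.first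
  second := ins.crossing x
  crossing_injective := injective_crossing
  range_crossing := range_crossing
  positive_crossing c := by
    by_cases hc : c = x
    · simp only [crossing, hc, if_true]
      exact hx
    · simp only [crossing, hc, if_false]
      exact ins.positive_crossing c
  sign := by
    have := ins.sign
    rw [hx] at this
    exact fun h => this (h.trans (ins.positive_crossing x))
  point := ins.point
  after l := !ins.after l
  enter := enter (D := D) (E := E) ins x
  enter_point l hl := h.enter_point (by simpa using hl)
  enter_of_ne r hr := enter_of_ne fun l hl => hr l (by simpa using hl)
  next_enter := by
    intro r hr
    obtain ⟨q, rfl⟩ := τ.surjective r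
    rw [withNext_apply]
    change (E.withNext (τ' * E.next * τ'⁻¹)).next (pass (E := E) ins x (τ q)) = _
    by_cases hp : ∃ l, q = ins.point l
    · obtain ⟨l, rfl⟩ := hp
      rw [h.apply_point, pass_crossing, next_apply τ' (h.apply_second l)]
      cases hl : ins.after l
      · rw [ins.next_second_of_before hl, h.apply_first, h.next_of_before hl, h.apply_crossing,
          enter_of_ne, h.pass_point]
        intro l' hl' hll
        rw [h.point_injective hll, hl'] at hl
        cases hl
      · rw [ins.next_second_of_after hl]
        refine h.apply_enter (fun l' hl' hll => ?_) fun l' hl' hll => ?_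
        · rw [← h.next_of_after hl'] at hll
          exact h.point_ne _ _ (D.next.injective hll)
        · rw [← h.next_of_before hl'] at hll
          rw [h.point_injective (D.next.injective hll), hl'] at hl
          cases hl
    have hp : ∀ l, q ≠ ins.point l := fun l hl => hp ⟨l, hl⟩
    by_cases hc : ∃ l, q = Sum.inl (x, l)
    · obtain ⟨l, rfl⟩ := hc
      rw [h.apply_crossing] at hr ⊢
      have hl : ins.after l = true := by
        by_contra hl
        exact hr l (by simpa using hl) rfl
      rw [h.pass_point, next_apply τ' (h.apply_first l), ins.next_first_of_after hl,
        h.apply_second, h.next_of_after hl, h.apply_point,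
        enter_of_ne fun l' _ => (h.point_ne l' l).symm, pass_crossing]
    · have hc : ∀ l, q ≠ Sum.inl (x, l) := fun l hl => hc ⟨l, hl⟩
      rw [pass_of_ne fun l hl => hp l (τ.injective (hl.trans (h.apply_point l).symm)),
        next_apply τ' (h.apply_pass q hc hp), ins.next_enter q fun l _ => hp l]
      refine h.apply_enter (fun l hl hll => ?_) fun l hl hll => ?_
      · rw [← h.next_of_after hl] at hll
        exact hc l (D.next.injective hll)
      · rw [← h.next_of_before hl] at hll
        exact hp l (D.next.injective hll)
  next_point l hl := by
    have hl : ins.after l = false := by simpa using hl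
    change (E.withNext (τ' * E.next * τ'⁻¹)).next (pass (E := E) ins x (ins.point l)) = _
    rw [h.pass_point, next_apply τ' (h.apply_first l), ins.next_first_of_before hl,
      h.apply_pass_point]
  next_first l := by
    rw [next_apply τ' (h.apply_pass_point l)]
    cases hl : ins.after l
    · rw [ins.next_enter, h.next_of_before hl, ins.enter_of_ne _ fun l' _ => (h.point_ne l' l).symm]
      · exact h.apply_pass_crossing l
      · intro l' hl' hll
        rw [h.point_injective hll, hl'] at hl
        cases hl
    · rw [ins.next_point l hl, h.apply_first]
      exact (h.pass_point l).symm
  next_second l := by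
    refine (next_apply τ' (h.apply_pass_crossing l)).trans ?_
    rw [ins.next_enter _ fun l' _ => (h.point_ne l' l).symm]
    cases hl : ins.after l
    · refine Eq.trans ?_ (congrArg (enter ins x)
        ((withNext_apply τ (Sum.inl (x, l))).symm.trans (by rw [h.apply_crossing])))
      refine h.apply_enter (fun l' hl' hll => ?_) fun l' hl' hll => ?_
      · rw [← h.next_of_after hl'] at hll
        have := D.next.injective hll
        simp only [Sum.inl.injEq, Prod.mk.injEq, true_and] at this
        rw [this, hl'] at hl
        cases hl
      · rw [← h.next_of_before hl'] at hll
        exact h.point_ne _ _ (D.next.injective hll).symm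
    · rw [h.next_of_after hl, ins.enter_of_ne, h.apply_pass_point]
      · rfl
      · intro l' hl' hll
        rw [h.point_injective hll, hl'] at hl
        cases hl

end Exchange

/-- The exchange at the crossing `x` does not change `Φ` if the exchange at the first crossing that
is inserted does not. -/
theorem Exchange.apply_eq {x : D.Crossing} {τ : Equiv.Perm D.Pass} {τ' : Equiv.Perm E.Pass}
    (h : ins.Exchange x τ τ') (hx : E.positive ins.second = D.positive x) {α : Type*}
    {Φ : VirtualLinkDiagram → α} (hΦ : SecondInvariant Φ)
    (hE : Φ E = Φ (E.rename τ')) : Φ D = Φ (D.rename τ) :=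
  (ins.apply_eq hΦ).symm.trans (hE.trans ((h.insertion hx).apply_eq hΦ))

end Insertion

end VirtualLinkDiagram

/-! ### Reduction of all third moves to a single one -/

theorem Equiv.swap_mul_swap_comm {α : Type*} [DecidableEq α] {a b c d : α} (hac : a ≠ c)
    (had : a ≠ d) (hbc : b ≠ c) (hbd : b ≠ d) :
    Equiv.swap a b * Equiv.swap c d = Equiv.swap c d * Equiv.swap a b := by
  ext x
  simp only [Equiv.Perm.mul_apply, Equiv.swap_apply_def]
  grind

namespace VirtualLinkDiagram

/-- Exchanging three pairs of passes. -/
abbrev swaps {α : Type*} [DecidableEq α] (a b : Bool → α) (c d : α) : Equiv.Perm α :=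
  Equiv.swap (a false) (b false) * Equiv.swap (a true) (b true) * Equiv.swap c d

/-- Three pairs without common members. -/
structure Separate {α : Type*} (a b : Bool → α) (c d : α) : Prop where
  left : Function.Injective a
  right : Function.Injective b
  ne : ∀ l l', a l ≠ b l'
  left_ne : ∀ l, a l ≠ c ∧ a l ≠ d
  right_ne : ∀ l, b l ≠ c ∧ b l ≠ d

theorem Separate.apply_left {α : Type*} [DecidableEq α] {a b : Bool → α} {c d : α}
    (h : Separate a b c d)
    (l : Bool) : swaps a b c d (a l) = b l := by
  obtain ⟨h₁, h₂, h₃, h₄, h₅⟩ := h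
  have e₁ := h₁.ne Bool.false_ne_true
  have e₂ := h₂.ne Bool.false_ne_true
  cases l <;> simp only [swaps, Equiv.Perm.mul_apply, Equiv.swap_apply_def] <;> grind

theorem Separate.apply_right {α : Type*} [DecidableEq α] {a b : Bool → α} {c d : α}
    (h : Separate a b c d)
    (l : Bool) : swaps a b c d (b l) = a l := by
  obtain ⟨h₁, h₂, h₃, h₄, h₅⟩ := h
  have e₁ := h₁.ne Bool.false_ne_true
  have e₂ := h₂.ne Bool.false_ne_true
  cases l <;> simp only [swaps, Equiv.Perm.mul_apply, Equiv.swap_apply_def] <;> grind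

theorem swaps_apply_of_ne {α : Type*} [DecidableEq α] {a b : Bool → α} {c d q : α}
    (ha : ∀ l, q ≠ a l)
    (hb : ∀ l, q ≠ b l) (hac : ∀ l, a l ≠ c ∧ a l ≠ d) (hbc : ∀ l, b l ≠ c ∧ b l ≠ d) :
    swaps a b c d q = Equiv.swap c d q := by
  simp only [swaps, Equiv.Perm.mul_apply, Equiv.swap_apply_def]
  grind

variable (D : VirtualLinkDiagram) {b : Bool → D.Pass} {o : Bool → Bool}

theorem oldPass_injective : Function.Injective D.oldPass :=
  (Sum.inl_injective.prodMap Function.injective_id).sumMap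
    (((Equiv.injective _).prodMap Function.injective_id).sumMap (Equiv.injective _))

theorem inl_ne_oldPass (i l : Bool) (q : D.Pass) : Sum.inl (Sum.inr i, l) ≠ D.oldPass q := by
  rcases q with ⟨c, l⟩ | q <;> simp

/-- The passes through the first of two new crossings. -/
abbrev firstPass (l : Bool) : D.PairPass := Sum.inl (Sum.inr false, l)

/-- In the applications the points are the neighbours of `x` in the triangle, and `c`, `d` are the
passes on the strand that avoids `x`. These two are exchanged in the same way in both diagrams. -/
theorem addPair_exchange {_ : DecidableEq D.Pass} {_ : DecidableEq D.PairPass} (s : Bool)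
    (hb : Function.Injective b) (x : D.Crossing) {c d : D.Pass}
    (h : Separate (fun l => Sum.inl (x, l)) b c d)
    (hn : ∀ l, if o l then D.next (Sum.inl (x, l)) = b l else D.next (b l) = Sum.inl (x, l)) :
    (D.addPairInsertion (o := o) s hb).Exchange x (swaps (fun l => Sum.inl (x, l)) b c d)
      (swaps D.firstPass (D.oldPass ∘ b) (D.oldPass c) (D.oldPass d)) := by
  have hinj := D.oldPass_injective
  have h' : Separate D.firstPass (D.oldPass ∘ b) (D.oldPass c) (D.oldPass d) :=
    { left := fun l l' e => by simpa using e
      right := hinj.comp hb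
      ne := fun l l' => D.inl_ne_oldPass _ _ _
      left_ne := fun l => ⟨D.inl_ne_oldPass _ _ _, D.inl_ne_oldPass _ _ _⟩
      right_ne := fun l => ⟨hinj.ne (h.right_ne l).1, hinj.ne (h.right_ne l).2⟩ }
  have key : ∀ q, (∀ l, q ≠ D.firstPass l) → (∀ l, q ≠ D.oldPass (b l)) →
      swaps D.firstPass (D.oldPass ∘ b) (D.oldPass c) (D.oldPass d) q =
        Equiv.swap (D.oldPass c) (D.oldPass d) q :=
    fun q h₁ h₂ => swaps_apply_of_ne h₁ h₂ h'.left_ne h'.right_ne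
  exact
    { next_eq := hn
      point_injective := hb
      point_ne := fun l l' => (h.ne l' l).symm
      apply_crossing := h.apply_left
      apply_point := h.apply_right
      apply_first := h'.apply_left
      apply_second := fun l => by
        refine (key _ (fun l' => by simp) fun l' => D.inl_ne_oldPass _ _ _).trans ?_
        exact Equiv.swap_apply_of_ne_of_ne (D.inl_ne_oldPass _ _ _) (D.inl_ne_oldPass _ _ _)
      apply_pass_point := h'.apply_right
      apply_pass_crossing := fun l => by
        refine (key _ (fun l' => (D.inl_ne_oldPass _ _ _).symm) fun l' => hinj.ne (h.ne _ _)).trans ?_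
        exact Equiv.swap_apply_of_ne_of_ne (hinj.ne (h.left_ne l).1) (hinj.ne (h.left_ne l).2)
      apply_pass := fun q h₁ h₂ => by
        refine (key _ (fun l' => (D.inl_ne_oldPass _ _ _).symm) fun l' => hinj.ne (h₂ l')).trans ?_
        exact (hinj.map_swap _ _ _).symm.trans (congrArg D.oldPass
          (swaps_apply_of_ne (a := fun l => Sum.inl (x, l)) h₁ h₂ h.left_ne h.right_ne).symm) }

/-- The configuration of the third Reidemeister move. -/
structure IsTriangle (ij ik jk : D.Crossing) (oi oj ok : Bool) : Prop where
  ne₁ : ij ≠ ik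
  ne₂ : ij ≠ jk
  ne₃ : ik ≠ jk
  sign₁ : D.positive ij = D.positive ik ↔ oj = ok
  sign₂ : D.positive ij = D.positive jk ↔ oi = ok
  sign₃ : D.positive ik = D.positive jk ↔ oi = oj
  hi : if oi then D.next (D.lower ij) = D.lower ik else D.next (D.lower ik) = D.lower ij
  hj : if oj then D.next (D.upper ij) = D.lower jk else D.next (D.lower jk) = D.upper ij
  hk : if ok then D.next (D.upper ik) = D.upper jk else D.next (D.upper jk) = D.upper ik

open Classical in
/-- The permutation of the passes in the third Reidemeister move. -/
noncomputable abbrev thirdPerm (ij ik jk : D.Crossing) : Equiv.Perm D.Pass :=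
  Equiv.swap (D.lower ij) (D.lower ik) * Equiv.swap (D.upper ij) (D.lower jk) *
    Equiv.swap (D.upper ik) (D.upper jk)

/-- The value of `Φ` does not change under third Reidemeister moves with the given orientations of
the strands and the given sign of the first crossing. -/
def ThirdInvariant {α : Type*} (Φ : VirtualLinkDiagram → α) (oi oj ok s : Bool) : Prop :=
  ∀ (D : VirtualLinkDiagram) (ij ik jk : D.Crossing), D.IsTriangle ij ik jk oi oj ok →
    D.positive ij = s → Φ D = Φ (D.rename (D.thirdPerm ij ik jk))

theorem addPair_next (s : Bool) (hb : Function.Injective b) (l : Bool) :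
    if o l then (D.addPair (o := o) s hb).next (D.oldPass (b l)) = D.firstPass l else
      (D.addPair (o := o) s hb).next (D.firstPass l) = D.oldPass (b l) := by
  cases hl : o l
  · exact (D.addPairInsertion (o := o) s hb).next_first_of_before hl
  · exact (D.addPairInsertion (o := o) s hb).next_point l hl

theorem addPair_next_oldPass (s : Bool) (hb : Function.Injective b) {c d : D.Pass}
    (hc : ∀ l, b l ≠ c ∧ b l ≠ d) (hcd : D.next c = d) :
    (D.addPair (o := o) s hb).next (D.oldPass c) = D.oldPass d := by
  refine ((D.addPairInsertion (o := o) s hb).next_enter c fun l _ => (hc l).1.symm).trans ?_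
  rw [hcd]
  exact D.pairEnter_of_ne d fun l _ => (hc l).2.symm

variable {α : Type*} {Φ : VirtualLinkDiagram → α} {oi oj ok s : Bool}

-- The three transpositions are disjoint and commute, so any crossing of the triangle can be singled
-- out as the `x` of an exchange. For `ij` the definition already has this form.
open Classical in
theorem thirdPerm_eq₂ {ij ik jk : D.Crossing} (h₁ : ij ≠ ik) (h₂ : ij ≠ jk) (h₃ : ik ≠ jk) :
    D.thirdPerm ij ik jk = swaps (fun l => Sum.inl (ik, l))
      (fun l => if l then D.upper jk else D.lower ij) (D.upper ij) (D.lower jk) := by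
  change Equiv.swap (D.lower ij) (D.lower ik) * Equiv.swap (D.upper ij) (D.lower jk) *
    Equiv.swap (D.upper ik) (D.upper jk) = Equiv.swap (D.lower ik) (D.lower ij) *
      Equiv.swap (D.upper ik) (D.upper jk) * Equiv.swap (D.upper ij) (D.lower jk)
  rw [mul_assoc, Equiv.swap_mul_swap_comm (a := D.upper ij), ← mul_assoc,
    Equiv.swap_comm (D.lower ij)] <;> simp [h₁, h₂, h₃.symm]

open Classical in
theorem thirdPerm_eq₃ {ij ik jk : D.Crossing} (h₁ : ij ≠ ik) (h₂ : ij ≠ jk) (h₃ : ik ≠ jk) :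
    D.thirdPerm ij ik jk = swaps (fun l => Sum.inl (jk, l))
      (fun l => if l then D.upper ik else D.upper ij) (D.lower ij) (D.lower ik) := by
  change Equiv.swap (D.lower ij) (D.lower ik) * Equiv.swap (D.upper ij) (D.lower jk) *
    Equiv.swap (D.upper ik) (D.upper jk) = Equiv.swap (D.lower jk) (D.upper ij) *
      Equiv.swap (D.upper jk) (D.upper ik) * Equiv.swap (D.lower ij) (D.lower ik)
  rw [Equiv.swap_comm (D.lower jk), Equiv.swap_comm (D.upper jk),
    Equiv.swap_mul_swap_comm (a := D.lower ij), mul_assoc,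
    Equiv.swap_mul_swap_comm (a := D.lower ij), ← mul_assoc] <;> simp [h₁, h₂, h₃]

/-- A cancelling pair is inserted on the far side of the triangle from `ij`, next to `ik` on the
strand `i` and next to `jk` on the strand `j`. Its first crossing forms with `ik` and `jk` a
triangle in which `i` and `j` are reversed and the crossing of `i` and `j` has the opposite sign.
`Exchange.apply_eq` carries the move over. -/
theorem ThirdInvariant.flip₁ (hΦ : SecondInvariant Φ) (h : ThirdInvariant Φ (!oi) (!oj) ok (!s)) :
    ThirdInvariant Φ oi oj ok s := by
  rintro D ij ik jk t rfl
  have h₁ := t.ne₁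
  have h₂ := t.ne₂
  have h₃ := t.ne₃
  let b : Bool → D.Pass := fun l => if l then D.lower jk else D.lower ik
  let o : Bool → Bool := fun l => if l then oj else oi
  have hsep : Separate (fun l => Sum.inl (ij, l)) b (D.upper ik) (D.upper jk) := by
    constructor <;> simp [b, Function.Injective, h₁, h₂, h₃, h₃.symm]
  have hn := D.addPair_next (o := o) (D.positive ij) hsep.right
  have hold := fun c d =>
    D.addPair_next_oldPass (o := o) (D.positive ij) hsep.right (c := c) (d := d)
  have hE : (D.addPair (o := o) (D.positive ij) hsep.right).IsTriangle
      (Sum.inr false) (Sum.inl ik) (Sum.inl jk)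
      (!oi) (!oj) ok := by
    constructor
    · simp
    · simp
    · simp [h₃]
    · have := t.sign₁
      revert this
      simp
      cases D.positive ij <;> cases D.positive ik <;> cases oj <;> cases ok <;> simp
    · have := t.sign₂
      revert this
      simp
      cases D.positive ij <;> cases D.positive jk <;> cases oi <;> cases ok <;> simp
    · have := t.sign₃
      revert this
      simp
    · have := hn false
      cases oi <;> exact this
    · have := hn true
      cases oj <;> exact this
    · have := t.hk
      cases ok
      · exact hold _ _ (fun l => (hsep.right_ne l).symm) this
      · exact hold _ _ hsep.right_ne this
  have key := h _ _ _ _ hE (by simp)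
  refine (D.addPair_exchange (o := o) (D.positive ij) hsep.right ij hsep ?_).apply_eq _
    (by simp [addPairInsertion]) hΦ key
  rintro (_ | _)
  · have := t.hi
    cases oi <;> exact this
  · have := t.hj
    cases oj <;> exact this

/-- The argument of `flip₁` with the pair inserted opposite to `ik`; now `i` and `k` are reversed,
and `ij` keeps its sign. -/
theorem ThirdInvariant.flip₂ (hΦ : SecondInvariant Φ) (h : ThirdInvariant Φ (!oi) oj (!ok) s) :
    ThirdInvariant Φ oi oj ok s := by
  rintro D ij ik jk t rfl
  have h₁ := t.ne₁
  have h₂ := t.ne₂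
  have h₃ := t.ne₃
  let b : Bool → D.Pass := fun l => if l then D.upper jk else D.lower ij
  -- This tells whether the neighbour comes after the pass through `ik`. On the strand `i` the
  -- neighbour `ij` comes before `ik` when `oi` holds, hence the negation.
  let o : Bool → Bool := fun l => if l then ok else !oi
  have hsep : Separate (fun l => Sum.inl (ik, l)) b (D.upper ij) (D.lower jk) := by
    constructor <;> simp [b, Function.Injective, h₁.symm, h₂, h₂.symm, h₃]
  have hn := D.addPair_next (o := o) (D.positive ik) hsep.right
  have hold := fun c d =>
    D.addPair_next_oldPass (o := o) (D.positive ik) hsep.right (c := c) (d := d)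
  have hE : (D.addPair (o := o) (D.positive ik) hsep.right).IsTriangle
      (Sum.inl ij) (Sum.inr false) (Sum.inl jk)
      (!oi) oj (!ok) := by
    constructor
    · simp
    · simp [h₂]
    · simp
    · have := t.sign₁
      revert this
      simp
      cases D.positive ij <;> cases D.positive ik <;> cases oj <;> cases ok <;> simp
    · have := t.sign₂
      revert this
      simp
    · have := t.sign₃
      revert this
      simp
      cases D.positive ik <;> cases D.positive jk <;> cases oi <;> cases oj <;> simp
    · have := hn false
      cases oi <;> exact this
    · have := t.hj
      cases oj
      · exact hold _ _ (fun l => (hsep.right_ne l).symm) this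
      · exact hold _ _ hsep.right_ne this
    · have := hn true
      cases ok <;> exact this
  have key := h _ _ _ _ hE (by simp)
  rw [D.thirdPerm_eq₂ h₁ h₂ h₃]
  rw [thirdPerm_eq₂ _ hE.ne₁ hE.ne₂ hE.ne₃] at key
  refine (D.addPair_exchange (o := o) (D.positive ik) hsep.right ik hsep ?_).apply_eq _
    (by simp [addPairInsertion]) hΦ key
  rintro (_ | _)
  · have := t.hi
    cases oi <;> exact this
  · have := t.hk
    cases ok <;> exact this

/-- The argument of `flip₁` with the pair inserted opposite to `jk`. It precedes both of its
neighbours in the numbering of the strands' crossings reversed, so both orientations are negated in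
`o`. -/
theorem ThirdInvariant.flip₃ (hΦ : SecondInvariant Φ) (h : ThirdInvariant Φ oi (!oj) (!ok) s) :
    ThirdInvariant Φ oi oj ok s := by
  rintro D ij ik jk t rfl
  have h₁ := t.ne₁
  have h₂ := t.ne₂
  have h₃ := t.ne₃
  let b : Bool → D.Pass := fun l => if l then D.upper ik else D.upper ij
  let o : Bool → Bool := fun l => if l then !ok else !oj
  have hsep : Separate (fun l => Sum.inl (jk, l)) b (D.lower ij) (D.lower ik) := by
    constructor <;> simp [b, Function.Injective, h₁, h₁.symm, h₂.symm, h₃.symm]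
  have hn := D.addPair_next (o := o) (D.positive jk) hsep.right
  have hold := fun c d =>
    D.addPair_next_oldPass (o := o) (D.positive jk) hsep.right (c := c) (d := d)
  have hE : (D.addPair (o := o) (D.positive jk) hsep.right).IsTriangle
      (Sum.inl ij) (Sum.inl ik) (Sum.inr false)
      oi (!oj) (!ok) := by
    constructor
    · simp [h₁]
    · simp
    · simp
    · have := t.sign₁
      revert this
      simp
    · have := t.sign₂
      revert this
      simp
      cases D.positive ij <;> cases D.positive jk <;> cases oi <;> cases ok <;> simp
    · have := t.sign₃
      revert this
      simp
      cases D.positive ik <;> cases D.positive jk <;> cases oi <;> cases oj <;> simp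
    · have := t.hi
      cases oi
      · exact hold _ _ (fun l => (hsep.right_ne l).symm) this
      · exact hold _ _ hsep.right_ne this
    · have := hn false
      cases oj <;> exact this
    · have := hn true
      cases ok <;> exact this
  have key := h _ _ _ _ hE (by simp)
  rw [D.thirdPerm_eq₃ h₁ h₂ h₃]
  rw [thirdPerm_eq₃ _ hE.ne₁ hE.ne₂ hE.ne₃] at key
  refine (D.addPair_exchange (o := o) (D.positive jk) hsep.right jk hsep ?_).apply_eq _
    (by simp [addPairInsertion]) hΦ key
  rintro (_ | _)
  · have := t.hj
    cases oj <;> exact this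
  · have := t.hk
    cases ok <;> exact this

end VirtualLinkDiagram

/-! ### Inverse third moves, and the case that is computed -/

namespace VirtualLinkDiagram

theorem Separate.swaps_mul_self {α : Type*} [DecidableEq α] {a b : Bool → α} {c d : α}
    (h : Separate a b c d) : swaps a b c d * swaps a b c d = 1 := by
  ext q
  rw [Equiv.Perm.mul_apply, Equiv.Perm.one_apply]
  by_cases ha : ∃ l, q = a l
  · obtain ⟨l, rfl⟩ := ha
    rw [h.apply_left, h.apply_right]
  by_cases hb : ∃ l, q = b l
  · obtain ⟨l, rfl⟩ := hb
    rw [h.apply_right, h.apply_left]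
  have ha : ∀ l, q ≠ a l := fun l hl => ha ⟨l, hl⟩
  have hb : ∀ l, q ≠ b l := fun l hl => hb ⟨l, hl⟩
  rw [swaps_apply_of_ne ha hb h.left_ne h.right_ne,
    swaps_apply_of_ne _ _ h.left_ne h.right_ne, Equiv.swap_apply_self]
  · intro l hl
    rw [Equiv.swap_apply_eq_iff,
      Equiv.swap_apply_of_ne_of_ne (h.left_ne l).1 (h.left_ne l).2] at hl
    exact ha l hl
  · intro l hl
    rw [Equiv.swap_apply_eq_iff,
      Equiv.swap_apply_of_ne_of_ne (h.right_ne l).1 (h.right_ne l).2] at hl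
    exact hb l hl

variable {D : VirtualLinkDiagram} {ij ik jk : D.Crossing}

theorem separate_third (h₁ : ij ≠ ik) (h₂ : ij ≠ jk) (h₃ : ik ≠ jk) :
    Separate (fun l => Sum.inl (ij, l)) (fun l => if l then D.lower jk else D.lower ik)
      (D.upper ik) (D.upper jk) := by
  constructor <;> simp [Function.Injective, h₁, h₂, h₃, h₃.symm]

section

open Classical

theorem thirdPerm_lower_ij (h₁ : ij ≠ ik) (h₂ : ij ≠ jk) (h₃ : ik ≠ jk) :
    D.thirdPerm ij ik jk (D.lower ij) = D.lower ik :=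
  (separate_third h₁ h₂ h₃).apply_left false

theorem thirdPerm_upper_ij (h₁ : ij ≠ ik) (h₂ : ij ≠ jk) (h₃ : ik ≠ jk) :
    D.thirdPerm ij ik jk (D.upper ij) = D.lower jk :=
  (separate_third h₁ h₂ h₃).apply_left true

theorem thirdPerm_lower_ik (h₁ : ij ≠ ik) (h₂ : ij ≠ jk) (h₃ : ik ≠ jk) :
    D.thirdPerm ij ik jk (D.lower ik) = D.lower ij :=
  (separate_third h₁ h₂ h₃).apply_right false

theorem thirdPerm_lower_jk (h₁ : ij ≠ ik) (h₂ : ij ≠ jk) (h₃ : ik ≠ jk) :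
    D.thirdPerm ij ik jk (D.lower jk) = D.upper ij :=
  (separate_third h₁ h₂ h₃).apply_right true

theorem thirdPerm_of_ne (h₁ : ij ≠ ik) (h₂ : ij ≠ jk) (h₃ : ik ≠ jk) {q : D.Pass}
    (hij : ∀ l, q ≠ Sum.inl (ij, l))
    (hik : q ≠ D.lower ik) (hjk : q ≠ D.lower jk) :
    D.thirdPerm ij ik jk q = Equiv.swap (D.upper ik) (D.upper jk) q :=
  swaps_apply_of_ne (a := fun l => Sum.inl (ij, l))
    (b := fun l => if l then D.lower jk else D.lower ik) hij
    (by rintro (_ | _) <;> assumption) (separate_third h₁ h₂ h₃).left_ne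
    (separate_third h₁ h₂ h₃).right_ne

theorem thirdPerm_upper_ik (h₁ : ij ≠ ik) (h₂ : ij ≠ jk) (h₃ : ik ≠ jk) :
    D.thirdPerm ij ik jk (D.upper ik) = D.upper jk := by
  rw [thirdPerm_of_ne h₁ h₂ h₃ _ (by simp) (by simp), Equiv.swap_apply_left]
  simp [h₁.symm]

theorem thirdPerm_upper_jk (h₁ : ij ≠ ik) (h₂ : ij ≠ jk) (h₃ : ik ≠ jk) :
    D.thirdPerm ij ik jk (D.upper jk) = D.upper ik := by
  rw [thirdPerm_of_ne h₁ h₂ h₃ _ (by simp) (by simp), Equiv.swap_apply_right]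
  simp [h₂.symm]

end

variable {α : Type*} {Φ : VirtualLinkDiagram → α} {oi oj ok s : Bool}

-- A third move exchanges the passes on all three strands. Its result is therefore a triangle with
-- all strands reversed, and the same permutation, being an involution, undoes it.
open Classical in
theorem ThirdInvariant.reverse (h : ThirdInvariant Φ (!oi) (!oj) (!ok) s) :
    ThirdInvariant Φ oi oj ok s := by
  rintro D ij ik jk t rfl
  have h₁ := t.ne₁
  have h₂ := t.ne₂
  have h₃ := t.ne₃
  let τ := D.thirdPerm ij ik jk
  have hτ : τ * τ = 1 := (separate_third h₁ h₂ h₃).swaps_mul_self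
  have hnext : ∀ {q r q' r'}, D.next q = r → τ q = q' → τ r = r' →
      (D.withNext (τ * D.next * τ⁻¹)).next q' = r' := by
    rintro q r q' r' rfl rfl rfl
    exact Insertion.withNext_apply τ q
  have key := h (D.withNext (τ * D.next * τ⁻¹)) ij ik jk
    { ne₁ := h₁
      ne₂ := h₂
      ne₃ := h₃
      sign₁ := t.sign₁.trans (by simp)
      sign₂ := t.sign₂.trans (by simp)
      sign₃ := t.sign₃.trans (by simp)
      hi := by
        have := t.hi
        cases oi
        · exact hnext this (thirdPerm_lower_ik h₁ h₂ h₃) (thirdPerm_lower_ij h₁ h₂ h₃)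
        · exact hnext this (thirdPerm_lower_ij h₁ h₂ h₃) (thirdPerm_lower_ik h₁ h₂ h₃)
      hj := by
        have := t.hj
        cases oj
        · exact hnext this (thirdPerm_lower_jk h₁ h₂ h₃) (thirdPerm_upper_ij h₁ h₂ h₃)
        · exact hnext this (thirdPerm_upper_ij h₁ h₂ h₃) (thirdPerm_lower_jk h₁ h₂ h₃)
      hk := by
        have := t.hk
        cases ok
        · exact hnext this (thirdPerm_upper_jk h₁ h₂ h₃) (thirdPerm_upper_ik h₁ h₂ h₃)
        · exact hnext this (thirdPerm_upper_ik h₁ h₂ h₃) (thirdPerm_upper_jk h₁ h₂ h₃) } rfl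
  refine ((congrArg Φ ?_).trans key.symm)
  change D.withNext D.next = D.withNext (τ * (τ * D.next * τ⁻¹) * τ⁻¹)
  have hτ' : τ⁻¹ = τ := inv_eq_of_mul_eq_one_left hτ
  congr 1
  rw [hτ']
  calc D.next = (τ * τ) * D.next * (τ * τ) := by rw [hτ, one_mul, mul_one]
    _ = τ * (τ * D.next * τ) * τ := by simp only [mul_assoc]

/-- All third Reidemeister moves can be reduced to one of them by second moves. -/
theorem ThirdInvariant.all (hΦ : SecondInvariant Φ) (h : ThirdInvariant Φ true true true true)
    (oi oj ok s : Bool) : ThirdInvariant Φ oi oj ok s := by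
  have h₁ : ∀ s, ThirdInvariant Φ true true true s := by
    rintro (_ | _)
    -- Each strand is reversed twice, while the sign of the first crossing changes once.
    · exact flip₁ hΦ (flip₂ hΦ (flip₃ hΦ h))
    · exact h
  -- Flips reverse two strands at a time and so reach only half of the orientations. The other half
  -- is obtained by `reverse`, which reverses all three.
  have h₂ : ∀ oi oj, ThirdInvariant Φ oi oj (oi == oj) s := by
    rintro (_ | _) (_ | _)
    · exact flip₂ hΦ (flip₃ hΦ (h₁ s))
    · exact flip₂ hΦ (h₁ s)
    · exact flip₃ hΦ (h₁ s)
    · exact h₁ s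
  by_cases hk : ok = (oi == oj)
  · rw [hk]
    exact h₂ oi oj
  · refine reverse ?_
    have : (!ok) = ((!oi) == (!oj)) := by
      revert hk
      cases oi <;> cases oj <;> cases ok <;> simp
    rw [this]
    exact h₂ _ _

-- If all strands point upwards, the sign conditions make all crossings equal in sign, so that they
-- are positive and form the pattern `triangle false`.
open Classical StrandPattern in
theorem thirdInvariant_stateSums {j : Version} {R M X : Type*} [CommRing R] [AddCommGroup M]
    [Module R M] [Biquandle X] [Fintype X] (I : PictureInvariant j R M)
    (k : Bool → Smoothing → X → X → R) (hk : SkeinRelations j I.δ k) :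
    ThirdInvariant (fun D => D.stateSums I k) true true true true := by
  intro D ij ik jk t hpos
  have h₁ := t.ne₁
  have h₂ := t.ne₂
  have h₃ := t.ne₃
  let κ : Fin 3 ↪ D.Crossing := ⟨![ij, ik, jk], by
    intro x y hxy
    fin_cases x <;> fin_cases y <;> simp_all⟩
  refine stateSums_triangle I k hk (κ := κ) ?_ ?_ ?_
  · constructor
    · intro s i
      fin_cases s <;> cases i
      · exact thirdPerm_lower_ij h₁ h₂ h₃
      · exact thirdPerm_lower_ik h₁ h₂ h₃
      · exact thirdPerm_upper_ij h₁ h₂ h₃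
      · exact thirdPerm_lower_jk h₁ h₂ h₃
      · exact thirdPerm_upper_ik h₁ h₂ h₃
      · exact thirdPerm_upper_jk h₁ h₂ h₃
    · intro q hq
      have hne : ∀ x b, q ≠ Sum.inl (κ x, b) := fun x b h => hq ⟨(x, b), h.symm⟩
      rw [thirdPerm_of_ne h₁ h₂ h₃ (hne 0) (hne 1 false) (hne 2 false)]
      exact Equiv.swap_apply_of_ne_of_ne (hne 1 true) (hne 2 true)
  · intro s
    fin_cases s
    · exact t.hi
    · exact t.hj
    · exact t.hk
  · have e₁ := t.sign₁.2 rfl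
    have e₂ := t.sign₂.2 rfl
    intro c
    fin_cases c
    · exact hpos
    · exact e₁.symm.trans hpos
    · exact e₂.symm.trans hpos

end VirtualLinkDiagram

/-! ### Relations in the coefficient rings -/

namespace BracketRing

variable {X : Type*} [Biquandle X] {j : Version}

theorem mk_gens₁ (j : Version) (x : X) :
    ∀ p ∈ gens₁ x j, Ideal.Quotient.mk (relations X j) p = 0 := fun _ hp =>
  Ideal.Quotient.eq_zero_iff_mem.2 (Ideal.subset_span
    (Or.inl (Or.inl (Set.mem_iUnion.2 ⟨x, hp⟩))))

theorem mk_gens₂ (j : Version) (x y : X) :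
    ∀ p ∈ gens₂ x y j, Ideal.Quotient.mk (relations X j) p = 0 := fun _ hp =>
  Ideal.Quotient.eq_zero_iff_mem.2 (Ideal.subset_span
    (Or.inl (Or.inr (Set.mem_iUnion₂.2 ⟨x, y, hp⟩))))

theorem mk_gens₃ (j : Version) (x y z : X) :
    ∀ p ∈ gens₃ x y z j, Ideal.Quotient.mk (relations X j) p = 0 := fun _ hp =>
  Ideal.Quotient.eq_zero_iff_mem.2 (Ideal.subset_span
    (Or.inr (Set.mem_iUnion.2 ⟨x, Set.mem_iUnion₂.2 ⟨y, z, hp⟩⟩)))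

/-- The class of the coefficient of a smoothing in the coefficient ring. -/
noncomputable def coefficient (j : Version) (b : Bool) (s : Smoothing) (x y : X) :
    BracketRing X j :=
  Ideal.Quotient.mk (relations X j) (skein b s x y)

/-- The value of a circle in the coefficient ring. -/
noncomputable def circle (X : Type*) [Biquandle X] (j : Version) : BracketRing X j :=
  Ideal.Quotient.mk (relations X j) δ

-- Every relation is a combination of generators. Version one lists certain products as zero one by
-- one; adding these to its shorter relations gives the relations in the form common to both
-- versions.
open VirtualLinkDiagram in
theorem skeinRelations (X : Type*) [Biquandle X] (j : Version) :
    SkeinRelations j (circle X j) (coefficient (X := X) j) where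
  kink b x := by
    have h := mk_gens₁ j x
    cases j <;> cases b <;>
      simp only [gens₁, Set.forall_mem_insert, Set.mem_singleton_iff, forall_eq, map_sub, map_add,
        map_mul, map_one] at h <;> simp only [circle, coefficient, skein]
    · linear_combination h.2.1 + h.2.2.2
    · linear_combination h.1 + h.2.2.1
    · linear_combination h.2
    · linear_combination h.1
  kink_one := by
    rintro rfl b x
    have h := mk_gens₁ Version.one x
    simp only [gens₁, Set.forall_mem_insert, Set.mem_singleton_iff, forall_eq] at h
    cases b
    · exact h.2.2.2
    · exact h.2.2.1
  clasp b x y := by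
    have h := mk_gens₂ j x y
    cases j
    · simp only [gens₂, Set.forall_mem_insert, Set.mem_singleton_iff, forall_eq, map_sub, map_add,
        map_mul, map_one] at h
      obtain ⟨h₁, h₂, h₃, h₄, h₅, h₆, h₇⟩ := h
      cases b <;> constructor <;> (try intro) <;>
        simp only [circle, coefficient, skein, Bool.not_true, Bool.not_false]
      · linear_combination h₆
      · linear_combination h₅
      · linear_combination h₇
      · linear_combination h₁ + h₂
      · linear_combination h₃ + h₄
      · refine ⟨⟨?_, ?_⟩, ?_, ?_⟩
        · linear_combination h₂
        · linear_combination h₁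
        · linear_combination h₄
        · linear_combination h₃
      · linear_combination h₆
      · linear_combination h₅
      · linear_combination h₇
      · linear_combination h₁ + h₂
      · linear_combination h₃ + h₄
      · exact ⟨⟨h₁, h₂⟩, h₃, h₄⟩
    · simp only [gens₂, Set.forall_mem_insert, Set.mem_singleton_iff, forall_eq, map_sub, map_add,
        map_mul, map_one] at h
      obtain ⟨h₁, h₂, h₃, h₄, h₅⟩ := h
      cases b <;> constructor <;> (try exact fun e => nomatch e) <;>
        simp only [circle, coefficient, skein, Bool.not_true, Bool.not_false]
      · linear_combination h₄
      · linear_combination h₃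
      · linear_combination h₅
      · linear_combination h₁
      · linear_combination h₂
      · linear_combination h₄
      · linear_combination h₃
      · linear_combination h₅
      · linear_combination h₁
      · linear_combination h₂
  triangle x y z := by
    have h := mk_gens₃ j x y z
    cases j
    · simp only [gens₃, gens₃Common, lhs, rhs, Set.mem_union, or_imp, forall_and,
        Set.forall_mem_insert, Set.mem_singleton_iff, forall_eq, map_sub, map_add,
        map_mul] at h
      obtain ⟨⟨h₁, h₂, h₃, h₄, h₅, h₆, h₇, h₈, h₉, i₁, i₂, i₃, i₄, i₅⟩,
        a₁, a₂, a₃, a₄, a₅, a₆, a₇, a₈⟩ := h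
      constructor <;> (try intro) <;> simp only [circle, coefficient, skein]
      · linear_combination h₁
      · linear_combination h₂
      · linear_combination h₃
      · linear_combination h₄
      · linear_combination h₅
      · linear_combination h₆
      · linear_combination h₇
      · linear_combination h₈
      · linear_combination h₉
      · linear_combination i₁
      · linear_combination i₂
      · linear_combination i₃
      · linear_combination i₄
      · linear_combination i₅
      -- The terms that stand for loops are missing in the generator of version one; they are zero
      -- there.
      · linear_combination a₇ - a₄ - a₅ - a₆
      · linear_combination a₈ - a₁ - a₂ - a₃
      · exact ⟨a₁, a₂, a₃, a₄, a₅, a₆⟩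
    · simp only [gens₃, gens₃Common, lhs, rhs, Set.mem_union, or_imp, forall_and,
        Set.forall_mem_insert, Set.mem_singleton_iff, forall_eq, map_sub, map_add,
        map_mul] at h
      obtain ⟨⟨h₁, h₂, h₃, h₄, h₅, h₆, h₇, h₈, h₉, i₁, i₂, i₃, i₄, i₅⟩, a₁, a₂⟩ := h
      constructor <;> (try exact fun e => nomatch e) <;> simp only [circle, coefficient, skein]
      · linear_combination h₁
      · linear_combination h₂
      · linear_combination h₃
      · linear_combination h₄
      · linear_combination h₅
      · linear_combination h₆
      · linear_combination h₇
      · linear_combination h₈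
      · linear_combination h₉
      · linear_combination i₁
      · linear_combination i₂
      · linear_combination i₃
      · linear_combination i₄
      · linear_combination i₅
      · linear_combination a₁
      · linear_combination a₂

end BracketRing

/-! ### Application to the bracket -/

/-- The classes in the module of pictures. -/
noncomputable def pictureInvariant (X : Type*) [Biquandle X] (j : Version) :
    PictureInvariant j (BracketRing X j) (PictureModule X j) where
  toFun := picture X j
  δ := BracketRing.circle X j
  move {G G'} h := by
    rw [picture, picture, ← sub_eq_zero, ← map_sub]
    exact (Submodule.Quotient.mk_eq_zero _).2 (Submodule.subset_span (Or.inl ⟨G, G', h, rfl⟩))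
  circle G h := by
    rw [picture, picture, ← map_smul, ← sub_eq_zero, ← map_sub]
    refine (Submodule.Quotient.mk_eq_zero _).2 (Submodule.subset_span (Or.inr ⟨G, h, ?_⟩))
    simp [BracketRing.circle]

namespace VirtualLinkDiagram

variable {X : Type*} [Biquandle X]

theorem bracket_eq_stateSum (D : VirtualLinkDiagram) (j : Version) (f : D.Pass → X) :
    D.bracket j f =
      D.stateSum (pictureInvariant X j) (D.weight (BracketRing.coefficient j) f) := by
  refine Finset.sum_congr rfl fun s _ => ?_
  rw [map_prod]
  rfl

theorem bracketMultiset_eq_stateSums [Fintype X] (D : VirtualLinkDiagram) (j : Version) :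
    D.bracketMultiset X j =
      D.stateSums (pictureInvariant X j) (BracketRing.coefficient j) :=
  Multiset.map_congr rfl fun f _ => D.bracket_eq_stateSum j f.1

theorem Move.bracketMultiset_eq [Fintype X] (j : Version) {D D' : VirtualLinkDiagram}
    (h : Move D D') : D.bracketMultiset X j = D'.bracketMultiset X j := by
  have hk := BracketRing.skeinRelations X j
  let I := pictureInvariant X j
  rw [bracketMultiset_eq_stateSums, bracketMultiset_eq_stateSums]
  cases h with
  | detour d => exact stateSums_detour I _ d
  | omega₁ c hc d => exact stateSums_kink I _ hk c hc d
  | omega₂ c₁ c₂ sign hover hunder d => exact stateSums_clasp I _ hk c₁ c₂ sign hover hunder d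
  | omega₃ ij ik jk oi oj ok h₁ h₂ h₃ sign₁ sign₂ sign₃ hi hj hk' =>
    -- Invariance under second moves is an ingredient of the proof for third moves.
    have hΦ : SecondInvariant fun D => D.stateSums I (BracketRing.coefficient j) :=
      fun _ _ c₁ c₂ sign hover hunder d => stateSums_clasp I _ hk c₁ c₂ sign hover hunder d
    exact ThirdInvariant.all hΦ (thirdInvariant_stateSums I _ hk) oi oj ok _ D ij ik jk
      ⟨h₁, h₂, h₃, sign₁, sign₂, sign₃, hi, hj, hk'⟩ rfl

end VirtualLinkDiagram

theorem mainTheorem1 {X : Type*} [Biquandle X] [Fintype X] (j : Version)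
    (L₁ L₂ : VirtualLinkDiagram) (h : L₁.SameLink L₂) :
    L₁.bracketMultiset X j = L₂.bracketMultiset X j := by
  induction h with
  | rel _ _ h => exact h.bracketMultiset_eq j
  | refl _ => rfl
  | symm _ _ _ ih => exact ih.symm
  | trans _ _ _ _ _ ih ih' => exact ih.trans ih'
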